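/- **Theorem.** *Setting.* For a unital C*-algebra $A$, let $K_0(A)$ be the Grothendieck group of the monoid of equivalence classes of idempotent matrices over $A$ (with $e\sim f$ iff $e=xy$, $f=yx$ for some rectangular matrices $x,y$ over $A$; addition is block sum), and let $K_1(A)$ be the group of path components of $GL_\infty(A)=\bigcup_n GL_n(A)$. For a C*-algebra $A$ that need not be unital, with unitization $A^+$, put $K_0(A):=\ker\big(K_0(A^+)\to K_0(\mathbb C)\big)$ and $K_1(A):=K_1(A^+)$. Let $A_1\xleftarrow{p_1}A\xrightarrow{p_2}A_2$ be the pullback of *-homomorphisms $A_1\xrightarrow{\pi_1}A_{12}\xleftarrow{\pi_2}A_2$ of C*-algebras, let $B_1\xleftarrow{q_1}B\xrightarrow{q_2}B_2$ be the pullback of *-homomorphisms $B_1\xrightarrow{\rho_1}B_{12}\xleftarrow{\rho_2}B_2$ of C*-algebras, and assume that $\pi_2$ and $\rho_2$ are surjective. Let $\phi_1:A_1\to B_1$, $\phi_2:A_2\to B_2$, $\phi_{12}:A_{12}\to B_{12}$ be *-homomorphisms with $\phi_{12}\circ\pi_i=\rho_i\circ\phi_i$ for $i=1,2$. (Pullback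 means that $p_1,p_2$ identify $A$ with $\{(x,y)\in A_1\times A_2:\pi_1(x)=\pi_2(y)\}$, and likewise for $B$.) *(I) Unital case.* Assume that all the algebras and *-homomorphisms above are unital. Then: 1. There is a unique unital *-homomorphism $\phi:A\to B$ with $q_i\circ\phi=\phi_i\circ p_i$ for $i=1,2$. 2. There is a unique homomorphism $\partial_{10}:K_1(B_{12})\to K_0(B)$ (the Milnor map) such that for all $n$, all $a\in GL_n(B_{12})$ and all $c,d\in M_n(B_2)$ with $\rho_2(c)=a$ and $\rho_2(d)=a^{-1}$ (entrywise) one has $\partial_{10}([a])=[p_a]-[I_n]$, where $p_a\in M_{2n}(B)$ is the idempotent given by $$q_1(p_a)=\begin{pmatrix}1&0\\0&0\end{pmatrix},\qquad q_2(p_a)=\begin{pmatrix}c(2-dc)d & c(2-dc)(1-dc)\\ (1-dc)d&(1-dc)^2\end{pmatrix}.$$ There is a unique homomorphism $\partial_{01}:K_0(B_{12})\to K_1(B)$ (the Bott map) such that for all $k$, all projections $p\in M_k(B_{12})$ and all selfadjoint $Q\in M_k(B_2)$ with $\rho_2(Q)=p$ one has $\partial_{01}([p])=[w]$, where $w\in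 GL_k(B)$ is given by $q_1(w)=I_k$ and $q_2(w)=e^{2\pi iQ}$. The same holds for the pullback $A$, with $\pi_2,p_1,p_2$ in place of $\rho_2,q_1,q_2$. 3. With these maps, the cyclic six-term sequence $$K_0(B)\xrightarrow{(q_{1*},q_{2*})}K_0(B_1)\oplus K_0(B_2)\xrightarrow{\rho_{2*}-\rho_{1*}}K_0(B_{12})\xrightarrow{\partial_{01}}K_1(B)\xrightarrow{(q_{1*},q_{2*})}K_1(B_1)\oplus K_1(B_2)\xrightarrow{\rho_{2*}-\rho_{1*}}K_1(B_{12})\xrightarrow{\partial_{10}}K_0(B)$$ is exact at all six places, and so is the corresponding sequence for $A$. 4. The maps $\phi_*$, $(\phi_{1*},\phi_{2*})$, $\phi_{12*}$ on $K_0$ and on $K_1$ form a morphism from the six-term sequence of $A$ to that of $B$, i.e. all six squares commute. In particular $$\phi_*\circ\partial_{10}=\partial_{10}\circ\phi_{12*},\qquad \phi_*\circ\partial_{01}=\partial_{01}\circ\phi_{12*}.$$ *(II) General case.* Statements 1–4 also hold for arbitrary C*-algebras and *-homomorphisms (without "unital" in 1), where the connecting maps are the unique homomorphisms $\partial_{10}:K_1(B_{12})\to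 K_0(B)$ and $\partial_{01}:K_0(B_{12})\to K_1(B)$ given by the same formulas over the unitizations: $\partial_{10}([a])=[p_a]-[I_n]$ for all $a\in GL_n(B_{12}^+)$ and all lifts $c,d\in M_n(B_2^+)$ of $a,a^{-1}$, and $\partial_{01}([p]-[s(p)])=[w]$, with $q_1^+(w)=I_k$ and $q_2^+(w)=e^{2\pi iQ}$, for all projections $p\in M_k(B_{12}^+)$ with scalar part $s(p)\in M_k(\mathbb C)$ and all selfadjoint lifts $Q\in M_k(B_2^+)$ of $p$; and likewise for $A$. -/

import Mathlib

noncomputable section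

namespace CStarK

/-! ### Block matrices indexed by initial segments of the natural numbers -/

/-- The block matrix with blocks `a, b, c, d`, with rows and columns indexed by `Fin (n + m)`. -/
def block {A : Type*} {n m : ℕ} (a : Matrix (Fin n) (Fin n) A) (b : Matrix (Fin n) (Fin m) A)
    (c : Matrix (Fin m) (Fin n) A) (d : Matrix (Fin m) (Fin m) A) :
    Matrix (Fin (n + m)) (Fin (n + m)) A :=
  (Matrix.fromBlocks a b c d).submatrix finSumFinEquiv.symm finSumFinEquiv.symm

theorem block_map {A B : Type*} {n m : ℕ} (f : A → B) (a : Matrix (Fin n) (Fin n) A)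
    (b : Matrix (Fin n) (Fin m) A) (c : Matrix (Fin m) (Fin n) A) (d : Matrix (Fin m) (Fin m) A) :
    (block a b c d).map f = block (a.map f) (b.map f) (c.map f) (d.map f) := by
  unfold block
  rw [← Matrix.fromBlocks_map]
  rfl

theorem block_mul {A : Type*} [Ring A] {n m : ℕ} (a a' : Matrix (Fin n) (Fin n) A)
    (b b' : Matrix (Fin n) (Fin m) A) (c c' : Matrix (Fin m) (Fin n) A)
    (d d' : Matrix (Fin m) (Fin m) A) :
    block a b c d * block a' b' c' d' =
      block (a * a' + b * c') (a * b' + b * d') (c * a' + d * c') (c * b' + d * d') := by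
  unfold block
  rw [Matrix.submatrix_mul_equiv, Matrix.fromBlocks_multiply]

theorem block_one {A : Type*} [Ring A] {n m : ℕ} :
    block (1 : Matrix (Fin n) (Fin n) A) 0 0 (1 : Matrix (Fin m) (Fin m) A) = 1 := by
  unfold block
  rw [Matrix.fromBlocks_one, Matrix.submatrix_one_equiv]

/-! ### The group `K₀` of a unital ring -/

/-- An idempotent square matrix of arbitrary finite size over `A`. -/
structure Idem (A : Type*) [Ring A] where
  /-- the size -/
  size : ℕ
  /-- the matrix -/
  mat : Matrix (Fin size) (Fin size) A
  idem : mat * mat = mat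

/-- Algebraic (Murray–von Neumann) equivalence of matrices `e` and `f`, possibly of different
sizes: `e = x y` and `f = y x` for rectangular matrices `x`, `y`. It is used for idempotents. Over a
C⋆-algebra, every idempotent is equivalent to a projection, and projections are equivalent in this
sense if and only if they are Murray–von Neumann equivalent. -/
def MvN {A : Type*} [Ring A] {n m : ℕ} (e : Matrix (Fin n) (Fin n) A)
    (f : Matrix (Fin m) (Fin m) A) : Prop :=
  ∃ (x : Matrix (Fin n) (Fin m) A) (y : Matrix (Fin m) (Fin n) A), x * y = e ∧ y * x = f

theorem MvN.trans {A : Type*} [Ring A] {n m k : ℕ} {e : Matrix (Fin n) (Fin n) A}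
    {f : Matrix (Fin m) (Fin m) A} {g : Matrix (Fin k) (Fin k) A} (he : e * e = e) (hg : g * g = g)
    (h : MvN e f) (h' : MvN f g) : MvN e g := by
  obtain ⟨x, y, h1, h2⟩ := h
  obtain ⟨z, w, h3, h4⟩ := h'
  refine ⟨x * z, w * y, ?_, ?_⟩
  · rw [Matrix.mul_assoc, ← Matrix.mul_assoc z, h3, ← h2, ← Matrix.mul_assoc,
      ← Matrix.mul_assoc, h1, Matrix.mul_assoc, h1, he]
  · rw [Matrix.mul_assoc, ← Matrix.mul_assoc y, h2, ← h3, ← Matrix.mul_assoc,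
      ← Matrix.mul_assoc, h4, Matrix.mul_assoc, h4, hg]

theorem MvN.block {A : Type*} [Ring A] {n m n' m' : ℕ} {e : Matrix (Fin n) (Fin n) A}
    {f : Matrix (Fin m) (Fin m) A} {e' : Matrix (Fin n') (Fin n') A}
    {f' : Matrix (Fin m') (Fin m') A} (h : MvN e e') (h' : MvN f f') :
    MvN (block e 0 0 f) (block e' 0 0 f') := by
  obtain ⟨x, y, h1, h2⟩ := h
  obtain ⟨z, w, h3, h4⟩ := h'
  refine ⟨(Matrix.fromBlocks x 0 0 z).submatrix finSumFinEquiv.symm finSumFinEquiv.symm,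
    (Matrix.fromBlocks y 0 0 w).submatrix finSumFinEquiv.symm finSumFinEquiv.symm, ?_, ?_⟩ <;>
  · rw [Matrix.submatrix_mul_equiv, Matrix.fromBlocks_multiply]
    simp [CStarK.block, h1, h2, h3, h4]

theorem MvN.map {A B : Type*} [Ring A] [Ring B] (f : A →+* B) {n m : ℕ}
    {e : Matrix (Fin n) (Fin n) A} {e' : Matrix (Fin m) (Fin m) A} (h : MvN e e') :
    MvN (e.map f) (e'.map f) := by
  obtain ⟨x, y, h1, h2⟩ := h
  exact ⟨x.map f, y.map f, by rw [← Matrix.map_mul, h1], by rw [← Matrix.map_mul, h2]⟩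

theorem MvN.of_submatrix {A : Type*} [Ring A] {n m : ℕ} {e : Matrix (Fin n) (Fin n) A}
    {f : Matrix (Fin m) (Fin m) A} (hf : f * f = f) (s : Fin n ≃ Fin m)
    (h : e = f.submatrix s s) : MvN e f := by
  refine ⟨f.submatrix s id, f.submatrix id s, ?_, ?_⟩
  · rw [← Matrix.submatrix_mul _ _ s id s Function.bijective_id, hf, h]
  · rw [← Matrix.submatrix_mul _ _ id s id s.bijective, hf, Matrix.submatrix_id_id]

theorem block_comm {A : Type*} [Zero A] {n m : ℕ} (e : Matrix (Fin n) (Fin n) A)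
    (f : Matrix (Fin m) (Fin m) A) : block e 0 0 f = (block f 0 0 e).submatrix
      ((finSumFinEquiv.symm.trans (Equiv.sumComm _ _)).trans finSumFinEquiv)
      ((finSumFinEquiv.symm.trans (Equiv.sumComm _ _)).trans finSumFinEquiv) := by
  ext i j
  obtain ⟨i | i, rfl⟩ := finSumFinEquiv.surjective i <;>
  obtain ⟨j | j, rfl⟩ := finSumFinEquiv.surjective j <;>
  simp [block]

theorem block_assoc {A : Type*} [Zero A] {n m k : ℕ} (e : Matrix (Fin n) (Fin n) A)
    (f : Matrix (Fin m) (Fin m) A) (g : Matrix (Fin k) (Fin k) A) :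
    block (block e 0 0 f) 0 0 g = (block e 0 0 (block f 0 0 g)).submatrix
      (finCongr (Nat.add_assoc n m k)) (finCongr (Nat.add_assoc n m k)) := by
  have h1 (i : Fin n) : Fin.cast (Nat.add_assoc n m k) (Fin.castAdd k (Fin.castAdd m i)) =
    Fin.castAdd (m + k) i := rfl
  have h2 (i : Fin m) : Fin.cast (Nat.add_assoc n m k) (Fin.castAdd k (Fin.natAdd n i)) =
    Fin.natAdd n (Fin.castAdd k i) := rfl
  have h3 (i : Fin k) : Fin.cast (Nat.add_assoc n m k) (Fin.natAdd (n + m) i) =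
    Fin.natAdd n (Fin.natAdd m i) := Fin.ext (Nat.add_assoc _ _ _)
  ext i j
  obtain ⟨i | i, rfl⟩ := finSumFinEquiv.surjective i <;>
  obtain ⟨j | j, rfl⟩ := finSumFinEquiv.surjective j <;>
  (try obtain ⟨i | i, rfl⟩ := finSumFinEquiv.surjective i) <;>
  (try obtain ⟨j | j, rfl⟩ := finSumFinEquiv.surjective j) <;>
  simp [block, h1, h2, h3]

theorem zero_block {A : Type*} [Zero A] {n : ℕ} (o : Matrix (Fin 0) (Fin 0) A)
    (e : Matrix (Fin n) (Fin n) A) : block o 0 0 e =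
      e.submatrix (finCongr (Nat.zero_add n)) (finCongr (Nat.zero_add n)) := by
  have h (i : Fin n) : Fin.cast (Nat.zero_add n) (Fin.natAdd 0 i) = i := Fin.ext (Nat.zero_add _)
  ext i j
  obtain ⟨i | i, rfl⟩ := finSumFinEquiv.surjective i
  · exact i.elim0
  obtain ⟨j | j, rfl⟩ := finSumFinEquiv.surjective j
  · exact j.elim0
  simp only [block, Matrix.submatrix_apply, Matrix.fromBlocks_apply₂₂,
    finSumFinEquiv_apply_right,
    finSumFinEquiv_symm_apply_natAdd, finCongr_apply, h]

instance idemSetoid (A : Type*) [Ring A] : Setoid (Idem A) where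
  r e f := MvN e.mat f.mat
  iseqv :=
    { refl := fun e => ⟨e.mat, e.mat, e.idem, e.idem⟩
      symm := fun ⟨x, y, h, h'⟩ => ⟨y, x, h', h⟩
      trans := fun {e _ g} h h' => MvN.trans e.idem g.idem h h' }

/-- The block sum `e ⊕ f` of two idempotents. -/
def Idem.sum {A : Type*} [Ring A] (e f : Idem A) : Idem A where
  size := e.size + f.size
  mat := block e.mat 0 0 f.mat
  idem := by rw [block_mul]; simp [e.idem, f.idem]

/-- The commutative monoid `V(A)` of equivalence classes of idempotent matrices over `A`. -/
def V (A : Type*) [Ring A] : Type _ := Quotient (idemSetoid A)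

instance (A : Type*) [Ring A] : Zero (V A) := ⟨Quotient.mk _ ⟨0, 0, by simp⟩⟩

instance (A : Type*) [Ring A] : Add (V A) :=
  ⟨Quotient.map₂ Idem.sum fun _ _ h _ _ h' => MvN.block h h'⟩

theorem V.add_comm' {A : Type*} [Ring A] (x y : V A) : x + y = y + x := by
  obtain ⟨e⟩ := x
  obtain ⟨f⟩ := y
  exact Quotient.sound (MvN.of_submatrix (f.sum e).idem _ (block_comm e.mat f.mat))

theorem V.zero_add' {A : Type*} [Ring A] (x : V A) : 0 + x = x := by
  obtain ⟨e⟩ := x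
  exact Quotient.sound (MvN.of_submatrix e.idem _ (zero_block _ e.mat))

/-- Addition in `V(A)` is induced by the block sum. -/
instance (A : Type*) [Ring A] : AddCommMonoid (V A) where
  add_assoc := by
    rintro ⟨e⟩ ⟨f⟩ ⟨g⟩
    exact Quotient.sound
      (MvN.of_submatrix (e.sum (f.sum g)).idem _ (block_assoc e.mat f.mat g.mat))
  zero_add := V.zero_add'
  add_zero x := by rw [V.add_comm', V.zero_add']
  add_comm := V.add_comm'
  nsmul := nsmulRec

/-- The group `K₀(A)` of a unital ring `A`: the Grothendieck group of `V(A)`. -/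
abbrev K0 (A : Type*) [Ring A] : Type _ := Algebra.GrothendieckAddGroup (V A)

/-- The class `[e] ∈ K₀(A)` of an idempotent matrix `e ∈ M_n(A)`. -/
def K0.cls {A : Type*} [Ring A] {n : ℕ} (e : Matrix (Fin n) (Fin n) A) (he : e * e = e) : K0 A :=
  Algebra.GrothendieckAddGroup.of (Quotient.mk _ (⟨n, e, he⟩ : Idem A))

/-- A unital ring homomorphism applied entrywise to an idempotent matrix. -/
def Idem.map {A B : Type*} [Ring A] [Ring B] (f : A →+* B) (e : Idem A) : Idem B where
  size := e.size
  mat := e.mat.map f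
  idem := by rw [← Matrix.map_mul, e.idem]

/-- The homomorphism `V(A) → V(B)` induced by a unital ring homomorphism. -/
def V.map {A B : Type*} [Ring A] [Ring B] (f : A →+* B) : V A →+ V B where
  toFun := Quotient.map (Idem.map f) fun _ _ h => MvN.map f h
  map_zero' := Quotient.sound (MvN.of_submatrix (by simp) (Equiv.refl (Fin 0))
    (by ext i; exact i.elim0))
  map_add' := by
    rintro ⟨e⟩ ⟨e'⟩
    refine Quotient.sound (MvN.of_submatrix ((e.map f).sum (e'.map f)).idem (Equiv.refl _) ?_)
    change (block e.mat 0 0 e'.mat).map f = block (e.mat.map f) 0 0 (e'.mat.map f)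
    rw [block_map]
    simp

/-- The homomorphism `f_* : K₀(A) → K₀(B)` induced by a unital ⋆-homomorphism `f`. -/
def K0.map {A B : Type*} [CStarAlgebra A] [CStarAlgebra B] (f : A →⋆ₐ[ℂ] B) : K0 A →+ K0 B :=
  Algebra.GrothendieckAddGroup.lift (Algebra.GrothendieckAddGroup.of.comp (V.map (f : A →+* B)))

theorem K0.map_cls {A B : Type*} [CStarAlgebra A] [CStarAlgebra B] (f : A →⋆ₐ[ℂ] B) {n : ℕ}
    (e : Matrix (Fin n) (Fin n) A) (he : e * e = e) :
    K0.map f (K0.cls e he) = K0.cls (e.map f) (by rw [← Matrix.map_mul, he]) :=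
  DFunLike.congr_fun (Algebra.GrothendieckAddGroup.lift.symm_apply_apply
    (Algebra.GrothendieckAddGroup.of.comp (V.map (f : A →+* B)))) _

theorem K0.map_comp {A B C : Type*} [CStarAlgebra A] [CStarAlgebra B] [CStarAlgebra C]
    (g : B →⋆ₐ[ℂ] C) (f : A →⋆ₐ[ℂ] B) : K0.map (g.comp f) = (K0.map g).comp (K0.map f) := by
  apply Algebra.GrothendieckAddGroup.lift.symm.injective
  ext ⟨e⟩
  change K0.map (g.comp f) (K0.cls e.mat e.idem) = K0.map g (K0.map f (K0.cls e.mat e.idem))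
  rw [K0.map_cls, K0.map_cls, K0.map_cls]
  rfl

/-! ### The group `K₁` of a unital C⋆-algebra -/

/-- The general linear group `GL_n(A)`, with the topology of a group of units. -/
abbrev GLn (n : ℕ) (A : Type*) [Ring A] : Type _ := (Matrix (Fin n) (Fin n) A)ˣ

/-- The homomorphism `a ↦ a ⊕ 1` from `M_n(A)` to `M_N(A)`, for `n ≤ N`. -/
def padMat {A : Type*} [Ring A] {n N : ℕ} (h : n ≤ N) :
    Matrix (Fin n) (Fin n) A →* Matrix (Fin N) (Fin N) A where
  toFun a := (block a 0 0 (1 : Matrix (Fin (N - n)) (Fin (N - n)) A)).submatrix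
    (finCongr (Nat.add_sub_of_le h)).symm (finCongr (Nat.add_sub_of_le h)).symm
  map_one' := by rw [block_one, Matrix.submatrix_one_equiv]
  map_mul' a b := by rw [Matrix.submatrix_mul_equiv, block_mul]; simp

/-- The homomorphism `a ↦ a ⊕ 1` from `GL_n(A)` to `GL_N(A)`, for `n ≤ N`. -/
def pad {A : Type*} [Ring A] {n N : ℕ} (h : n ≤ N) : GLn n A →* GLn N A := Units.map (padMat h)

theorem padMat_apply {A : Type*} [Ring A] {n N : ℕ} (h : n ≤ N) (a : Matrix (Fin n) (Fin n) A)
    (i j : Fin N) : padMat h a i j =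
      if h : (i : ℕ) < n ∧ (j : ℕ) < n then a ⟨i, h.1⟩ ⟨j, h.2⟩ else if i = j then 1 else 0 := by
  obtain ⟨i, rfl⟩ := (finCongr (Nat.add_sub_of_le h)).surjective i
  obtain ⟨j, rfl⟩ := (finCongr (Nat.add_sub_of_le h)).surjective j
  obtain ⟨i | i, rfl⟩ := finSumFinEquiv.surjective i <;>
  obtain ⟨j | j, rfl⟩ := finSumFinEquiv.surjective j <;>
  simp [padMat, block, Matrix.one_apply, Fin.ext_iff] <;> omega

theorem pad_pad {A : Type*} [Ring A] {n N M : ℕ} (h : n ≤ N) (h' : N ≤ M) (a : GLn n A) :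
    pad h' (pad h a) = pad (h.trans h') a := by
  ext i j
  change padMat h' (padMat h a.1) i j = padMat _ a.1 i j
  simp only [padMat_apply]
  grind

theorem pad_self {A : Type*} [Ring A] {n : ℕ} (a : GLn n A) : pad le_rfl a = a := by
  ext i j
  change padMat le_rfl a.1 i j = a.1 i j
  simp [padMat_apply]

section Topological

variable {A : Type*} [CStarAlgebra A]

theorem continuous_pad {n N : ℕ} (h : n ≤ N) : Continuous (pad h : GLn n A → GLn N A) := by
  refine Continuous.units_map _ ?_
  exact (Continuous.matrix_fromBlocks continuous_id continuous_const continuous_const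
    continuous_const).matrix_submatrix _ _ |>.matrix_submatrix _ _

/-- The block matrix with two invertible diagonal blocks. -/
def diag2 {N : ℕ} (u v : GLn N A) : GLn (N + N) A where
  val := block u.1 0 0 v.1
  inv := block u.inv 0 0 v.inv
  val_inv := by rw [block_mul]; simp [block_one]
  inv_val := by rw [block_mul]; simp [block_one]

/-- An upper triangular elementary block matrix. -/
def upper {N : ℕ} (x : Matrix (Fin N) (Fin N) A) : GLn (N + N) A where
  val := block 1 x 0 1
  inv := block 1 (-x) 0 1
  val_inv := by rw [block_mul]; simp [block_one]
  inv_val := by rw [block_mul]; simp [block_one]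

/-- A lower triangular elementary block matrix. -/
def lower {N : ℕ} (x : Matrix (Fin N) (Fin N) A) : GLn (N + N) A where
  val := block 1 0 x 1
  inv := block 1 0 (-x) 1
  val_inv := by rw [block_mul]; simp [block_one]
  inv_val := by rw [block_mul]; simp [block_one]

theorem joined_upper {N : ℕ} (x : Matrix (Fin N) (Fin N) A) : Joined 1 (upper x) := by
  have hc : ∀ ε : ℝ, Continuous fun t : unitInterval =>
      block (1 : Matrix (Fin N) (Fin N) A) (ε • (t : ℝ) • x) 0 1 := fun ε =>
    (Continuous.matrix_fromBlocks continuous_const (by fun_prop) continuous_const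
      continuous_const).matrix_submatrix _ _
  refine ⟨⟨⟨fun t => upper ((t : ℝ) • x), Units.continuous_iff.2 ⟨?_, ?_⟩⟩, ?_, ?_⟩⟩
  · simpa using! hc 1
  · simpa using! hc (-1)
  · exact Units.ext (by simpa [upper] using block_one)
  · simp

theorem joined_lower {N : ℕ} (x : Matrix (Fin N) (Fin N) A) : Joined 1 (lower x) := by
  have hc : ∀ ε : ℝ, Continuous fun t : unitInterval =>
      block (1 : Matrix (Fin N) (Fin N) A) 0 (ε • (t : ℝ) • x) 1 := fun ε =>
    (Continuous.matrix_fromBlocks continuous_const continuous_const (by fun_prop)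
      continuous_const).matrix_submatrix _ _
  refine ⟨⟨⟨fun t => lower ((t : ℝ) • x), Units.continuous_iff.2 ⟨?_, ?_⟩⟩, ?_, ?_⟩⟩
  · simpa using! hc 1
  · simpa using! hc (-1)
  · exact Units.ext (by simpa [lower] using block_one)
  · simp

/-- `u ⊕ 1` and `1 ⊕ u` are homotopic through invertible matrices. -/
theorem joined_diag2 {N : ℕ} (u : GLn N A) : Joined (diag2 u 1) (diag2 1 u) := by
  have hw : Joined (1 * 1 * 1) (upper (-1) * lower 1 * upper (-1) : GLn (N + N) A) :=
    ((joined_upper _).mul (joined_lower _)).mul (joined_upper _)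
  simp only [mul_one] at hw
  have h := (hw.mul (Joined.refl (diag2 u 1))).mul hw.inv
  have e : (upper (-1) * lower 1 * upper (-1) : GLn (N + N) A) * diag2 u 1 =
      diag2 1 u * (upper (-1) * lower 1 * upper (-1)) := by
    ext1
    simp [upper, lower, diag2, block_mul]
  rwa [e, mul_inv_cancel_right, inv_one, mul_one, one_mul] at h

theorem pad_eq_diag2 {N : ℕ} (u : GLn N A) : pad (Nat.le_add_right N N) u = diag2 u 1 := by
  ext i j
  change padMat _ u.1 i j = block u.1 0 0 1 i j
  rw [padMat_apply]
  obtain ⟨i | i, rfl⟩ := finSumFinEquiv.surjective i <;>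
  obtain ⟨j | j, rfl⟩ := finSumFinEquiv.surjective j <;>
  simp [block, Matrix.one_apply, Fin.ext_iff, -Fin.natAdd_eq_addNat] <;> omega

theorem joined_pad_comm {N : ℕ} (u v : GLn N A) :
    Joined (pad (Nat.le_add_right N N) (u * v)) (pad (Nat.le_add_right N N) (v * u)) := by
  have e : (diag2 u 1 : GLn (N + N) A) * diag2 1 v = diag2 1 v * diag2 u 1 := by
    ext1
    simp [diag2, block_mul]
  rw [map_mul, map_mul, pad_eq_diag2, pad_eq_diag2]
  have h1 := (Joined.refl (diag2 u 1)).mul (joined_diag2 v)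
  rw [e] at h1
  exact h1.trans ((joined_diag2 v).symm.mul (Joined.refl _))

/-- `a ∈ GL_n(A)` and `b ∈ GL_m(A)` are stably homotopic if `a ⊕ 1` and `b ⊕ 1` are joined by a
path in `GL_N(A)` for some `N`. -/
def StablyHomotopic (a b : Σ n, GLn n A) : Prop :=
  ∃ (N : ℕ) (h : a.1 ≤ N) (h' : b.1 ≤ N), Joined (pad h a.2) (pad h' b.2)

theorem StablyHomotopic.of_le {a b : Σ n, GLn n A} {N M : ℕ} {h : a.1 ≤ N} {h' : b.1 ≤ N}
    (H : Joined (pad h a.2) (pad h' b.2)) (hM : N ≤ M) :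
    Joined (pad (h.trans hM) a.2) (pad (h'.trans hM) b.2) := by
  rw [← pad_pad h hM, ← pad_pad h' hM]
  exact H.map (continuous_pad hM)

variable (A) in
instance stableSetoid : Setoid (Σ n, GLn n A) where
  r := StablyHomotopic
  iseqv :=
    { refl := fun a => ⟨a.1, le_rfl, le_rfl, Joined.refl _⟩
      symm := fun ⟨N, h, h', H⟩ => ⟨N, h', h, H.symm⟩
      trans := fun ⟨N, _, _, H⟩ ⟨M, _, _, H'⟩ =>
        ⟨max N M, _, _, (StablyHomotopic.of_le H (le_max_left N M)).trans
          (StablyHomotopic.of_le H' (le_max_right N M))⟩ }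

variable (A) in
/-- The group `K₁(A)` of a unital C⋆-algebra `A`: the set of path components of
`GL_∞(A) = ⋃ GL_n(A)`, with the group structure induced by the multiplication of matrices,
written additively. -/
def K1 : Type _ := Quotient (stableSetoid A)

/-- The class `[a] ∈ K₁(A)` of an invertible matrix `a ∈ GL_n(A)`. -/
def K1.cls {n : ℕ} (a : GLn n A) : K1 A := Quotient.mk _ ⟨n, a⟩

theorem K1.cls_pad {n N : ℕ} (h : n ≤ N) (a : GLn n A) : K1.cls (pad h a) = K1.cls a :=
  Quotient.sound ⟨N, le_rfl, h, by rw [pad_self]⟩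

theorem K1.cls_eq_of_joined {n : ℕ} {a b : GLn n A} (h : Joined a b) : K1.cls a = K1.cls b :=
  Quotient.sound ⟨n, le_rfl, le_rfl, by rw [pad_self, pad_self]; exact h⟩

theorem K1.exists_cls (x : K1 A) : ∃ n, ∀ N, n ≤ N → ∃ a : GLn N A, x = K1.cls a := by
  obtain ⟨⟨n, a⟩⟩ := x
  exact ⟨n, fun N h => ⟨pad h a, (K1.cls_pad h a).symm⟩⟩

instance : Zero (K1 A) := ⟨K1.cls (1 : GLn 0 A)⟩

instance : Neg (K1 A) := ⟨Quotient.map (fun a => ⟨a.1, a.2⁻¹⟩) (by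
  rintro a b ⟨N, h, h', H⟩
  refine ⟨N, h, h', ?_⟩
  rw [map_inv, map_inv]
  exact H.inv)⟩

instance : Add (K1 A) := ⟨Quotient.map₂
  (fun a b => ⟨max a.1 b.1, pad (le_max_left _ _) a.2 * pad (le_max_right _ _) b.2⟩) (by
    rintro a a' ⟨N, h1, h1', H⟩ b b' ⟨M, h2, h2', H'⟩
    refine ⟨max N M, max_le_max h1 h2, max_le_max h1' h2', ?_⟩
    rw [map_mul, map_mul, pad_pad, pad_pad, pad_pad, pad_pad]
    exact (StablyHomotopic.of_le H (le_max_left N M)).mul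
      (StablyHomotopic.of_le H' (le_max_right N M)))⟩

theorem K1.cls_mul {n : ℕ} (a b : GLn n A) : K1.cls (a * b) = K1.cls a + K1.cls b := by
  rw [← K1.cls_pad (le_max_left n n) (a * b), map_mul]
  rfl

theorem K1.cls_one (n : ℕ) : K1.cls (1 : GLn n A) = 0 := by
  rw [← map_one (pad (Nat.zero_le n)), K1.cls_pad]
  rfl

theorem K1.cls_inv {n : ℕ} (a : GLn n A) : K1.cls a⁻¹ = -K1.cls a := rfl

theorem K1.add_comm' (x y : K1 A) : x + y = y + x := by
  obtain ⟨n, hn⟩ := x.exists_cls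
  obtain ⟨m, hm⟩ := y.exists_cls
  obtain ⟨a, rfl⟩ := hn (max n m) (le_max_left _ _)
  obtain ⟨b, rfl⟩ := hm (max n m) (le_max_right _ _)
  rw [← K1.cls_mul, ← K1.cls_mul, ← K1.cls_pad (Nat.le_add_right _ _) (a * b),
    ← K1.cls_pad (Nat.le_add_right _ _) (b * a)]
  exact K1.cls_eq_of_joined (joined_pad_comm a b)

theorem K1.zero_add' (x : K1 A) : 0 + x = x := by
  obtain ⟨n, hn⟩ := x.exists_cls
  obtain ⟨a, rfl⟩ := hn n le_rfl
  rw [← K1.cls_one n, ← K1.cls_mul, one_mul]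

instance : AddCommGroup (K1 A) where
  add_assoc x y z := by
    obtain ⟨n, hn⟩ := x.exists_cls
    obtain ⟨m, hm⟩ := y.exists_cls
    obtain ⟨k, hk⟩ := z.exists_cls
    obtain ⟨a, rfl⟩ := hn (n + m + k) (by omega)
    obtain ⟨b, rfl⟩ := hm (n + m + k) (by omega)
    obtain ⟨c, rfl⟩ := hk (n + m + k) (by omega)
    simp only [← K1.cls_mul, mul_assoc]
  zero_add := K1.zero_add'
  add_zero x := by rw [K1.add_comm', K1.zero_add']
  add_comm := K1.add_comm'
  neg_add_cancel x := by
    obtain ⟨n, hn⟩ := x.exists_cls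
    obtain ⟨a, rfl⟩ := hn n le_rfl
    rw [← K1.cls_inv, ← K1.cls_mul, inv_mul_cancel, K1.cls_one]
  nsmul := nsmulRec
  zsmul := zsmulRec

variable {B : Type*} [CStarAlgebra B]

/-- A unital ⋆-homomorphism applied entrywise to an invertible matrix. -/
def GLn.map (f : A →⋆ₐ[ℂ] B) (n : ℕ) : GLn n A →* GLn n B :=
  Units.map (RingHom.mapMatrix (m := Fin n) (f : A →+* B)).toMonoidHom

open scoped CStarAlgebra in
theorem GLn.continuous_map (f : A →⋆ₐ[ℂ] B) (n : ℕ) : Continuous (GLn.map f n) :=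
  Continuous.units_map _ (Continuous.matrix_map continuous_id (map_continuous f))

theorem GLn.map_pad (f : A →⋆ₐ[ℂ] B) {n N : ℕ} (h : n ≤ N) (a : GLn n A) :
    GLn.map f N (pad h a) = pad h (GLn.map f n a) := by
  ext i j
  change f (padMat h a.1 i j) = padMat h (a.1.map f) i j
  rw [padMat_apply, padMat_apply]
  split_ifs <;> simp

/-- The homomorphism `f_* : K₁(A) → K₁(B)` induced by a unital ⋆-homomorphism `f`. -/
def K1.map (f : A →⋆ₐ[ℂ] B) : K1 A →+ K1 B where
  toFun := Quotient.map (fun a => ⟨a.1, GLn.map f a.1 a.2⟩) (by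
    rintro a b ⟨N, h, h', H⟩
    refine ⟨N, h, h', ?_⟩
    rw [← GLn.map_pad, ← GLn.map_pad]
    exact H.map (GLn.continuous_map f N))
  map_zero' := congrArg K1.cls (map_one (GLn.map f 0))
  map_add' x y := by
    obtain ⟨n, hn⟩ := x.exists_cls
    obtain ⟨m, hm⟩ := y.exists_cls
    obtain ⟨a, rfl⟩ := hn (max n m) (le_max_left _ _)
    obtain ⟨b, rfl⟩ := hm (max n m) (le_max_right _ _)
    rw [← K1.cls_mul]
    change K1.cls (GLn.map f _ (a * b)) = K1.cls (GLn.map f _ a) + K1.cls (GLn.map f _ b)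
    rw [map_mul, K1.cls_mul]

end Topological

/-! ### K-theory of C⋆-algebras that need not have a unit -/

section NonUnital

/-- The canonical character `ℂ ⊕ A → ℂ` of the unitization of `A`. -/
def character (A : Type*) [NonUnitalCStarAlgebra A] : Unitization ℂ A →⋆ₐ[ℂ] ℂ :=
  Unitization.starLift 0

/-- The scalar map `(z, a) ↦ (z, 0)` of the unitization of `A`. -/
def scalarMap (A : Type*) [NonUnitalCStarAlgebra A] : Unitization ℂ A →⋆ₐ[ℂ] Unitization ℂ A :=
  Unitization.starMap 0

/-- `K₀` of a C⋆-algebra `A` that need not have a unit: the kernel of the map from `K₀` of the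
unitization of `A` to `K₀(ℂ)` given by the canonical character. -/
def NK0 (A : Type*) [NonUnitalCStarAlgebra A] : AddSubgroup (K0 (Unitization ℂ A)) :=
  (K0.map (character A)).ker

/-- `K₁` of a C⋆-algebra `A` that need not have a unit: the group `K₁` of the unitization
of `A`. -/
abbrev NK1 (A : Type*) [NonUnitalCStarAlgebra A] : Type _ := K1 (Unitization ℂ A)

variable {A B : Type*} [NonUnitalCStarAlgebra A] [NonUnitalCStarAlgebra B]

theorem character_coe (a : A) : character A a = 0 :=
  DFunLike.congr_fun (Unitization.starLift.symm_apply_apply (0 : A →⋆ₙₐ[ℂ] ℂ)) a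

theorem character_comp_starMap (f : A →⋆ₙₐ[ℂ] B) :
    (character B).comp (Unitization.starMap f) = character A := by
  ext a
  change character B (Unitization.starMap f a) = character A a
  rw [Unitization.starMap_inr, character_coe, character_coe]

/-- The homomorphism `f_* : K₀(A) → K₀(B)` induced by a ⋆-homomorphism `f`. -/
def NK0.map (f : A →⋆ₙₐ[ℂ] B) : NK0 A →+ NK0 B :=
  ((K0.map (Unitization.starMap f)).comp (NK0 A).subtype).codRestrict (NK0 B) (by
    rintro ⟨x, hx⟩
    change K0.map (character B) (K0.map (Unitization.starMap f) x) = 0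
    rw [← AddMonoidHom.comp_apply, ← K0.map_comp, character_comp_starMap]
    exact hx)

/-- The homomorphism `f_* : K₁(A) → K₁(B)` induced by a ⋆-homomorphism `f`. -/
def NK1.map (f : A →⋆ₙₐ[ℂ] B) : NK1 A →+ NK1 B := K1.map (Unitization.starMap f)

end NonUnital

/-! ### Pullback squares, connecting homomorphisms and six-term sequences -/

/-- The square with upper maps `q₁ : B → B₁`, `q₂ : B → B₂` and lower maps `ρ₁ : B₁ → B₁₂`,
`ρ₂ : B₂ → B₁₂` is a pullback: it commutes, and `b ↦ (q₁ b, q₂ b)` is a bijection from `B` onto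
`{(x, y) | ρ₁ x = ρ₂ y}`. -/
def IsPullbackSquare {B B₁ B₂ B₁₂ : Type*} (q₁ : B → B₁) (q₂ : B → B₂) (ρ₁ : B₁ → B₁₂)
    (ρ₂ : B₂ → B₁₂) : Prop :=
  (∀ b, ρ₁ (q₁ b) = ρ₂ (q₂ b)) ∧ ∀ x y, ρ₁ x = ρ₂ y → ∃! b, q₁ b = x ∧ q₂ b = y

/-- The second component of Milnor's idempotent. -/
def milnorMatrix {A : Type*} [Ring A] {n : ℕ} (c d : Matrix (Fin n) (Fin n) A) :
    Matrix (Fin (n + n)) (Fin (n + n)) A :=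
  block (c * (2 - d * c) * d) (c * (2 - d * c) * (1 - d * c)) ((1 - d * c) * d) ((1 - d * c) ^ 2)

section Connecting

variable {B B₁ B₂ B₁₂ : Type*} [CStarAlgebra B] [CStarAlgebra B₁] [CStarAlgebra B₂]
  [CStarAlgebra B₁₂]

/-- `D` is Milnor's connecting map of a square of unital C⋆-algebras: `D [a] = [p_a] - [I_n]` for
every `a ∈ GL_n(B₁₂)` and all lifts `c`, `d` of `a`, `a⁻¹` to `M_n(B₂)`, where `p_a ∈ M_{2n}(B)` is
the idempotent with first component `diag(1, 0)` and second component `milnorMatrix c d`. -/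
def IsMilnorMap (q₁ : B →⋆ₐ[ℂ] B₁) (q₂ : B →⋆ₐ[ℂ] B₂) (ρ₂ : B₂ →⋆ₐ[ℂ] B₁₂)
    (D : K1 B₁₂ →+ K0 B) : Prop :=
  ∀ (n : ℕ) (a : GLn n B₁₂) (c d : Matrix (Fin n) (Fin n) B₂),
    c.map ρ₂ = a.val → d.map ρ₂ = a⁻¹.val →
    ∃ (p : Matrix (Fin (n + n)) (Fin (n + n)) B) (hp : p * p = p),
      p.map q₁ = block 1 0 0 0 ∧ p.map q₂ = milnorMatrix c d ∧
      D (K1.cls a) = K0.cls p hp - K0.cls (1 : Matrix (Fin n) (Fin n) B) (one_mul 1)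

/-- `w ∈ GL_k(B)` is the matrix `(I_k, exp(2πiQ))`. -/
def IsBottMatrix (q₁ : B →⋆ₐ[ℂ] B₁) (q₂ : B →⋆ₐ[ℂ] B₂) {k : ℕ} (Q : Matrix (Fin k) (Fin k) B₂)
    (w : GLn k B) : Prop :=
  w.val.map q₁ = 1 ∧ w.val.map q₂ = NormedSpace.exp ((2 * Real.pi * Complex.I : ℂ) • Q)

/-- `D` is Bott's connecting map of a square of unital C⋆-algebras: `D [p] = [(I_k, exp(2πiQ))]`
for every projection `p ∈ M_k(B₁₂)` and every selfadjoint lift `Q ∈ M_k(B₂)` of `p`. -/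
def IsBottMap (q₁ : B →⋆ₐ[ℂ] B₁) (q₂ : B →⋆ₐ[ℂ] B₂) (ρ₂ : B₂ →⋆ₐ[ℂ] B₁₂)
    (D : K0 B₁₂ →+ K1 B) : Prop :=
  ∀ (k : ℕ) (p : Matrix (Fin k) (Fin k) B₁₂) (hp : p * p = p) (Q : Matrix (Fin k) (Fin k) B₂),
    p.IsHermitian → Q.IsHermitian → Q.map ρ₂ = p →
    ∃ w : GLn k B, IsBottMatrix q₁ q₂ Q w ∧ D (K0.cls p hp) = K1.cls w

end Connecting

section ConnectingNonUnital

variable {B B₁ B₂ B₁₂ : Type*} [NonUnitalCStarAlgebra B] [NonUnitalCStarAlgebra B₁]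
  [NonUnitalCStarAlgebra B₂] [NonUnitalCStarAlgebra B₁₂]

/-- `D` is Milnor's connecting map of a square of C⋆-algebras that need not have units: it is
given by Milnor's formula for the unitized square. -/
def IsNMilnorMap (q₁ : B →⋆ₙₐ[ℂ] B₁) (q₂ : B →⋆ₙₐ[ℂ] B₂) (ρ₂ : B₂ →⋆ₙₐ[ℂ] B₁₂)
    (D : NK1 B₁₂ →+ NK0 B) : Prop :=
  IsMilnorMap (Unitization.starMap q₁) (Unitization.starMap q₂) (Unitization.starMap ρ₂)
    ((NK0 B).subtype.comp D)

/-- `D` is Bott's connecting map of a square of C⋆-algebras that need not have units: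
`D ([p] - [s(p)]) = [(I_k, exp(2πiQ))]` for every projection `p` over the unitization of `B₁₂`
with scalar part `s(p)`, and every selfadjoint lift `Q` of `p` over the unitization of `B₂`. -/
def IsNBottMap (q₁ : B →⋆ₙₐ[ℂ] B₁) (q₂ : B →⋆ₙₐ[ℂ] B₂) (ρ₂ : B₂ →⋆ₙₐ[ℂ] B₁₂)
    (D : NK0 B₁₂ →+ NK1 B) : Prop :=
  ∀ (k : ℕ) (p : Matrix (Fin k) (Fin k) (Unitization ℂ B₁₂)) (hp : p * p = p)
    (Q : Matrix (Fin k) (Fin k) (Unitization ℂ B₂)),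
    p.IsHermitian → Q.IsHermitian → Q.map (Unitization.starMap ρ₂) = p →
    ∃ w : GLn k (Unitization ℂ B),
      IsBottMatrix (Unitization.starMap q₁) (Unitization.starMap q₂) Q w ∧
      ∀ x : NK0 B₁₂, (x : K0 (Unitization ℂ B₁₂)) =
        K0.cls p hp - K0.map (scalarMap B₁₂) (K0.cls p hp) → D x = K1.cls w

end ConnectingNonUnital

section SixTerm

variable {G₀ H₀ L₀ G₁ H₁ L₁ G₀' H₀' L₀' G₁' H₁' L₁' : Type*}
  [AddCommGroup G₀] [AddCommGroup H₀] [AddCommGroup L₀]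
  [AddCommGroup G₁] [AddCommGroup H₁] [AddCommGroup L₁]
  [AddCommGroup G₀'] [AddCommGroup H₀'] [AddCommGroup L₀']
  [AddCommGroup G₁'] [AddCommGroup H₁'] [AddCommGroup L₁']

/-- The difference map `(x, y) ↦ g y - f x`. -/
def diffMap (f : G₀ →+ L₀) (g : H₀ →+ L₀) : G₀ × H₀ →+ L₀ :=
  g.comp (AddMonoidHom.snd G₀ H₀) - f.comp (AddMonoidHom.fst G₀ H₀)

/-- The cyclic sequence `G₀ → H₀ → L₀ → G₁ → H₁ → L₁ → G₀` is exact at all six places. -/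
def SixTermExact (α₀ : G₀ →+ H₀) (β₀ : H₀ →+ L₀) (D₀₁ : L₀ →+ G₁) (α₁ : G₁ →+ H₁)
    (β₁ : H₁ →+ L₁) (D₁₀ : L₁ →+ G₀) : Prop :=
  Function.Exact α₀ β₀ ∧ Function.Exact β₀ D₀₁ ∧ Function.Exact D₀₁ α₁ ∧
  Function.Exact α₁ β₁ ∧ Function.Exact β₁ D₁₀ ∧ Function.Exact D₁₀ α₀

/-- The maps `g₀, h₀, l₀, g₁, h₁, l₁` form a morphism between two cyclic six-term sequences: all
six squares commute. -/
def SixTermMorphism (α₀ : G₀ →+ H₀) (β₀ : H₀ →+ L₀) (D₀₁ : L₀ →+ G₁) (α₁ : G₁ →+ H₁)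
    (β₁ : H₁ →+ L₁) (D₁₀ : L₁ →+ G₀) (α₀' : G₀' →+ H₀') (β₀' : H₀' →+ L₀') (D₀₁' : L₀' →+ G₁')
    (α₁' : G₁' →+ H₁') (β₁' : H₁' →+ L₁') (D₁₀' : L₁' →+ G₀') (g₀ : G₀ →+ G₀') (h₀ : H₀ →+ H₀')
    (l₀ : L₀ →+ L₀') (g₁ : G₁ →+ G₁') (h₁ : H₁ →+ H₁') (l₁ : L₁ →+ L₁') : Prop :=
  h₀.comp α₀ = α₀'.comp g₀ ∧ l₀.comp β₀ = β₀'.comp h₀ ∧ g₁.comp D₀₁ = D₀₁'.comp l₀ ∧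
  h₁.comp α₁ = α₁'.comp g₁ ∧ l₁.comp β₁ = β₁'.comp h₁ ∧ g₀.comp D₁₀ = D₁₀'.comp l₁

end SixTerm

end CStarK

end

open CStarK

/-! In the unital case, an invertible matrix a over B₁₂ glues the free modules B₁ⁿ and B₂ⁿ to a
projective module over B. `MilnorRep` records such a gluing by trivializations over B₁ and B₂ that
differ by a over B₁₂. Idempotents glued along the same a are equivalent (`MilnorRep.mvn`), and a
matters only up to invertibles coming from B₁ and B₂ (`MilnorRep.mul`). Since ρ₂ is onto, every
invertible in the identity component lifts to B₂ (`exists_lift_of_joined`), so the glued class is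
homotopy invariant and defines ∂₁₀. Exactness at K₀(B), at K₁(B₁₂) and at the two direct sums is
then Milnor's linear algebra together with this lifting and the lifting of elementary matrices
(`swapUnit`).

The Bott map sends [e] to the class of (1, exp(2πiQ)), where Q is any lift of e. Independence of the
choices comes from segments between lifts and from conjugation by invertibles joined to 1
(`BottRep.cls_eq_of_mvn`). Every idempotent is equivalent to a projection and every projection has a
selfadjoint lift, so the formula for projections determines the map.

Exactness at K₀(B₁₂) and K₁(B) is where Bott periodicity enters. It is used in this form: [e] ↦ [1 -
e + ze] is an injection of K₀(A) into K₁(C(𝕋, A)) whose image consists of the classes vanishing at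
the base point (`Loop.bottHom_injective`, `Loop.exists_bottHom_eq`). A path in GL(B) from (1,
exp(2πiQ)) to 1 factors the loop of e into a loop from B₁ and a loop from B₂, and periodicity turns
this into a decomposition of [e]. Conversely, if w over B is connected to 1 over B₁ and over B₂, the
two paths differ over B₁₂ by a loop (`IsClutching`), and periodicity identifies that loop with an
idempotent whose Bott image is [w].

Periodicity is proved in the manner of Atiyah and Bott. Invertible loops are approximated by Laurent
polynomials and shifted by a power of z to polynomials. For injectivity, Toeplitz blocks formed from
the Fourier coefficients of a polynomial loop and of its inverse give an idempotent
(`Loop.specIdem`), whose class is constant along homotopies and recovers [1 - e] from the loop of e.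
For surjectivity, a polynomial loop is linearized by enlarging matrices, and a linear loop is split
by its spectral idempotent into factors joined to constants and one factor 1 - e + ze.

For general algebras everything happens over the unitizations. There K₀(A) is a natural direct
summand (`NK0.proj`), and the exact sequence and its naturality restrict to that summand. -/

noncomputable section

namespace CStarK

/-! ### Idempotent matrices and the group K₀ -/

section KZero

variable {A : Type*} [Ring A]

/-- Algebraic equivalence of idempotent matrices with arbitrary finite index types. -/
def MvNEquiv {ι κ : Type*} [Fintype ι] [Fintype κ] (e : Matrix ι ι A) (f : Matrix κ κ A) : Prop :=
  ∃ (x : Matrix ι κ A) (y : Matrix κ ι A), x * y = e ∧ y * x = f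

theorem MvNEquiv.symm {ι κ : Type*} [Fintype ι] [Fintype κ] {e : Matrix ι ι A}
    {f : Matrix κ κ A} (h : MvNEquiv e f) : MvNEquiv f e :=
  let ⟨x, y, h1, h2⟩ := h; ⟨y, x, h2, h1⟩

theorem MvNEquiv.trans {ι κ μ : Type*} [Fintype ι] [Fintype κ] [Fintype μ] {e : Matrix ι ι A}
    {f : Matrix κ κ A} {g : Matrix μ μ A} (he : e * e = e) (hg : g * g = g)
    (h : MvNEquiv e f) (h' : MvNEquiv f g) : MvNEquiv e g := by
  obtain ⟨x, y, h1, h2⟩ := h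
  obtain ⟨z, w, h3, h4⟩ := h'
  refine ⟨x * z, w * y, ?_, ?_⟩
  · rw [Matrix.mul_assoc, ← Matrix.mul_assoc z, h3, ← h2, ← Matrix.mul_assoc,
      ← Matrix.mul_assoc, h1, Matrix.mul_assoc, h1, he]
  · rw [Matrix.mul_assoc, ← Matrix.mul_assoc y, h2, ← h3, ← Matrix.mul_assoc,
      ← Matrix.mul_assoc, h4, Matrix.mul_assoc, h4, hg]

theorem MvNEquiv.submatrix {ι κ : Type*} [Fintype ι] [Fintype κ] {f : Matrix κ κ A}
    (hf : f * f = f) (s : ι ≃ κ) : MvNEquiv (f.submatrix s s) f := by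
  refine ⟨f.submatrix s id, f.submatrix id s, ?_, ?_⟩
  · rw [← Matrix.submatrix_mul _ _ s id s Function.bijective_id, hf]
  · rw [← Matrix.submatrix_mul _ _ id s id s.bijective, hf, Matrix.submatrix_id_id]

theorem submatrix_idem {ι κ : Type*} [Fintype ι] [Fintype κ] {f : Matrix κ κ A}
    (hf : f * f = f) (s : ι ≃ κ) : f.submatrix s s * f.submatrix s s = f.submatrix s s := by
  rw [Matrix.submatrix_mul_equiv, hf]

/-- The class in `V(A)` of an idempotent matrix with an arbitrary finite index type. -/
def V.cls {ι : Type*} [Fintype ι] (e : Matrix ι ι A) (he : e * e = e) : V A :=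
  Quotient.mk _ (⟨Fintype.card ι,
    e.submatrix (Fintype.equivFin ι).symm (Fintype.equivFin ι).symm, submatrix_idem he _⟩ : Idem A)

theorem V.cls_eq_iff {ι κ : Type*} [Fintype ι] [Fintype κ] {e : Matrix ι ι A} {f : Matrix κ κ A}
    {he : e * e = e} {hf : f * f = f} : V.cls e he = V.cls f hf ↔ MvNEquiv e f := by
  refine Quotient.eq.trans ⟨fun h => ?_, fun h => ?_⟩
  · exact (MvNEquiv.submatrix he _).symm.trans he hf
      (MvNEquiv.trans (submatrix_idem he _) hf h (MvNEquiv.submatrix hf _))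
  · exact (MvNEquiv.submatrix he _).trans (submatrix_idem he _) (submatrix_idem hf _)
      (h.trans he (submatrix_idem hf _) (MvNEquiv.submatrix hf _).symm)

theorem V.mk_eq_cls {n : ℕ} (e : Matrix (Fin n) (Fin n) A) (he : e * e = e) :
    (Quotient.mk _ (⟨n, e, he⟩ : Idem A) : V A) = V.cls e he :=
  Quotient.sound (MvNEquiv.submatrix he _).symm

theorem K0.cls_eq {n : ℕ} (e : Matrix (Fin n) (Fin n) A) (he : e * e = e) :
    K0.cls e he = Algebra.GrothendieckAddGroup.of (V.cls e he) := by
  rw [← V.mk_eq_cls]; rfl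

theorem MvNEquiv.fromBlocks {ι κ ι' κ' : Type*} [Fintype ι] [Fintype κ] [Fintype ι'] [Fintype κ']
    {e : Matrix ι ι A} {f : Matrix κ κ A} {e' : Matrix ι' ι' A} {f' : Matrix κ' κ' A}
    (h : MvNEquiv e e') (h' : MvNEquiv f f') :
    MvNEquiv (Matrix.fromBlocks e 0 0 f) (Matrix.fromBlocks e' 0 0 f') := by
  obtain ⟨x, y, h1, h2⟩ := h
  obtain ⟨z, w, h3, h4⟩ := h'
  refine ⟨Matrix.fromBlocks x 0 0 z, Matrix.fromBlocks y 0 0 w, ?_, ?_⟩ <;>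
    simp [Matrix.fromBlocks_multiply, h1, h2, h3, h4]

theorem fromBlocks_idem {ι κ : Type*} [Fintype ι] [Fintype κ] {e : Matrix ι ι A}
    {f : Matrix κ κ A} (he : e * e = e) (hf : f * f = f) :
    Matrix.fromBlocks e 0 0 f * Matrix.fromBlocks e 0 0 f = Matrix.fromBlocks e 0 0 f := by
  simp [Matrix.fromBlocks_multiply, he, hf]

theorem block_idem {n m : ℕ} {e : Matrix (Fin n) (Fin n) A}
    {f : Matrix (Fin m) (Fin m) A} (he : e * e = e) (hf : f * f = f) :
    block e 0 0 f * block e 0 0 f = block e 0 0 f := by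
  rw [block_mul]; simp [he, hf]

theorem V.cls_block {n m : ℕ} {e : Matrix (Fin n) (Fin n) A} {f : Matrix (Fin m) (Fin m) A}
    (he : e * e = e) (hf : f * f = f) :
    V.cls (block e 0 0 f) (block_idem he hf) = V.cls e he + V.cls f hf := by
  rw [← V.mk_eq_cls, ← V.mk_eq_cls, ← V.mk_eq_cls]
  rfl

theorem V.cls_fromBlocks {ι κ : Type*} [Fintype ι] [Fintype κ] {e : Matrix ι ι A}
    {f : Matrix κ κ A} (he : e * e = e) (hf : f * f = f) :
    V.cls (Matrix.fromBlocks e 0 0 f) (fromBlocks_idem he hf) = V.cls e he + V.cls f hf := by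
  have h1 := MvNEquiv.submatrix he (Fintype.equivFin ι).symm
  have h2 := MvNEquiv.submatrix hf (Fintype.equivFin κ).symm
  have he' := submatrix_idem he (Fintype.equivFin ι).symm
  have hf' := submatrix_idem hf (Fintype.equivFin κ).symm
  rw [← (V.cls_eq_iff (he := he') (hf := he)).2 h1, ← (V.cls_eq_iff (he := hf') (hf := hf)).2 h2,
    ← V.cls_block he' hf', V.cls_eq_iff]
  exact MvNEquiv.trans (fromBlocks_idem he hf) (block_idem he' hf')
    (MvNEquiv.fromBlocks h1.symm h2.symm) (MvNEquiv.submatrix (fromBlocks_idem he' hf') _).symm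

/-- The sum of two orthogonal idempotents is equivalent to their block sum. -/
theorem V.cls_add_of_orthogonal {ι : Type*} [Fintype ι] {e f : Matrix ι ι A}
    (he : e * e = e) (hf : f * f = f) (hef : e * f = 0) (hfe : f * e = 0)
    (h : (e + f) * (e + f) = e + f) : V.cls (e + f) h = V.cls e he + V.cls f hf := by
  rw [← V.cls_fromBlocks he hf]
  -- The row (e f) times the column with entries e and f is e + f; in the other order orthogonality
  -- removes the off-diagonal entries.
  refine V.cls_eq_iff.2 ⟨Matrix.fromCols e f, Matrix.fromRows e f, ?_, ?_⟩
  · rw [Matrix.fromCols_mul_fromRows, he, hf]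
  · rw [Matrix.fromRows_mul_fromCols, he, hf, hef, hfe]

theorem K0.cls_eq_of_mvn {n m : ℕ} {e : Matrix (Fin n) (Fin n) A} {f : Matrix (Fin m) (Fin m) A}
    {he : e * e = e} {hf : f * f = f} (h : MvN e f) : K0.cls e he = K0.cls f hf :=
  congrArg _ (Quotient.sound h)

theorem K0.cls_block {n m : ℕ} {e : Matrix (Fin n) (Fin n) A} {f : Matrix (Fin m) (Fin m) A}
    (he : e * e = e) (hf : f * f = f) :
    K0.cls (block e 0 0 f) (block_idem he hf) = K0.cls e he + K0.cls f hf := by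
  rw [K0.cls_eq, K0.cls_eq, K0.cls_eq, ← map_add, V.cls_block]

theorem one_sub_idem {R : Type*} [Ring R] {e : R} (he : e * e = e) :
    (1 - e) * (1 - e) = 1 - e := by
  simp [mul_sub, sub_mul, he]

theorem K0.cls_add_cls_one_sub {n : ℕ} {e : Matrix (Fin n) (Fin n) A} (he : e * e = e) :
    K0.cls e he + K0.cls (1 - e) (one_sub_idem he) =
      K0.cls (1 : Matrix (Fin n) (Fin n) A) (one_mul 1) := by
  rw [K0.cls_eq, K0.cls_eq, K0.cls_eq, ← map_add, ← V.cls_add_of_orthogonal he (one_sub_idem he)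
    (by simp [mul_sub, he]) (by simp [sub_mul, he]) (by simp)]
  congr 2
  simp

theorem V.cls_zero {n : ℕ} : V.cls (0 : Matrix (Fin n) (Fin n) A) (zero_mul 0) = 0 := by
  refine Eq.trans (V.cls_eq_iff.2 ?_) (V.mk_eq_cls (0 : Matrix (Fin 0) (Fin 0) A) (by simp)).symm
  exact ⟨0, 0, by simp, by simp⟩

theorem K0.cls_zero {n : ℕ} :
    K0.cls (0 : Matrix (Fin n) (Fin n) A) (zero_mul 0) = 0 := by
  rw [K0.cls_eq, V.cls_zero, map_zero]

theorem K0.cls_one_add (n m : ℕ) :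
    K0.cls (1 : Matrix (Fin (n + m)) (Fin (n + m)) A) (one_mul 1) =
      K0.cls (1 : Matrix (Fin n) (Fin n) A) (one_mul 1) +
      K0.cls (1 : Matrix (Fin m) (Fin m) A) (one_mul 1) := by
  rw [← K0.cls_block]
  congr 1
  exact block_one.symm

theorem exists_of_sub_of {M : Type*} [AddCommMonoid M] (x : Algebra.GrothendieckAddGroup M) :
    ∃ a b : M, x = Algebra.GrothendieckAddGroup.of a - Algebra.GrothendieckAddGroup.of b := by
  induction x using AddLocalization.ind with
  | _ x =>
  obtain ⟨a, b, _⟩ := x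
  refine ⟨a, b, ?_⟩
  change _ = AddLocalization.addMonoidOf ⊤ a - AddLocalization.addMonoidOf ⊤ b
  rw [← AddLocalization.mk_zero_eq_addMonoidOf_mk, ← AddLocalization.mk_zero_eq_addMonoidOf_mk,
    Algebra.GrothendieckAddGroup.mk_sub_mk]
  simp

/-- The Grothendieck group is a localization at the whole monoid, so equality there is equality
after adding a common element; cancellation in the monoid itself may fail. -/
theorem exists_add_eq_of_of_eq {M : Type*} [AddCommMonoid M] {a b : M}
    (h : Algebra.GrothendieckAddGroup.of a = Algebra.GrothendieckAddGroup.of b) :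
    ∃ c, c + a = c + b := by
  change AddLocalization.addMonoidOf ⊤ a = AddLocalization.addMonoidOf ⊤ b at h
  rw [← AddLocalization.mk_zero_eq_addMonoidOf_mk, ← AddLocalization.mk_zero_eq_addMonoidOf_mk,
    AddLocalization.mk_eq_mk_iff, AddLocalization.r_iff_exists] at h
  obtain ⟨c, hc⟩ := h
  exact ⟨c, by simpa using hc⟩

theorem V.exists_cls (x : V A) :
    ∃ (n : ℕ) (e : Matrix (Fin n) (Fin n) A) (he : e * e = e), x = V.cls e he := by
  obtain ⟨⟨n, e, he⟩⟩ := x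
  exact ⟨n, e, he, V.mk_eq_cls e he⟩

/-- Every element of `K₀(A)` has the form `[e] - [I_k]`. -/
theorem K0.exists_cls_sub_one (x : K0 A) : ∃ (n k : ℕ) (e : Matrix (Fin n) (Fin n) A)
    (he : e * e = e), x = K0.cls e he - K0.cls (1 : Matrix (Fin k) (Fin k) A) (one_mul 1) := by
  obtain ⟨a, b, rfl⟩ := exists_of_sub_of x
  obtain ⟨n, e, he, rfl⟩ := a.exists_cls
  obtain ⟨m, f, hf, rfl⟩ := b.exists_cls
  -- Adding [1 - f] to both terms of [e] - [f] turns the second one into [I_m].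
  refine ⟨n + m, m, block e 0 0 (1 - f), block_idem he (one_sub_idem hf), ?_⟩
  rw [K0.cls_block he (one_sub_idem hf), ← K0.cls_add_cls_one_sub hf, ← K0.cls_eq, ← K0.cls_eq]
  abel

theorem V.cls_one_add (n m : ℕ) :
    V.cls (1 : Matrix (Fin (n + m)) (Fin (n + m)) A) (one_mul 1) =
      V.cls (1 : Matrix (Fin n) (Fin n) A) (one_mul 1) +
      V.cls (1 : Matrix (Fin m) (Fin m) A) (one_mul 1) := by
  rw [← V.cls_block]
  congr 1
  exact block_one.symm

/-- Two idempotents with the same class in `K₀(A)` are stably equivalent. -/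
theorem K0.exists_mvn_of_cls_eq {n m : ℕ} {e : Matrix (Fin n) (Fin n) A}
    {f : Matrix (Fin m) (Fin m) A} {he : e * e = e} {hf : f * f = f}
    (h : K0.cls e he = K0.cls f hf) :
    ∃ k₀ : ℕ, ∀ k ≥ k₀, MvN (block e 0 0 (1 : Matrix (Fin k) (Fin k) A))
      (block f 0 0 (1 : Matrix (Fin k) (Fin k) A)) := by
  rw [K0.cls_eq, K0.cls_eq] at h
  obtain ⟨c, hc⟩ := exists_add_eq_of_of_eq h
  obtain ⟨k₀, g, hg, rfl⟩ := c.exists_cls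
  -- The common summand is the class of an arbitrary idempotent g. Adding 1 - g as well replaces it
  -- by an identity matrix.
  have h1 : V.cls (1 : Matrix (Fin k₀) (Fin k₀) A) (one_mul 1) =
      V.cls (1 - g) (one_sub_idem hg) + V.cls g hg := by
    rw [← V.cls_add_of_orthogonal (one_sub_idem hg) hg (by simp [sub_mul, hg])
      (by simp [mul_sub, hg]) (by simp)]
    congr 1
    simp
  refine ⟨k₀, fun k hk => (V.cls_eq_iff (he := block_idem he (one_mul 1))
    (hf := block_idem hf (one_mul 1))).1 ?_⟩
  obtain ⟨j, rfl⟩ := Nat.exists_eq_add_of_le hk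
  rw [V.cls_block he (one_mul 1), V.cls_block hf (one_mul 1), V.cls_one_add, h1]
  rw [show ∀ x y z w : V A, x + (y + z + w) = y + (z + x) + w by intros; abel, hc]
  abel

end KZero

/-! ### Topology, exponentials and lifting of invertible matrices -/

section MatrixTopology

variable {A B : Type*} [CStarAlgebra A] [CStarAlgebra B]

open scoped CStarAlgebra in
theorem continuous_starAlgHom (f : A →⋆ₐ[ℂ] B) : Continuous f := map_continuous f

/-- The operator norm makes the matrices a Banach algebra without changing their topology. Hence
continuity of a map into `GLn` can be tested on the matrix alone, not on its inverse. -/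
theorem isOpenEmbedding_unitsVal (n : ℕ) :
    Topology.IsOpenEmbedding (Units.val : GLn n A → Matrix (Fin n) (Fin n) A) := by
  let i := Matrix.linftyOpNormedRing (n := Fin n) (α := A)
  have : @CompleteSpace (Matrix (Fin n) (Fin n) A) i.toPseudoMetricSpace.toUniformSpace :=
    Matrix.instCompleteSpace (Fin n) (Fin n) A
  exact Units.isOpenEmbedding_val (R := Matrix (Fin n) (Fin n) A)

/-- Every invertible matrix has a convex neighbourhood of invertible matrices, which may be chosen
inside any given neighbourhood. -/
theorem exists_convex_nhds {n : ℕ} (u : Matrix (Fin n) (Fin n) A)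
    {s : Set (Matrix (Fin n) (Fin n) A)} (hs : s ∈ nhds u) :
    ∃ W ⊆ s, IsOpen W ∧ u ∈ W ∧ Convex ℝ W := by
  let i := Matrix.linftyOpNormedRing (n := Fin n) (α := A)
  let i1 := Matrix.linftyOpNormedSpace (R := ℝ) (m := Fin n) (n := Fin n) (α := A)
  have hs' : s ∈ @nhds _ i.toPseudoMetricSpace.toUniformSpace.toTopologicalSpace u := hs
  obtain ⟨ε, h0, hε⟩ := Metric.mem_nhds_iff.1 hs'
  exact ⟨Metric.ball u ε, hε, Metric.isOpen_ball, Metric.mem_ball_self h0, convex_ball u ε⟩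

theorem continuous_exp_matrix {n : ℕ} :
    Continuous (NormedSpace.exp : Matrix (Fin n) (Fin n) A → Matrix (Fin n) (Fin n) A) := by
  let i := Matrix.linftyOpNormedRing (n := Fin n) (α := A)
  let i1 := Matrix.linftyOpNormedAlgebra (R := ℂ) (n := Fin n) (α := A)
  let i2 := NormedAlgebra.restrictScalars ℚ ℂ (Matrix (Fin n) (Fin n) A)
  have : @CompleteSpace (Matrix (Fin n) (Fin n) A) i.toPseudoMetricSpace.toUniformSpace :=
    Matrix.instCompleteSpace (Fin n) (Fin n) A
  exact NormedSpace.exp_continuous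

theorem map_exp_matrix (f : A →⋆ₐ[ℂ] B) {n : ℕ} (x : Matrix (Fin n) (Fin n) A) :
    (NormedSpace.exp x).map f = NormedSpace.exp (x.map f) := by
  let i := Matrix.linftyOpNormedRing (n := Fin n) (α := A)
  let i1 := Matrix.linftyOpNormedAlgebra (R := ℂ) (n := Fin n) (α := A)
  let i2 := NormedAlgebra.restrictScalars ℚ ℂ (Matrix (Fin n) (Fin n) A)
  have : @CompleteSpace (Matrix (Fin n) (Fin n) A) i.toPseudoMetricSpace.toUniformSpace :=
    Matrix.instCompleteSpace (Fin n) (Fin n) A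
  let j := Matrix.linftyOpNormedRing (n := Fin n) (α := B)
  let j1 := Matrix.linftyOpNormedAlgebra (R := ℂ) (n := Fin n) (α := B)
  let j2 := NormedAlgebra.restrictScalars ℚ ℂ (Matrix (Fin n) (Fin n) B)
  have hc : Continuous (RingHom.mapMatrix (m := Fin n) (f : A →+* B)) :=
    Continuous.matrix_map continuous_id (continuous_starAlgHom f)
  exact NormedSpace.map_exp (RingHom.mapMatrix (m := Fin n) (f : A →+* B)) hc x

/-- `exp(z • x)` as an invertible matrix. -/
def expUnit {n : ℕ} (x : Matrix (Fin n) (Fin n) A) : GLn n A where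
  val := NormedSpace.exp x
  inv := NormedSpace.exp (-x)
  val_inv := by
    let i2 := NormedAlgebra.restrictScalars ℚ ℂ A
    rw [← Matrix.exp_add_of_commute _ _ (Commute.neg_right (Commute.refl x)), add_neg_cancel,
      NormedSpace.exp_zero]
  inv_val := by
    let i2 := NormedAlgebra.restrictScalars ℚ ℂ A
    rw [← Matrix.exp_add_of_commute _ _ (Commute.neg_left (Commute.refl x)), neg_add_cancel,
      NormedSpace.exp_zero]

theorem continuous_expUnit {n : ℕ} :
    Continuous (expUnit : Matrix (Fin n) (Fin n) A → GLn n A) :=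
  (isOpenEmbedding_unitsVal n).continuous_iff.2 continuous_exp_matrix

theorem map_expUnit (f : A →⋆ₐ[ℂ] B) {n : ℕ} (x : Matrix (Fin n) (Fin n) A) :
    GLn.map f n (expUnit x) = expUnit (x.map f) :=
  Units.ext (map_exp_matrix f x)

/-- The block diagonal inclusion is a continuous ring homomorphism from a product, where
exponentials are computed componentwise. -/
theorem exp_block {n m : ℕ} (x : Matrix (Fin n) (Fin n) A) (y : Matrix (Fin m) (Fin m) A) :
    NormedSpace.exp (block x 0 0 y) = block (NormedSpace.exp x) 0 0 (NormedSpace.exp y) := by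
  let i := Matrix.linftyOpNormedRing (n := Fin n) (α := A)
  let i1 := Matrix.linftyOpNormedAlgebra (R := ℂ) (n := Fin n) (α := A)
  let i2 := NormedAlgebra.restrictScalars ℚ ℂ (Matrix (Fin n) (Fin n) A)
  have hi : @CompleteSpace (Matrix (Fin n) (Fin n) A) i.toPseudoMetricSpace.toUniformSpace :=
    Matrix.instCompleteSpace (Fin n) (Fin n) A
  let j := Matrix.linftyOpNormedRing (n := Fin m) (α := A)
  let j1 := Matrix.linftyOpNormedAlgebra (R := ℂ) (n := Fin m) (α := A)
  let j2 := NormedAlgebra.restrictScalars ℚ ℂ (Matrix (Fin m) (Fin m) A)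
  have hj : @CompleteSpace (Matrix (Fin m) (Fin m) A) j.toPseudoMetricSpace.toUniformSpace :=
    Matrix.instCompleteSpace (Fin m) (Fin m) A
  let k := Matrix.linftyOpNormedRing (n := Fin (n + m)) (α := A)
  let k1 := Matrix.linftyOpNormedAlgebra (R := ℂ) (n := Fin (n + m)) (α := A)
  let k2 := NormedAlgebra.restrictScalars ℚ ℂ (Matrix (Fin (n + m)) (Fin (n + m)) A)
  let f : Matrix (Fin n) (Fin n) A × Matrix (Fin m) (Fin m) A →+*
      Matrix (Fin (n + m)) (Fin (n + m)) A :=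
    { toFun := fun p => block p.1 0 0 p.2
      map_one' := block_one
      map_mul' := fun p q => by rw [block_mul]; simp
      map_zero' := by simp [block]
      map_add' := fun p q => by
        simp only [block, Prod.fst_add, Prod.snd_add]
        refine Eq.trans ?_ (congrFun (congrFun (Matrix.submatrix_add _ _) _) _)
        rw [Matrix.fromBlocks_add]
        simp }
  have hc : Continuous f := by
    change Continuous fun p : Matrix (Fin n) (Fin n) A × Matrix (Fin m) (Fin m) A =>
      block p.1 0 0 p.2
    exact (Continuous.matrix_fromBlocks continuous_fst continuous_const continuous_const
      continuous_snd).matrix_submatrix _ _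
  have h := NormedSpace.map_exp f hc (x, y)
  have h1 := Prod.fst_exp (x, y)
  have h2 := Prod.snd_exp (x, y)
  exact h.symm.trans (congrArg₂ (fun a b => block a 0 0 b) h1 h2)

/-- The exponential of a multiple of an idempotent. -/
theorem exp_smul_idem {n : ℕ} {e : Matrix (Fin n) (Fin n) A} (he : e * e = e) (z : ℂ) :
    NormedSpace.exp (z • e) = (1 - e) + Complex.exp z • e := by
  let k := Matrix.linftyOpNormedRing (n := Fin n) (α := A)
  let k1 := Matrix.linftyOpNormedAlgebra (R := ℂ) (n := Fin n) (α := A)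
  let k2 := NormedAlgebra.restrictScalars ℚ ℂ (Matrix (Fin n) (Fin n) A)
  -- The idempotent defines a continuous homomorphism of ℂ × ℂ into the matrices; it commutes with
  -- the exponential and is evaluated at (0, z).
  let f : ℂ × ℂ →+* Matrix (Fin n) (Fin n) A :=
    { toFun := fun p => p.1 • (1 - e) + p.2 • e
      map_one' := by simp
      map_mul' := fun p q => by simp [mul_add, add_mul, mul_sub, sub_mul, he, smul_smul, mul_comm]
      map_zero' := by simp
      map_add' := fun p q => by simp only [Prod.fst_add, Prod.snd_add, add_smul]; abel }
  have hc : Continuous f := by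
    change Continuous fun p : ℂ × ℂ => p.1 • (1 - e) + p.2 • e
    fun_prop
  have h := NormedSpace.map_exp f hc (0, z)
  have h1 := Prod.fst_exp ((0, z) : ℂ × ℂ)
  have h2 := Prod.snd_exp ((0, z) : ℂ × ℂ)
  change (NormedSpace.exp ((0, z) : ℂ × ℂ)).1 • (1 - e) +
    (NormedSpace.exp ((0, z) : ℂ × ℂ)).2 • e = NormedSpace.exp ((0 : ℂ) • (1 - e) + z • e) at h
  rw [h1, h2, zero_smul, zero_add, NormedSpace.exp_zero, one_smul, ← Complex.exp_eq_exp_ℂ] at h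
  exact h.symm

theorem exp_conj_unit {n : ℕ} (u : GLn n A) (x : Matrix (Fin n) (Fin n) A) :
    NormedSpace.exp (u.val * x * u⁻¹.val) = u.val * NormedSpace.exp x * u⁻¹.val := by
  let i2 := NormedAlgebra.restrictScalars ℚ ℂ A
  exact Matrix.exp_units_conj u x

/-- A continuous path of matrices all of which are invertible. -/
theorem joined_of_isUnit {n : ℕ} {a b : GLn n A} (γ : Path a.val b.val)
    (hu : ∀ t, IsUnit (γ t)) : Joined a b := by
  refine ⟨⟨⟨fun t => (hu t).unit, (isOpenEmbedding_unitsVal n).continuous_iff.2 γ.continuous⟩,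
    ?_, ?_⟩⟩
  · ext1; simp
  · ext1; simp

theorem joined_of_convex {n : ℕ} {a b : GLn n A} {W : Set (Matrix (Fin n) (Fin n) A)}
    (hW : Convex ℝ W) (hu : ∀ x ∈ W, IsUnit x) (ha : a.val ∈ W) (hb : b.val ∈ W) :
    Joined a b := by
  refine joined_of_isUnit ⟨⟨fun t => (1 - (t : ℝ)) • a.val + (t : ℝ) • b.val, by fun_prop⟩,
    by simp, by simp⟩ fun t => hu _ ?_
  exact hW ha hb (by linarith [t.2.2]) t.2.1 (by ring)

theorem exists_convex_nhds_unit {n : ℕ} (u : GLn n A) :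
    ∃ W : Set (Matrix (Fin n) (Fin n) A), IsOpen W ∧ u.val ∈ W ∧ Convex ℝ W ∧
      ∀ x ∈ W, IsUnit x := by
  obtain ⟨W, h1, h2, h3, h4⟩ := exists_convex_nhds u.val
    ((isOpenEmbedding_unitsVal n).isOpen_range.mem_nhds ⟨u, rfl⟩)
  refine ⟨W, h2, h3, h4, fun x hx => ?_⟩
  obtain ⟨v, rfl⟩ := h1 hx
  exact v.isUnit

/-- The open mapping theorem applies in each entry, and a finite product of open maps is open. -/
theorem isOpenMap_mapMatrix {f : A →⋆ₐ[ℂ] B} (hf : Function.Surjective f) (n : ℕ) :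
    IsOpenMap fun M : Matrix (Fin n) (Fin n) A => M.map f := by
  have h : IsOpenMap f := by
    let g : A →L[ℂ] B := ⟨(f : A →ₐ[ℂ] B).toLinearMap, continuous_starAlgHom f⟩
    exact ContinuousLinearMap.isOpenMap g hf
  exact IsOpenMap.piMap (fun _ => IsOpenMap.piMap (fun _ => h) (by simp))
    (by simp)

/-- An invertible matrix in the component of the identity lifts along a surjection. -/
theorem exists_lift_of_joined {f : A →⋆ₐ[ℂ] B} (hf : Function.Surjective f) {n : ℕ} {b : GLn n B}
    (hb : Joined 1 b) : ∃ a : GLn n A, Joined 1 a ∧ GLn.map f n a = b := by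
  -- The invertibles with a lift joined to 1 form a subgroup. It contains the image of a convex
  -- neighbourhood of 1, so it is open, hence closed, hence contains the component of 1.
  let H : Subgroup (GLn n B) :=
    { carrier := {b | ∃ a : GLn n A, Joined 1 a ∧ GLn.map f n a = b}
      one_mem' := ⟨1, Joined.refl _, map_one _⟩
      mul_mem' := by
        rintro _ _ ⟨a, ha, rfl⟩ ⟨a', ha', rfl⟩
        exact ⟨a * a', by simpa using ha.mul ha', map_mul _ _ _⟩
      inv_mem' := by
        rintro _ ⟨a, ha, rfl⟩
        exact ⟨a⁻¹, by simpa using ha.inv, map_inv _ _⟩ }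
  obtain ⟨W, h1, h2, h3, h4⟩ := exists_convex_nhds_unit (1 : GLn n A)
  have h5 : (H : Set (GLn n B)) ∈ nhds 1 := by
    have h6 := (isOpenMap_mapMatrix hf n) W h1
    refine Filter.mem_of_superset ((h6.preimage Units.continuous_val).mem_nhds
      ⟨_, h2, by simp⟩) ?_
    rintro b ⟨M, hM, hb⟩
    refine ⟨(h4 M hM).unit, joined_of_convex h3 h4 h2 hM, Units.ext hb⟩
  have h7 : IsClopen (H : Set (GLn n B)) :=
    ⟨H.isClosed_of_isOpen (H.isOpen_of_mem_nhds h5), H.isOpen_of_mem_nhds h5⟩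
  exact h7.connectedComponent_subset H.one_mem (pathComponent_subset_component 1 hb)

end MatrixTopology

/-! ### Block sums, elementary matrices and the group K₁ -/

section KOne

variable {A B : Type*} [CStarAlgebra A] [CStarAlgebra B]

/-- The block sum of two invertible matrices. -/
def dsum {n m : ℕ} (u : GLn n A) (v : GLn m A) : GLn (n + m) A where
  val := block u.1 0 0 v.1
  inv := block u.inv 0 0 v.inv
  val_inv := by rw [block_mul]; simp [block_one]
  inv_val := by rw [block_mul]; simp [block_one]

theorem pad_eq_dsum {n m : ℕ} (u : GLn n A) : pad (Nat.le_add_right n m) u = dsum u 1 := by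
  ext i j
  change padMat _ u.1 i j = block u.1 0 0 1 i j
  rw [padMat_apply]
  obtain ⟨i | i, rfl⟩ := finSumFinEquiv.surjective i <;>
  obtain ⟨j | j, rfl⟩ := finSumFinEquiv.surjective j <;>
  simp [block, Matrix.one_apply, Fin.ext_iff, -Fin.natAdd_eq_addNat] <;> omega

/-- The permutation matrix of `s`. -/
def permUnit {n : ℕ} (s : Equiv.Perm (Fin n)) : GLn n A where
  val := s.toPEquiv.toMatrix
  inv := s.symm.toPEquiv.toMatrix
  val_inv := by rw [PEquiv.toMatrix_toPEquiv_mul]; ext i j; simp [PEquiv.toMatrix_apply,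
      Matrix.one_apply]
  inv_val := by rw [PEquiv.toMatrix_toPEquiv_mul]; ext i j; simp [PEquiv.toMatrix_apply,
      Matrix.one_apply]

theorem K1.cls_conj {n : ℕ} (u a : GLn n A) : K1.cls (u * a * u⁻¹) = K1.cls a := by
  rw [K1.cls_mul, K1.cls_mul, K1.cls_inv]
  abel

theorem K1.cls_eq_of_submatrix {n : ℕ} {a b : GLn n A} (s : Equiv.Perm (Fin n))
    (h : a.val = b.val.submatrix s s) : K1.cls a = K1.cls b := by
  rw [← K1.cls_conj (permUnit s) b]
  congr 1
  ext1
  rw [h]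
  change _ = s.toPEquiv.toMatrix * b.val * s.symm.toPEquiv.toMatrix
  rw [PEquiv.toMatrix_toPEquiv_mul, PEquiv.mul_toMatrix_toPEquiv]
  rfl

/-- Factor u ⊕ v as (u ⊕ 1)(1 ⊕ v). The second factor is conjugate by a permutation matrix to the
stabilization of v, and conjugation is invisible in the commutative group K₁. -/
theorem K1.cls_dsum {n m : ℕ} (u : GLn n A) (v : GLn m A) :
    K1.cls (dsum u v) = K1.cls u + K1.cls v := by
  have h : dsum u v = dsum u 1 * dsum 1 v := by
    ext1
    simp [dsum, block_mul]
  rw [h, K1.cls_mul, ← pad_eq_dsum, K1.cls_pad, ← K1.cls_pad (Nat.le_add_left m n) v]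
  congr 1
  let s : Equiv.Perm (Fin (n + m)) := ((finSumFinEquiv.symm.trans (Equiv.sumComm _ _)).trans
    finSumFinEquiv).trans (finCongr (Nat.add_comm m n))
  refine K1.cls_eq_of_submatrix s ?_
  ext i j
  change block 1 0 0 v.1 i j = padMat (Nat.le_add_left m n) v.1 (s i) (s j)
  rw [padMat_apply]
  obtain ⟨i | i, rfl⟩ := finSumFinEquiv.surjective i <;>
  obtain ⟨j | j, rfl⟩ := finSumFinEquiv.surjective j <;>
  simp [block, Matrix.one_apply, Fin.ext_iff, s, -Fin.natAdd_eq_addNat] <;>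
  (intro h; omega)

theorem K1.map_cls (f : A →⋆ₐ[ℂ] B) {n : ℕ} (a : GLn n A) :
    K1.map f (K1.cls a) = K1.cls (GLn.map f n a) := rfl

theorem K1.map_comp {C : Type*} [CStarAlgebra C] (g : B →⋆ₐ[ℂ] C) (f : A →⋆ₐ[ℂ] B) :
    K1.map (g.comp f) = (K1.map g).comp (K1.map f) := by
  ext x
  obtain ⟨n, hn⟩ := x.exists_cls
  obtain ⟨a, rfl⟩ := hn n le_rfl
  rfl

/-- Two invertible matrices of the same class in `K₁(A)` become joined after adding a large enough
identity matrix. -/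
theorem K1.exists_joined_of_cls_eq {n : ℕ} {a b : GLn n A} (h : K1.cls a = K1.cls b) :
    ∃ m : ℕ, Joined (dsum a (1 : GLn m A)) (dsum b (1 : GLn m A)) := by
  obtain ⟨N, h1, h2, H⟩ := Quotient.exact h
  obtain ⟨m, rfl⟩ := Nat.exists_eq_add_of_le h1
  exact ⟨m, by rw [← pad_eq_dsum, ← pad_eq_dsum]; exact H⟩

/-- The rectangular elementary matrix with upper right corner `x`. -/
def elemUpper {n m : ℕ} (x : Matrix (Fin n) (Fin m) A) : GLn (n + m) A where
  val := block 1 x 0 1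
  inv := block 1 (-x) 0 1
  val_inv := by rw [block_mul]; simp [block_one]
  inv_val := by rw [block_mul]; simp [block_one]

/-- The rectangular elementary matrix with lower left corner `x`. -/
def elemLower {n m : ℕ} (x : Matrix (Fin m) (Fin n) A) : GLn (n + m) A where
  val := block 1 0 x 1
  inv := block 1 0 (-x) 1
  val_inv := by rw [block_mul]; simp [block_one]
  inv_val := by rw [block_mul]; simp [block_one]

theorem joined_elemUpper {n m : ℕ} (x : Matrix (Fin n) (Fin m) A) : Joined 1 (elemUpper x) := by
  refine joined_of_isUnit ⟨⟨fun t => (elemUpper ((t : ℝ) • x)).val, ?_⟩, ?_, ?_⟩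
    fun t => Units.isUnit _
  · exact (Continuous.matrix_fromBlocks continuous_const (by fun_prop) continuous_const
      continuous_const).matrix_submatrix _ _
  · simp [elemUpper, block_one]
  · simp

theorem joined_elemLower {n m : ℕ} (x : Matrix (Fin m) (Fin n) A) : Joined 1 (elemLower x) := by
  refine joined_of_isUnit ⟨⟨fun t => (elemLower ((t : ℝ) • x)).val, ?_⟩, ?_, ?_⟩
    fun t => Units.isUnit _
  · exact (Continuous.matrix_fromBlocks continuous_const continuous_const (by fun_prop)
      continuous_const).matrix_submatrix _ _
  · simp [elemLower, block_one]
  · simp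

theorem K1.cls_eq_zero_of_joined {n : ℕ} {a : GLn n A} (h : Joined 1 a) : K1.cls a = 0 := by
  rw [← K1.cls_eq_of_joined h, K1.cls_one]

theorem map_dsum (f : A →⋆ₐ[ℂ] B) {n m : ℕ} (u : GLn n A) (v : GLn m A) :
    GLn.map f (n + m) (dsum u v) = dsum (GLn.map f n u) (GLn.map f m v) := by
  ext1
  change (block u.1 0 0 v.1).map f = block (u.1.map f) 0 0 (v.1.map f)
  rw [block_map]
  simp

/-- For equivalent idempotents `e = x y` and `f = y x`, an invertible matrix conjugating `0 ⊕ f`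
into `e ⊕ 0`. -/
def swapUnit {n m : ℕ} (x : Matrix (Fin n) (Fin m) A) (y : Matrix (Fin m) (Fin n) A) :
    GLn (n + m) A := elemUpper x * elemLower (-y) * elemUpper x

theorem joined_swapUnit {n m : ℕ} (x : Matrix (Fin n) (Fin m) A) (y : Matrix (Fin m) (Fin n) A) :
    Joined 1 (swapUnit x y) := by
  simpa only [mul_one] using! ((joined_elemUpper x).mul (joined_elemLower (-y))).mul
    (joined_elemUpper x)

/-- A product of elementary matrices is invertible for arbitrary `x` and `y`. So the conjugating
matrix of an equivalence over the quotient lifts along a surjection, even though lifted `x` and `y`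
need not give idempotents. -/
theorem map_swapUnit (f : A →⋆ₐ[ℂ] B) {n m : ℕ} (x : Matrix (Fin n) (Fin m) A)
    (y : Matrix (Fin m) (Fin n) A) :
    GLn.map f (n + m) (swapUnit x y) = swapUnit (x.map f) (y.map f) := by
  have h1 : ∀ z : Matrix (Fin n) (Fin m) A, GLn.map f (n + m) (elemUpper z) =
        elemUpper (z.map f) := by
    intro z
    ext1
    change (block 1 z 0 1).map f = block 1 (z.map f) 0 1
    rw [block_map]
    simp
  have h2 : ∀ z : Matrix (Fin m) (Fin n) A, GLn.map f (n + m) (elemLower z) =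
        elemLower (z.map f) := by
    intro z
    ext1
    change (block 1 0 z 1).map f = block 1 0 (z.map f) 1
    rw [block_map]
    simp
  unfold swapUnit
  rw [map_mul, map_mul, h1, h2]
  congr 3
  ext i j
  simp

/-- Passing from x, y to xyx, yxy cuts both down to the corners defined by e and f, without changing
the two products. -/
theorem MvN.exists_normalized {n m : ℕ} {e : Matrix (Fin n) (Fin n) A}
    {f : Matrix (Fin m) (Fin m) A} (he : e * e = e) (hf : f * f = f) (h : MvN e f) :
    ∃ (x : Matrix (Fin n) (Fin m) A) (y : Matrix (Fin m) (Fin n) A),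
      x * y = e ∧ y * x = f ∧ x * f = x ∧ e * x = x ∧ f * y = y ∧ y * e = y := by
  obtain ⟨x, y, rfl, rfl⟩ := h
  simp only [Matrix.mul_assoc] at he hf
  refine ⟨x * y * x, y * x * y, ?_, ?_, ?_, ?_, ?_, ?_⟩ <;> simp only [Matrix.mul_assoc, he, hf]

/-- Under these relations the swap matrix has rows (1 - e, x) and (-y, 1 - f). Both sides reduce to
the matrix whose only nonzero block is x in the upper right corner. -/
theorem swapUnit_mul {n m : ℕ} {e : Matrix (Fin n) (Fin n) A} {f : Matrix (Fin m) (Fin m) A}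
    {x : Matrix (Fin n) (Fin m) A} {y : Matrix (Fin m) (Fin n) A} (h1 : x * y = e) (h2 : y * x = f)
    (h3 : x * f = x) (h4 : e * x = x) :
    (swapUnit x y).val * block 0 0 0 f = block e 0 0 0 * (swapUnit x y).val := by
  have hf : f * f = f := by rw [← h2, Matrix.mul_assoc, ← Matrix.mul_assoc x, h1, h4]
  have he : e * e = e := by rw [← h1, Matrix.mul_assoc, ← Matrix.mul_assoc y, h2,
      ← Matrix.mul_assoc, h3]
  simp [swapUnit, elemUpper, elemLower, block_mul, Matrix.add_mul, Matrix.mul_add, h1, h2, h3, h4,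
    hf, he]

end KOne

/-! ### Matrices and paths of invertibles over a pullback -/

section Pullback

variable {B B₁ B₂ B₁₂ : Type*} [CStarAlgebra B] [CStarAlgebra B₁] [CStarAlgebra B₂]
  [CStarAlgebra B₁₂] {q₁ : B →⋆ₐ[ℂ] B₁} {q₂ : B →⋆ₐ[ℂ] B₂} {ρ₁ : B₁ →⋆ₐ[ℂ] B₁₂}
  {ρ₂ : B₂ →⋆ₐ[ℂ] B₁₂}

namespace IsPullbackSquare

theorem eq_of_eq {B B₁ B₂ B₁₂ : Type*} {q₁ : B → B₁} {q₂ : B → B₂} {ρ₁ : B₁ → B₁₂} {ρ₂ : B₂ → B₁₂}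
    (hB : IsPullbackSquare q₁ q₂ ρ₁ ρ₂) {b c : B} (h1 : q₁ b = q₁ c)
    (h2 : q₂ b = q₂ c) : b = c :=
  (hB.2 _ _ (hB.1 c)).unique ⟨h1, h2⟩ ⟨rfl, rfl⟩

variable (hB : IsPullbackSquare q₁ q₂ ρ₁ ρ₂)

include hB

theorem matrix_ext {ι κ : Type*} {M N : Matrix ι κ B} (h1 : M.map q₁ = N.map q₁)
    (h2 : M.map q₂ = N.map q₂) : M = N :=
  Matrix.ext fun i j => hB.eq_of_eq (Matrix.ext_iff.2 h1 i j) (Matrix.ext_iff.2 h2 i j)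

theorem map_map_matrix {ι κ : Type*} (M : Matrix ι κ B) :
    (M.map q₁).map ρ₁ = (M.map q₂).map ρ₂ :=
  Matrix.ext fun i j => hB.1 (M i j)

theorem exists_matrix {ι κ : Type*} {M₁ : Matrix ι κ B₁} {M₂ : Matrix ι κ B₂}
    (h : M₁.map ρ₁ = M₂.map ρ₂) : ∃ M : Matrix ι κ B, M.map q₁ = M₁ ∧ M.map q₂ = M₂ := by
  have h' : ∀ i j, ∃ b, q₁ b = M₁ i j ∧ q₂ b = M₂ i j := fun i j =>
    (hB.2 _ _ (Matrix.ext_iff.2 h i j)).exists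
  choose M h1 h2 using h'
  exact ⟨M, Matrix.ext h1, Matrix.ext h2⟩

theorem unit_ext {n : ℕ} {u v : GLn n B} (h1 : GLn.map q₁ n u = GLn.map q₁ n v)
    (h2 : GLn.map q₂ n u = GLn.map q₂ n v) : u = v :=
  Units.ext (hB.matrix_ext (congrArg Units.val h1) (congrArg Units.val h2))

theorem map_map_unit {n : ℕ} (u : GLn n B) :
    GLn.map ρ₁ n (GLn.map q₁ n u) = GLn.map ρ₂ n (GLn.map q₂ n u) :=
  Units.ext (hB.map_map_matrix u.val)

theorem exists_unit {n : ℕ} {u₁ : GLn n B₁} {u₂ : GLn n B₂}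
    (h : GLn.map ρ₁ n u₁ = GLn.map ρ₂ n u₂) :
    ∃ u : GLn n B, GLn.map q₁ n u = u₁ ∧ GLn.map q₂ n u = u₂ := by
  obtain ⟨M, h1, h2⟩ := hB.exists_matrix (congrArg Units.val h)
  obtain ⟨N, h3, h4⟩ := hB.exists_matrix (congrArg (fun a => (a⁻¹).val) h)
  change N.map q₁ = u₁⁻¹.val at h3
  change N.map q₂ = u₂⁻¹.val at h4
  refine ⟨⟨M, N, hB.matrix_ext ?_ ?_, hB.matrix_ext ?_ ?_⟩, Units.ext h1, Units.ext h2⟩ <;>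
  rw [Matrix.map_mul] <;> simp [h1, h2, h3, h4]

/-- An injective ⋆-homomorphism of C⋆-algebras is isometric, so the algebraic pullback automatically
carries the subspace topology. This is what lets paths be glued componentwise. -/
theorem isEmbedding : Topology.IsEmbedding fun b => (q₁ b, q₂ b) := by
  let f : B →⋆ₐ[ℂ] B₁ × B₂ := q₁.prod q₂
  have hf : Function.Injective f := fun b c h =>
    hB.eq_of_eq (congrArg Prod.fst h) (congrArg Prod.snd h)
  exact (NonUnitalStarAlgHom.isometry f hf).isEmbedding

theorem continuous_unit {X : Type*} [TopologicalSpace X] {n : ℕ} {γ : X → GLn n B}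
    (h1 : Continuous fun x => GLn.map q₁ n (γ x)) (h2 : Continuous fun x => GLn.map q₂ n (γ x)) :
    Continuous γ := by
  refine (isOpenEmbedding_unitsVal n).continuous_iff.2 (continuous_matrix fun i j => ?_)
  refine hB.isEmbedding.continuous_iff.2 (Continuous.prodMk ?_ ?_)
  · exact (Units.continuous_val.comp h1).matrix_elem i j
  · exact (Units.continuous_val.comp h2).matrix_elem i j

theorem joined_of_path {n : ℕ} {w w' : GLn n B} (γ₁ : Path (GLn.map q₁ n w) (GLn.map q₁ n w'))
    (γ₂ : Path (GLn.map q₂ n w) (GLn.map q₂ n w'))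
    (h : ∀ t, GLn.map ρ₁ n (γ₁ t) = GLn.map ρ₂ n (γ₂ t)) : Joined w w' := by
  choose γ h1 h2 using fun t => hB.exists_unit (h t)
  refine ⟨⟨⟨γ, hB.continuous_unit ?_ ?_⟩, hB.unit_ext ?_ ?_, hB.unit_ext ?_ ?_⟩⟩
  · simpa only [h1] using γ₁.continuous
  · simpa only [h2] using γ₂.continuous
  · rw [h1, γ₁.source]
  · rw [h2, γ₂.source]
  · rw [h1, γ₁.target]
  · rw [h2, γ₂.target]

end IsPullbackSquare

end Pullback

/-! ### Block rows and block columns -/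

section RowCol

variable {A : Type*} {n m k : ℕ}

/-- The block column with blocks `x` and `y`. -/
def colBlock (x : Matrix (Fin n) (Fin k) A) (y : Matrix (Fin m) (Fin k) A) :
    Matrix (Fin (n + m)) (Fin k) A :=
  (Matrix.fromRows x y).submatrix finSumFinEquiv.symm (Equiv.refl _)

/-- The block row with blocks `x` and `y`. -/
def rowBlock (x : Matrix (Fin k) (Fin n) A) (y : Matrix (Fin k) (Fin m) A) :
    Matrix (Fin k) (Fin (n + m)) A :=
  (Matrix.fromCols x y).submatrix (Equiv.refl _) finSumFinEquiv.symm

theorem rowBlock_mul_colBlock [Ring A] {l : ℕ} (x : Matrix (Fin k) (Fin n) A)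
    (y : Matrix (Fin k) (Fin m) A) (z : Matrix (Fin n) (Fin l) A) (w : Matrix (Fin m) (Fin l) A) :
    rowBlock x y * colBlock z w = x * z + y * w := by
  unfold rowBlock colBlock
  rw [Matrix.submatrix_mul_equiv, Matrix.fromCols_mul_fromRows]
  rfl

theorem colBlock_mul_rowBlock [Ring A] (x : Matrix (Fin n) (Fin k) A)
    (y : Matrix (Fin m) (Fin k) A) (z : Matrix (Fin k) (Fin n) A) (w : Matrix (Fin k) (Fin m) A) :
    colBlock x y * rowBlock z w = block (x * z) (x * w) (y * z) (y * w) := by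
  unfold rowBlock colBlock block
  rw [Matrix.submatrix_mul_equiv, Matrix.fromRows_mul_fromCols]

theorem colBlock_mul [Ring A] {l : ℕ} (x : Matrix (Fin n) (Fin k) A)
    (y : Matrix (Fin m) (Fin k) A) (z : Matrix (Fin k) (Fin l) A) :
    colBlock x y * z = colBlock (x * z) (y * z) := by
  ext i j
  obtain ⟨i | i, rfl⟩ := finSumFinEquiv.surjective i <;>
  simp [colBlock, Matrix.mul_apply]

theorem mul_rowBlock [Ring A] {l : ℕ} (x : Matrix (Fin k) (Fin n) A)
    (y : Matrix (Fin k) (Fin m) A) (z : Matrix (Fin l) (Fin k) A) :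
    z * rowBlock x y = rowBlock (z * x) (z * y) := by
  ext i j
  obtain ⟨j | j, rfl⟩ := finSumFinEquiv.surjective j <;>
  simp [rowBlock, Matrix.mul_apply]

theorem colBlock_map {B : Type*} (f : A → B) (x : Matrix (Fin n) (Fin k) A)
    (y : Matrix (Fin m) (Fin k) A) : (colBlock x y).map f = colBlock (x.map f) (y.map f) := by
  ext i j
  obtain ⟨i | i, rfl⟩ := finSumFinEquiv.surjective i <;> simp [colBlock]

theorem rowBlock_map {B : Type*} (f : A → B) (x : Matrix (Fin k) (Fin n) A)
    (y : Matrix (Fin k) (Fin m) A) : (rowBlock x y).map f = rowBlock (x.map f) (y.map f) := by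
  ext i j
  obtain ⟨j | j, rfl⟩ := finSumFinEquiv.surjective j <;> simp [rowBlock]

end RowCol

/-! ### Gluing of free modules and the Milnor map -/

section Milnor

variable {B B₁ B₂ B₁₂ : Type*} [CStarAlgebra B] [CStarAlgebra B₁] [CStarAlgebra B₂]
  [CStarAlgebra B₁₂]

/-- `p` is an idempotent over `B` whose range is the module obtained by gluing `B₁ⁿ` and `B₂ⁿ`
along the automorphism `a` of `B₁₂ⁿ`. -/
def MilnorRep (q₁ : B →⋆ₐ[ℂ] B₁) (q₂ : B →⋆ₐ[ℂ] B₂) (ρ₁ : B₁ →⋆ₐ[ℂ] B₁₂) (ρ₂ : B₂ →⋆ₐ[ℂ] B₁₂)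
    {n N : ℕ} (a : GLn n B₁₂) (p : Matrix (Fin N) (Fin N) B) : Prop :=
  ∃ (X₁ : Matrix (Fin N) (Fin n) B₁) (Y₁ : Matrix (Fin n) (Fin N) B₁)
    (X₂ : Matrix (Fin N) (Fin n) B₂) (Y₂ : Matrix (Fin n) (Fin N) B₂),
    Y₁ * X₁ = 1 ∧ X₁ * Y₁ = p.map q₁ ∧ Y₂ * X₂ = 1 ∧ X₂ * Y₂ = p.map q₂ ∧
    X₂.map ρ₂ = X₁.map ρ₁ * a.val ∧ Y₂.map ρ₂ = a⁻¹.val * Y₁.map ρ₁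

variable {q₁ : B →⋆ₐ[ℂ] B₁} {q₂ : B →⋆ₐ[ℂ] B₂} {ρ₁ : B₁ →⋆ₐ[ℂ] B₁₂} {ρ₂ : B₂ →⋆ₐ[ℂ] B₁₂}

theorem MilnorRep.idem (hB : IsPullbackSquare q₁ q₂ ρ₁ ρ₂) {n N : ℕ} {a : GLn n B₁₂}
    {p : Matrix (Fin N) (Fin N) B} (h : MilnorRep q₁ q₂ ρ₁ ρ₂ a p) : p * p = p := by
  obtain ⟨X₁, Y₁, X₂, Y₂, h1, h2, h3, h4, -, -⟩ := h
  refine hB.matrix_ext ?_ ?_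
  · rw [Matrix.map_mul, ← h2, Matrix.mul_assoc, ← Matrix.mul_assoc Y₁, h1, Matrix.one_mul]
  · rw [Matrix.map_mul, ← h4, Matrix.mul_assoc, ← Matrix.mul_assoc Y₂, h3, Matrix.one_mul]

/-- Milnor's matrix is the column (c(2 - dc), 1 - dc) times the row (d, 1 - dc). In the opposite
order the product is dc(2 - dc) + (1 - dc)² = 1. Over B₁₂ the column becomes (a, 0) and the row
(a⁻¹, 0), which is the gluing condition for diag(1, 0). -/
theorem exists_milnorRep (hB : IsPullbackSquare q₁ q₂ ρ₁ ρ₂) {n : ℕ} {a : GLn n B₁₂}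
    {c d : Matrix (Fin n) (Fin n) B₂} (hc : c.map ρ₂ = a.val) (hd : d.map ρ₂ = a⁻¹.val) :
    ∃ p : Matrix (Fin (n + n)) (Fin (n + n)) B, p.map q₁ = block 1 0 0 0 ∧
      p.map q₂ = milnorMatrix c d ∧ MilnorRep q₁ q₂ ρ₁ ρ₂ a p := by
  have hX : (colBlock (c * (2 - d * c)) (1 - d * c)).map ρ₂ =
      (colBlock (1 : Matrix (Fin n) (Fin n) B₁) (0 : Matrix (Fin n) (Fin n) B₁)).map ρ₁ * a.val := by
    have h2 : (c * (2 - d * c)).map ρ₂ = a.val := by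
      change RingHom.mapMatrix (ρ₂ : B₂ →+* B₁₂) _ = _
      rw [map_mul, map_sub, map_mul, map_ofNat]
      change c.map ρ₂ * (2 - d.map ρ₂ * c.map ρ₂) = _
      rw [hc, hd, Units.inv_mul, ← one_add_one_eq_two, add_sub_cancel_right, mul_one]
    have h3 : (1 - d * c).map ρ₂ = 0 := by
      change RingHom.mapMatrix (ρ₂ : B₂ →+* B₁₂) _ = _
      rw [map_sub, map_mul, map_one]
      change 1 - d.map ρ₂ * c.map ρ₂ = _
      rw [hc, hd, Units.inv_mul, sub_self]
    rw [colBlock_map, colBlock_map, colBlock_mul, h2, h3]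
    simp
  have hY : (rowBlock d (1 - d * c)).map ρ₂ = a⁻¹.val *
      (rowBlock (1 : Matrix (Fin n) (Fin n) B₁) (0 : Matrix (Fin n) (Fin n) B₁)).map ρ₁ := by
    have h3 : (1 - d * c).map ρ₂ = 0 := by
      change RingHom.mapMatrix (ρ₂ : B₂ →+* B₁₂) _ = _
      rw [map_sub, map_mul, map_one]
      change 1 - d.map ρ₂ * c.map ρ₂ = _
      rw [hc, hd, Units.inv_mul, sub_self]
    rw [rowBlock_map, rowBlock_map, mul_rowBlock, hd, h3]
    simp
  have e1 : colBlock (1 : Matrix (Fin n) (Fin n) B₁) (0 : Matrix (Fin n) (Fin n) B₁) *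
      rowBlock (1 : Matrix (Fin n) (Fin n) B₁) (0 : Matrix (Fin n) (Fin n) B₁) =
        block 1 0 0 0 := by
    rw [colBlock_mul_rowBlock]; simp
  have e2 : colBlock (c * (2 - d * c)) (1 - d * c) * rowBlock d (1 - d * c) = milnorMatrix c d := by
    rw [colBlock_mul_rowBlock, milnorMatrix, pow_two]
  obtain ⟨p, h1, h2⟩ := hB.exists_matrix (M₁ := block 1 0 0 0) (M₂ := milnorMatrix c d) (by
    rw [← e1, ← e2, Matrix.map_mul, Matrix.map_mul, hX, hY, ← Matrix.mul_assoc,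
      Matrix.mul_assoc _ a.val, Units.mul_inv, Matrix.mul_one])
  refine ⟨p, h1, h2, _, _, _, _, ?_, by rw [h1, e1], ?_, by rw [h2, e2], hX, hY⟩
  · rw [rowBlock_mul_colBlock]; simp
  · rw [rowBlock_mul_colBlock]; noncomm_ring

/-- The equivalence is X Y' one way and X' Y the other way. The components of each agree over B₁₂
because a and a⁻¹ cancel. In particular the class does not depend on the lifts c and d. -/
theorem MilnorRep.mvn (hB : IsPullbackSquare q₁ q₂ ρ₁ ρ₂) {n N M : ℕ} {a : GLn n B₁₂}
    {p : Matrix (Fin N) (Fin N) B} {p' : Matrix (Fin M) (Fin M) B}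
    (h : MilnorRep q₁ q₂ ρ₁ ρ₂ a p) (h' : MilnorRep q₁ q₂ ρ₁ ρ₂ a p') : MvN p p' := by
  obtain ⟨X₁, Y₁, X₂, Y₂, h1, h2, h3, h4, h5, h6⟩ := h
  obtain ⟨X₁', Y₁', X₂', Y₂', h1', h2', h3', h4', h5', h6'⟩ := h'
  obtain ⟨x, hx1, hx2⟩ := hB.exists_matrix (M₁ := X₁ * Y₁') (M₂ := X₂ * Y₂') (by
    rw [Matrix.map_mul, Matrix.map_mul, h5, h6', ← Matrix.mul_assoc,
      Matrix.mul_assoc _ a.val, Units.mul_inv, Matrix.mul_one])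
  obtain ⟨y, hy1, hy2⟩ := hB.exists_matrix (M₁ := X₁' * Y₁) (M₂ := X₂' * Y₂) (by
    rw [Matrix.map_mul, Matrix.map_mul, h5', h6, ← Matrix.mul_assoc,
      Matrix.mul_assoc _ a.val, Units.mul_inv, Matrix.mul_one])
  refine ⟨x, y, hB.matrix_ext ?_ ?_, hB.matrix_ext ?_ ?_⟩
  · rw [Matrix.map_mul, hx1, hy1, Matrix.mul_assoc, ← Matrix.mul_assoc Y₁', h1', Matrix.one_mul, h2]
  · rw [Matrix.map_mul, hx2, hy2, Matrix.mul_assoc, ← Matrix.mul_assoc Y₂', h3', Matrix.one_mul, h4]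
  · rw [Matrix.map_mul, hx1, hy1, Matrix.mul_assoc, ← Matrix.mul_assoc Y₁, h1, Matrix.one_mul, h2']
  · rw [Matrix.map_mul, hx2, hy2, Matrix.mul_assoc, ← Matrix.mul_assoc Y₂, h3, Matrix.one_mul, h4']

/-- Changing the bases of the free modules over B₁ and B₂ changes the gluing matrix but not the
glued module. -/
theorem MilnorRep.mul {n N : ℕ} {a : GLn n B₁₂} {p : Matrix (Fin N) (Fin N) B}
    (h : MilnorRep q₁ q₂ ρ₁ ρ₂ a p) (u : GLn n B₁) (v : GLn n B₂) :
    MilnorRep q₁ q₂ ρ₁ ρ₂ (GLn.map ρ₁ n u * a * GLn.map ρ₂ n v) p := by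
  obtain ⟨X₁, Y₁, X₂, Y₂, h1, h2, h3, h4, h5, h6⟩ := h
  refine ⟨X₁ * u⁻¹.val, u.val * Y₁, X₂ * v.val, v⁻¹.val * Y₂, ?_, ?_, ?_, ?_, ?_, ?_⟩
  · rw [Matrix.mul_assoc, ← Matrix.mul_assoc Y₁, h1, Matrix.one_mul, Units.mul_inv]
  · rw [Matrix.mul_assoc, ← Matrix.mul_assoc u⁻¹.val, Units.inv_mul, Matrix.one_mul, h2]
  · rw [Matrix.mul_assoc, ← Matrix.mul_assoc Y₂, h3, Matrix.one_mul, Units.inv_mul]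
  · rw [Matrix.mul_assoc, ← Matrix.mul_assoc v.val, Units.mul_inv, Matrix.one_mul, h4]
  · rw [Matrix.map_mul, Matrix.map_mul, h5]
    have e : (GLn.map ρ₁ n u * a * GLn.map ρ₂ n v).val =
      u.val.map ρ₁ * a.val * v.val.map ρ₂ := rfl
    rw [e, Matrix.mul_assoc _ (u⁻¹.val.map ρ₁), ← Matrix.mul_assoc (u⁻¹.val.map ρ₁),
      ← Matrix.mul_assoc (u⁻¹.val.map ρ₁), ← Matrix.map_mul, Units.inv_mul]
    simp [Matrix.mul_assoc]
  · rw [Matrix.map_mul, Matrix.map_mul, h6, mul_inv_rev, mul_inv_rev]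
    have e : ((GLn.map ρ₂ n v)⁻¹ * (a⁻¹ * (GLn.map ρ₁ n u)⁻¹)).val =
      v⁻¹.val.map ρ₂ * (a⁻¹.val * u⁻¹.val.map ρ₁) := rfl
    rw [e, Matrix.mul_assoc, Matrix.mul_assoc a⁻¹.val, ← Matrix.mul_assoc (u⁻¹.val.map ρ₁),
      ← Matrix.map_mul, Units.inv_mul]
    simp

theorem conj_mul_eq_one {C : Type*} [CStarAlgebra C] {q : B →⋆ₐ[ℂ] C} {n N M : ℕ}
    {p : Matrix (Fin N) (Fin N) B} {p' : Matrix (Fin M) (Fin M) B} {x : Matrix (Fin N) (Fin M) B}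
    {y : Matrix (Fin M) (Fin N) B} {X : Matrix (Fin N) (Fin n) C} {Y : Matrix (Fin n) (Fin N) C}
    (h1 : Y * X = 1) (h2 : X * Y = p.map q) (h3 : x * y = p) (h4 : y * x = p')
    (h5 : p * x = x) :
    (Y * x.map q) * (y.map q * X) = 1 ∧ (y.map q * X) * (Y * x.map q) = p'.map q := by
  constructor
  · rw [Matrix.mul_assoc, ← Matrix.mul_assoc (x.map q), ← Matrix.map_mul, h3, ← h2,
      Matrix.mul_assoc, h1, Matrix.mul_one, h1]
  · rw [Matrix.mul_assoc, ← Matrix.mul_assoc X, h2, ← Matrix.map_mul, h5, ← Matrix.map_mul, h4]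

/-- The trivializations of p are transported along the equivalence; since x and y are defined over
B, their two components agree over B₁₂ and a is unchanged. -/
theorem MilnorRep.of_mvn (hB : IsPullbackSquare q₁ q₂ ρ₁ ρ₂) {n N M : ℕ} {a : GLn n B₁₂}
    {p : Matrix (Fin N) (Fin N) B} {p' : Matrix (Fin M) (Fin M) B}
    (h : MilnorRep q₁ q₂ ρ₁ ρ₂ a p) (hp' : p' * p' = p') (hm : MvN p p') :
    MilnorRep q₁ q₂ ρ₁ ρ₂ a p' := by
  obtain ⟨x, y, h7, h8, h9, h10, h11, h12⟩ := hm.exists_normalized (h.idem hB) hp'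
  obtain ⟨X₁, Y₁, X₂, Y₂, h1, h2, h3, h4, h5, h6⟩ := h
  obtain ⟨k1, k2⟩ := conj_mul_eq_one h1 h2 h7 h8 h10
  obtain ⟨k3, k4⟩ := conj_mul_eq_one h3 h4 h7 h8 h10
  refine ⟨_, _, _, _, k1, k2, k3, k4, ?_, ?_⟩
  · rw [Matrix.map_mul, Matrix.map_mul, h5, hB.map_map_matrix, Matrix.mul_assoc]
  · rw [Matrix.map_mul, Matrix.map_mul, h6, hB.map_map_matrix, Matrix.mul_assoc]

/-- The block diagonal matrix with two rectangular blocks. -/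
def bdiag {C : Type*} [Zero C] {r r' s s' : ℕ} (x : Matrix (Fin r) (Fin s) C)
    (y : Matrix (Fin r') (Fin s') C) : Matrix (Fin (r + r')) (Fin (s + s')) C :=
  (Matrix.fromBlocks x 0 0 y).submatrix finSumFinEquiv.symm finSumFinEquiv.symm

theorem bdiag_mul {C : Type*} [Ring C] {r r' s s' t t' : ℕ} (x : Matrix (Fin r) (Fin s) C)
    (y : Matrix (Fin r') (Fin s') C) (z : Matrix (Fin s) (Fin t) C)
    (w : Matrix (Fin s') (Fin t') C) : bdiag x y * bdiag z w = bdiag (x * z) (y * w) := by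
  unfold bdiag
  rw [Matrix.submatrix_mul_equiv, Matrix.fromBlocks_multiply]
  simp

theorem bdiag_map {C D : Type*} [CStarAlgebra C] [CStarAlgebra D] (f : C →⋆ₐ[ℂ] D)
    {r r' s s' : ℕ} (x : Matrix (Fin r) (Fin s) C) (y : Matrix (Fin r') (Fin s') C) :
    (bdiag x y).map f = bdiag (x.map f) (y.map f) := by
  unfold bdiag
  rw [← Matrix.submatrix_map, Matrix.fromBlocks_map]
  simp

theorem bdiag_one {C : Type*} [Ring C] {n m : ℕ} : bdiag (1 : Matrix (Fin n) (Fin n) C)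
    (1 : Matrix (Fin m) (Fin m) C) = 1 := block_one

theorem MilnorRep.one (n : ℕ) : MilnorRep q₁ q₂ ρ₁ ρ₂ (1 : GLn n B₁₂)
    (1 : Matrix (Fin n) (Fin n) B) :=
  ⟨1, 1, 1, 1, by simp, by simp, by simp, by simp, by simp, by simp⟩

theorem MilnorRep.dsum {n N m M : ℕ} {a : GLn n B₁₂} {b : GLn m B₁₂}
    {p : Matrix (Fin N) (Fin N) B} {p' : Matrix (Fin M) (Fin M) B}
    (h : MilnorRep q₁ q₂ ρ₁ ρ₂ a p) (h' : MilnorRep q₁ q₂ ρ₁ ρ₂ b p') :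
    MilnorRep q₁ q₂ ρ₁ ρ₂ (dsum a b) (block p 0 0 p') := by
  obtain ⟨X₁, Y₁, X₂, Y₂, h1, h2, h3, h4, h5, h6⟩ := h
  obtain ⟨X₁', Y₁', X₂', Y₂', h1', h2', h3', h4', h5', h6'⟩ := h'
  have e1 : (block p 0 0 p').map q₁ = bdiag (p.map q₁) (p'.map q₁) := bdiag_map q₁ p p'
  have e2 : (block p 0 0 p').map q₂ = bdiag (p.map q₂) (p'.map q₂) := bdiag_map q₂ p p'
  have e3 : (CStarK.dsum a b).val = bdiag a.val b.val := rfl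
  have e4 : (CStarK.dsum a b)⁻¹.val = bdiag a⁻¹.val b⁻¹.val := rfl
  refine ⟨bdiag X₁ X₁', bdiag Y₁ Y₁', bdiag X₂ X₂', bdiag Y₂ Y₂', ?_, ?_, ?_, ?_, ?_, ?_⟩
  · rw [bdiag_mul, h1, h1', bdiag_one]
  · rw [bdiag_mul, h2, h2', e1]
  · rw [bdiag_mul, h3, h3', bdiag_one]
  · rw [bdiag_mul, h4, h4', e2]
  · rw [bdiag_map, h5, h5', bdiag_map, e3, bdiag_mul]
  · rw [bdiag_map, h6, h6', bdiag_map, e4, bdiag_mul]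

theorem exists_map_matrix_eq {f : B₂ →⋆ₐ[ℂ] B₁₂} (hf : Function.Surjective f) {ι κ : Type*}
    (M : Matrix ι κ B₁₂) : ∃ N : Matrix ι κ B₂, N.map f = M := by
  choose N hN using fun i j => hf (M i j)
  exact ⟨N, Matrix.ext hN⟩

theorem exists_idem_milnorRep (hB : IsPullbackSquare q₁ q₂ ρ₁ ρ₂) (hs : Function.Surjective ρ₂)
    {n : ℕ} (a : GLn n B₁₂) : ∃ p : Matrix (Fin (n + n)) (Fin (n + n)) B,
      p * p = p ∧ MilnorRep q₁ q₂ ρ₁ ρ₂ a p := by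
  obtain ⟨c, hc⟩ := exists_map_matrix_eq hs a.val
  obtain ⟨d, hd⟩ := exists_map_matrix_eq hs a⁻¹.val
  obtain ⟨p, -, -, h⟩ := exists_milnorRep hB hc hd
  exact ⟨p, h.idem hB, h⟩

/-- The value of Milnor's connecting map on an invertible matrix. -/
def milnorFun (hB : IsPullbackSquare q₁ q₂ ρ₁ ρ₂) (hs : Function.Surjective ρ₂) {n : ℕ}
    (a : GLn n B₁₂) : K0 B :=
  K0.cls (exists_idem_milnorRep hB hs a).choose (exists_idem_milnorRep hB hs a).choose_spec.1 -
    K0.cls (1 : Matrix (Fin n) (Fin n) B) (one_mul 1)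

theorem milnorFun_eq (hB : IsPullbackSquare q₁ q₂ ρ₁ ρ₂) (hs : Function.Surjective ρ₂) {n N : ℕ}
    {a : GLn n B₁₂} {p : Matrix (Fin N) (Fin N) B} (h : MilnorRep q₁ q₂ ρ₁ ρ₂ a p) :
    milnorFun hB hs a = K0.cls p (h.idem hB) - K0.cls (1 : Matrix (Fin n) (Fin n) B) (one_mul 1) := by
  unfold milnorFun
  rw [K0.cls_eq_of_mvn (MilnorRep.mvn hB (exists_idem_milnorRep hB hs a).choose_spec.2 h)]

theorem milnorFun_dsum (hB : IsPullbackSquare q₁ q₂ ρ₁ ρ₂) (hs : Function.Surjective ρ₂) {n m : ℕ}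
    (a : GLn n B₁₂) (b : GLn m B₁₂) :
    milnorFun hB hs (dsum a b) = milnorFun hB hs a + milnorFun hB hs b := by
  obtain ⟨p, -, h⟩ := exists_idem_milnorRep hB hs a
  obtain ⟨p', -, h'⟩ := exists_idem_milnorRep hB hs b
  rw [milnorFun_eq hB hs h, milnorFun_eq hB hs h', milnorFun_eq hB hs (h.dsum h'),
    K0.cls_block (h.idem hB) (h'.idem hB), K0.cls_one_add]
  abel

theorem milnorFun_mul (hB : IsPullbackSquare q₁ q₂ ρ₁ ρ₂) (hs : Function.Surjective ρ₂) {n : ℕ}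
    (u : GLn n B₁) (a : GLn n B₁₂) (v : GLn n B₂) :
    milnorFun hB hs (GLn.map ρ₁ n u * a * GLn.map ρ₂ n v) = milnorFun hB hs a := by
  obtain ⟨p, -, h⟩ := exists_idem_milnorRep hB hs a
  rw [milnorFun_eq hB hs h, milnorFun_eq hB hs (h.mul u v)]

theorem milnorFun_one (hB : IsPullbackSquare q₁ q₂ ρ₁ ρ₂) (hs : Function.Surjective ρ₂) (n : ℕ) :
    milnorFun hB hs (1 : GLn n B₁₂) = 0 := by
  rw [milnorFun_eq hB hs (MilnorRep.one n), sub_self]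

theorem milnorFun_pad (hB : IsPullbackSquare q₁ q₂ ρ₁ ρ₂) (hs : Function.Surjective ρ₂) {n N : ℕ}
    (h : n ≤ N) (a : GLn n B₁₂) : milnorFun hB hs (pad h a) = milnorFun hB hs a := by
  obtain ⟨m, rfl⟩ := Nat.exists_eq_add_of_le h
  rw [pad_eq_dsum, milnorFun_dsum, milnorFun_one, add_zero]

/-- The quotient a⁻¹ b lies in the identity component, so it lifts to an invertible v over B₂. Then
b = a ρ₂(v) amounts to a change of basis over B₂. -/
theorem milnorFun_eq_of_joined (hB : IsPullbackSquare q₁ q₂ ρ₁ ρ₂) (hs : Function.Surjective ρ₂)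
    {n : ℕ} {a b : GLn n B₁₂} (h : Joined a b) : milnorFun hB hs a = milnorFun hB hs b := by
  have h1 : Joined 1 (a⁻¹ * b) := by simpa using (Joined.refl a⁻¹).mul h
  obtain ⟨v, -, hv⟩ := exists_lift_of_joined hs h1
  rw [← milnorFun_mul hB hs 1 a v, hv]
  simp

theorem milnorFun_eq_of_cls_eq (hB : IsPullbackSquare q₁ q₂ ρ₁ ρ₂) (hs : Function.Surjective ρ₂)
    {n m : ℕ} {a : GLn n B₁₂} {b : GLn m B₁₂} (h : K1.cls a = K1.cls b) :
    milnorFun hB hs a = milnorFun hB hs b := by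
  obtain ⟨N, h1, h2, H⟩ := Quotient.exact h
  rw [← milnorFun_pad hB hs h1, ← milnorFun_pad hB hs h2]
  exact milnorFun_eq_of_joined hB hs H

/-- Milnor's connecting map. -/
def milnorMap (hB : IsPullbackSquare q₁ q₂ ρ₁ ρ₂) (hs : Function.Surjective ρ₂) :
    K1 B₁₂ →+ K0 B where
  toFun := Quotient.lift (fun a => milnorFun hB hs a.2) fun a b h =>
    milnorFun_eq_of_cls_eq hB hs (Quotient.sound h)
  map_zero' := milnorFun_one hB hs 0
  map_add' x y := by
    obtain ⟨n, hn⟩ := x.exists_cls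
    obtain ⟨m, hm⟩ := y.exists_cls
    obtain ⟨a, rfl⟩ := hn n le_rfl
    obtain ⟨b, rfl⟩ := hm m le_rfl
    rw [← K1.cls_dsum]
    exact milnorFun_dsum hB hs a b

theorem milnorMap_cls (hB : IsPullbackSquare q₁ q₂ ρ₁ ρ₂) (hs : Function.Surjective ρ₂) {n N : ℕ}
    {a : GLn n B₁₂} {p : Matrix (Fin N) (Fin N) B} (h : MilnorRep q₁ q₂ ρ₁ ρ₂ a p) :
    milnorMap hB hs (K1.cls a) =
      K0.cls p (h.idem hB) - K0.cls (1 : Matrix (Fin n) (Fin n) B) (one_mul 1) :=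
  milnorFun_eq hB hs h

theorem isMilnorMap_milnorMap (hB : IsPullbackSquare q₁ q₂ ρ₁ ρ₂) (hs : Function.Surjective ρ₂) :
    IsMilnorMap q₁ q₂ ρ₂ (milnorMap hB hs) := by
  intro n a c d hc hd
  obtain ⟨p, h1, h2, h⟩ := exists_milnorRep hB hc hd
  exact ⟨p, h.idem hB, h1, h2, milnorMap_cls hB hs h⟩

/-- Lifts c and d always exist, and the two prescribed components determine the idempotent over the
pullback, so the formula leaves no freedom. -/
theorem IsMilnorMap.eq (hB : IsPullbackSquare q₁ q₂ ρ₁ ρ₂) (hs : Function.Surjective ρ₂)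
    {D : K1 B₁₂ →+ K0 B} (hD : IsMilnorMap q₁ q₂ ρ₂ D) : D = milnorMap hB hs := by
  ext x
  obtain ⟨n, hn⟩ := x.exists_cls
  obtain ⟨a, rfl⟩ := hn n le_rfl
  obtain ⟨c, hc⟩ := exists_map_matrix_eq hs a.val
  obtain ⟨d, hd⟩ := exists_map_matrix_eq hs a⁻¹.val
  obtain ⟨p, hp, h1, h2, h3⟩ := hD n a c d hc hd
  obtain ⟨p', hp', h1', h2', h3'⟩ := isMilnorMap_milnorMap hB hs n a c d hc hd
  obtain rfl : p = p' := hB.matrix_ext (h1.trans h1'.symm) (h2.trans h2'.symm)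
  rw [h3, h3']

/-! ### Exactness at `K₁(B₁₂)` and `K₀(B)` -/

theorem K0.map_cls_one (f : B →⋆ₐ[ℂ] B₁) {n : ℕ} :
    K0.map f (K0.cls (1 : Matrix (Fin n) (Fin n) B) (one_mul 1)) =
      K0.cls (1 : Matrix (Fin n) (Fin n) B₁) (one_mul 1) := by
  rw [K0.map_cls]
  congr 1
  simp

/-- An idempotent whose components are trivial is obtained by gluing. -/
theorem exists_milnorRep_of_mvn_one (hB : IsPullbackSquare q₁ q₂ ρ₁ ρ₂) {n N : ℕ}
    {p : Matrix (Fin N) (Fin N) B} (h1 : MvN (p.map q₁) (1 : Matrix (Fin n) (Fin n) B₁))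
    (h2 : MvN (p.map q₂) (1 : Matrix (Fin n) (Fin n) B₂)) :
    ∃ a : GLn n B₁₂, MilnorRep q₁ q₂ ρ₁ ρ₂ a p := by
  obtain ⟨X₁, Y₁, h1, h3⟩ := h1
  obtain ⟨X₂, Y₂, h2, h4⟩ := h2
  have e := hB.map_map_matrix p
  rw [← h1, ← h2, Matrix.map_mul, Matrix.map_mul] at e
  have e1 : Y₁.map ρ₁ * X₁.map ρ₁ = 1 := by rw [← Matrix.map_mul, h3]; simp
  have e2 : Y₂.map ρ₂ * X₂.map ρ₂ = 1 := by rw [← Matrix.map_mul, h4]; simp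
  -- Over B₁₂ both trivializations have the image of p as range, so they differ by the invertible Y₁
  -- X₂.
  refine ⟨⟨Y₁.map ρ₁ * X₂.map ρ₂, Y₂.map ρ₂ * X₁.map ρ₁, ?_, ?_⟩, X₁, Y₁, X₂, Y₂, h3, h1, h4, h2,
    ?_, ?_⟩
  · rw [Matrix.mul_assoc, ← Matrix.mul_assoc (X₂.map ρ₂), ← e, Matrix.mul_assoc, e1, Matrix.mul_one,
      e1]
  · rw [Matrix.mul_assoc, ← Matrix.mul_assoc (X₁.map ρ₁), e, Matrix.mul_assoc, e2, Matrix.mul_one,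
      e2]
  · rw [← Matrix.mul_assoc, e, Matrix.mul_assoc, e2, Matrix.mul_one]
  · change _ = Y₂.map ρ₂ * X₁.map ρ₁ * Y₁.map ρ₁
    rw [Matrix.mul_assoc, e, ← Matrix.mul_assoc, e2, Matrix.one_mul]

theorem block_one_map {C : Type*} [CStarAlgebra C] (q : B →⋆ₐ[ℂ] C) {n m : ℕ}
    (e : Matrix (Fin n) (Fin n) B) :
    (block e 0 0 (1 : Matrix (Fin m) (Fin m) B)).map q = block (e.map q) 0 0 1 := by
  rw [block_map]
  simp

theorem exact_milnorMap_left (hB : IsPullbackSquare q₁ q₂ ρ₁ ρ₂) (hs : Function.Surjective ρ₂) :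
    Function.Exact (milnorMap hB hs) ((K0.map q₁).prod (K0.map q₂)) := by
  intro x
  constructor
  · intro hx
    obtain ⟨n, k, e, he, rfl⟩ := K0.exists_cls_sub_one x
    obtain ⟨hx1, hx2⟩ := Prod.mk_eq_zero.1 hx
    rw [map_sub, K0.map_cls_one, K0.map_cls, sub_eq_zero] at hx1 hx2
    obtain ⟨m₁, H1⟩ := K0.exists_mvn_of_cls_eq hx1
    obtain ⟨m₂, H2⟩ := K0.exists_mvn_of_cls_eq hx2
    -- One stabilization must serve both components, so that free modules of the same rank k + m are
    -- glued.
    let m := max m₁ m₂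
    have hK1 := H1 m (le_max_left _ _)
    have hK2 := H2 m (le_max_right _ _)
    rw [block_one, ← block_one_map] at hK1 hK2
    obtain ⟨a, ha⟩ := exists_milnorRep_of_mvn_one hB hK1 hK2
    refine ⟨K1.cls a, ?_⟩
    rw [milnorMap_cls hB hs ha, K0.cls_block he (one_mul 1), K0.cls_one_add]
    abel
  · rintro ⟨y, rfl⟩
    obtain ⟨n, hn⟩ := y.exists_cls
    obtain ⟨a, rfl⟩ := hn n le_rfl
    obtain ⟨p, -, h⟩ := exists_idem_milnorRep hB hs a
    rw [milnorMap_cls hB hs h]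
    obtain ⟨X₁, Y₁, X₂, Y₂, h1, h2, h3, h4, -, -⟩ := h
    refine Prod.ext ?_ ?_
    · change K0.map q₁ _ = 0
      rw [map_sub, K0.map_cls_one, K0.map_cls, sub_eq_zero]
      exact K0.cls_eq_of_mvn ⟨X₁, Y₁, h2, h1⟩
    · change K0.map q₂ _ = 0
      rw [map_sub, K0.map_cls_one, K0.map_cls, sub_eq_zero]
      exact K0.cls_eq_of_mvn ⟨X₂, Y₂, h4, h3⟩

theorem exact_milnorMap_right (hB : IsPullbackSquare q₁ q₂ ρ₁ ρ₂) (hs : Function.Surjective ρ₂) :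
    Function.Exact (diffMap (K1.map ρ₁) (K1.map ρ₂)) (milnorMap hB hs) := by
  intro x
  constructor
  · intro hx
    obtain ⟨n, hn⟩ := x.exists_cls
    obtain ⟨a, rfl⟩ := hn n le_rfl
    obtain ⟨p, -, h⟩ := exists_idem_milnorRep hB hs a
    rw [milnorMap_cls hB hs h, sub_eq_zero] at hx
    obtain ⟨m, hm⟩ := K0.exists_mvn_of_cls_eq hx
    -- After stabilization the identity matrix itself is glued along a ⊕ 1. Its trivializations X₁
    -- and X₂ are then invertible, and ρ₂(X₂) = ρ₁(X₁)(a ⊕ 1) exhibits [a] as a difference.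
    have h' := (h.dsum (MilnorRep.one m)).of_mvn hB (one_mul 1)
      (by simpa only [block_one] using hm m le_rfl)
    obtain ⟨X₁, Y₁, X₂, Y₂, h1, h2, h3, h4, h5, h6⟩ := h'
    have h2' : X₁ * Y₁ = 1 := by rw [h2]; simp
    have h4' : X₂ * Y₂ = 1 := by rw [h4]; simp
    let u : GLn (n + m) B₁ := ⟨X₁, Y₁, h2', h1⟩
    let v : GLn (n + m) B₂ := ⟨X₂, Y₂, h4', h3⟩
    have e : GLn.map ρ₂ _ v = GLn.map ρ₁ _ u * dsum a 1 := Units.ext h5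
    refine ⟨(K1.cls u, K1.cls v), ?_⟩
    change K1.cls (GLn.map ρ₂ _ v) - K1.cls (GLn.map ρ₁ _ u) = _
    rw [e, K1.cls_mul, K1.cls_dsum, K1.cls_one]
    abel
  · rintro ⟨⟨x, y⟩, rfl⟩
    obtain ⟨n, hn⟩ := x.exists_cls
    obtain ⟨u, rfl⟩ := hn n le_rfl
    obtain ⟨m, hm⟩ := y.exists_cls
    obtain ⟨v, rfl⟩ := hm m le_rfl
    change milnorMap hB hs (K1.cls (GLn.map ρ₂ _ v) - K1.cls (GLn.map ρ₁ _ u)) = 0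
    have h1 : milnorMap hB hs (K1.cls (GLn.map ρ₂ _ v)) = 0 := by
      simpa [milnorFun_one] using! milnorFun_mul hB hs 1 1 v
    have h2 : milnorMap hB hs (K1.cls (GLn.map ρ₁ _ u)) = 0 := by
      simpa [milnorFun_one] using! milnorFun_mul hB hs u 1 1
    rw [map_sub, h1, h2, sub_zero]

/-! ### Exactness at `K₁(B₁) ⊕ K₁(B₂)` and `K₀(B₁) ⊕ K₀(B₂)` -/

theorem K0.map_map_of_square (hB : IsPullbackSquare q₁ q₂ ρ₁ ρ₂) (x : K0 B) :
    K0.map ρ₁ (K0.map q₁ x) = K0.map ρ₂ (K0.map q₂ x) := by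
  have h : ρ₁.comp q₁ = ρ₂.comp q₂ := StarAlgHom.ext hB.1
  rw [← AddMonoidHom.comp_apply, ← AddMonoidHom.comp_apply, ← K0.map_comp, ← K0.map_comp, h]

theorem K1.map_map_of_square (hB : IsPullbackSquare q₁ q₂ ρ₁ ρ₂) (x : K1 B) :
    K1.map ρ₁ (K1.map q₁ x) = K1.map ρ₂ (K1.map q₂ x) := by
  have h : ρ₁.comp q₁ = ρ₂.comp q₂ := StarAlgHom.ext hB.1
  rw [← AddMonoidHom.comp_apply, ← AddMonoidHom.comp_apply, ← K1.map_comp, ← K1.map_comp, h]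

theorem exact_K1_middle (hB : IsPullbackSquare q₁ q₂ ρ₁ ρ₂) (hs : Function.Surjective ρ₂) :
    Function.Exact ((K1.map q₁).prod (K1.map q₂)) (diffMap (K1.map ρ₁) (K1.map ρ₂)) := by
  rintro ⟨x, y⟩
  constructor
  · intro h
    obtain ⟨n, hn⟩ := x.exists_cls
    obtain ⟨m, hm⟩ := y.exists_cls
    obtain ⟨u, rfl⟩ := hn (max n m) (le_max_left _ _)
    obtain ⟨v, rfl⟩ := hm (max n m) (le_max_right _ _)
    obtain ⟨k, hk⟩ := K1.exists_joined_of_cls_eq (sub_eq_zero.1 h)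
    have e1 := map_dsum ρ₁ u (1 : GLn k B₁)
    have e2 := map_dsum ρ₂ v (1 : GLn k B₂)
    rw [map_one] at e1 e2
    rw [← e1, ← e2] at hk
    -- The discrepancy between the stabilized images of v and u lies in the identity component. It
    -- lifts to some w joined to 1, and replacing v ⊕ 1 by (v ⊕ 1)w makes the pair compatible
    -- without changing the class over B₂.
    have hk' := (Joined.refl (GLn.map ρ₂ _ (dsum v (1 : GLn k B₂)))⁻¹).mul hk
    rw [inv_mul_cancel] at hk'
    obtain ⟨w, hw1, hw2⟩ := exists_lift_of_joined hs hk'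
    obtain ⟨b, hb1, hb2⟩ := hB.exists_unit (u₁ := dsum u 1) (u₂ := dsum v 1 * w) (by
      rw [map_mul, hw2, mul_inv_cancel_left])
    refine ⟨K1.cls b, Prod.ext ?_ ?_⟩
    · change K1.cls (GLn.map q₁ _ b) = _
      rw [hb1, K1.cls_dsum, K1.cls_one, add_zero]
    · change K1.cls (GLn.map q₂ _ b) = _
      rw [hb2, K1.cls_mul, K1.cls_eq_zero_of_joined hw1, K1.cls_dsum, K1.cls_one, add_zero,
        add_zero]
  · rintro ⟨z, hz⟩
    rw [← hz]
    exact sub_eq_zero.2 (K1.map_map_of_square hB z).symm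

theorem MvN.block_zero {A : Type*} [Ring A] {n m : ℕ} {e : Matrix (Fin n) (Fin n) A}
    (he : e * e = e) :
    MvN (CStarK.block e 0 0 (0 : Matrix (Fin m) (Fin m) A)) e := by
  refine ⟨colBlock e 0, rowBlock e 0, ?_, ?_⟩
  · rw [colBlock_mul_rowBlock]; simp [he]
  · rw [rowBlock_mul_colBlock]; simp [he]

theorem MvN.zero_block {A : Type*} [Ring A] {n m : ℕ} {e : Matrix (Fin n) (Fin n) A}
    (he : e * e = e) :
    MvN (CStarK.block (0 : Matrix (Fin m) (Fin m) A) 0 0 e) e := by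
  refine ⟨colBlock 0 e, rowBlock 0 e, ?_, ?_⟩
  · rw [colBlock_mul_rowBlock]; simp [he]
  · rw [rowBlock_mul_colBlock]; simp [he]

/-- Idempotents over `B₁` and `B₂` with equivalent images in `B₁₂` can be glued. -/
theorem exists_idem_of_mvn (hB : IsPullbackSquare q₁ q₂ ρ₁ ρ₂) (hs : Function.Surjective ρ₂)
    {n m : ℕ} {e : Matrix (Fin n) (Fin n) B₁} {f : Matrix (Fin m) (Fin m) B₂} (he : e * e = e)
    (hf : f * f = f) (h : MvN (e.map ρ₁) (f.map ρ₂)) :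
    ∃ (N : ℕ) (g : Matrix (Fin N) (Fin N) B), g * g = g ∧ MvN (g.map q₁) e ∧ MvN (g.map q₂) f := by
  obtain ⟨x, y, h1, h2, h3, h4, h5, h6⟩ := h.exists_normalized (by rw [← Matrix.map_mul, he])
    (by rw [← Matrix.map_mul, hf])
  obtain ⟨x', rfl⟩ := exists_map_matrix_eq hs x
  obtain ⟨y', rfl⟩ := exists_map_matrix_eq hs y
  have h7 := swapUnit_mul h1 h2 h3 h4
  rw [← map_swapUnit] at h7
  set W := swapUnit x' y'
  -- The component over B₁ is e ⊕ 0. The component over B₂ is 0 ⊕ f conjugated by a lift of the swap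
  -- matrix, which over B₁₂ becomes the image of e ⊕ 0.
  obtain ⟨g, hg1, hg2⟩ := hB.exists_matrix (M₁ := block e 0 0 (0 : Matrix (Fin m) (Fin m) B₁))
    (M₂ := W.val * block 0 0 0 f * W⁻¹.val) (by
      rw [Matrix.map_mul, Matrix.map_mul, block_map, block_map]
      have e1 : W.val.map ρ₂ = (GLn.map ρ₂ _ W).val := rfl
      have e2 : W⁻¹.val.map ρ₂ = (GLn.map ρ₂ _ W)⁻¹.val := rfl
      simp only [Matrix.map_zero _ (map_zero ρ₁), Matrix.map_zero _ (map_zero ρ₂)]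
      rw [e1, e2, h7, Matrix.mul_assoc, Units.mul_inv, Matrix.mul_one])
  refine ⟨_, g, hB.matrix_ext ?_ ?_, ?_, ?_⟩
  · rw [Matrix.map_mul, hg1, block_idem he (zero_mul 0)]
  · rw [Matrix.map_mul, hg2, Matrix.mul_assoc, ← Matrix.mul_assoc W⁻¹.val,
      ← Matrix.mul_assoc W⁻¹.val, Units.inv_mul, Matrix.one_mul, ← Matrix.mul_assoc,
      Matrix.mul_assoc W.val, block_idem (zero_mul 0) hf]
  · rw [hg1]
    exact MvN.block_zero he
  · rw [hg2]
    refine MvN.trans ?_ hf (e := W.val * block 0 0 0 f * W⁻¹.val)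
      (f := block (0 : Matrix (Fin n) (Fin n) B₂) 0 0 f) ?_ (MvN.zero_block (m := n) hf)
    · rw [Matrix.mul_assoc, ← Matrix.mul_assoc W⁻¹.val,
        ← Matrix.mul_assoc W⁻¹.val, Units.inv_mul, Matrix.one_mul, ← Matrix.mul_assoc,
        Matrix.mul_assoc W.val, block_idem (zero_mul 0) hf]
    · refine ⟨W.val * block 0 0 0 f, block 0 0 0 f * W⁻¹.val, ?_, ?_⟩
      · rw [← Matrix.mul_assoc, Matrix.mul_assoc W.val, block_idem (zero_mul 0) hf]
      · rw [Matrix.mul_assoc, ← Matrix.mul_assoc W⁻¹.val, Units.inv_mul, Matrix.one_mul,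
          block_idem (zero_mul 0) hf]

theorem exact_K0_middle (hB : IsPullbackSquare q₁ q₂ ρ₁ ρ₂) (hs : Function.Surjective ρ₂) :
    Function.Exact ((K0.map q₁).prod (K0.map q₂)) (diffMap (K0.map ρ₁) (K0.map ρ₂)) := by
  rintro ⟨x, y⟩
  constructor
  · intro h
    obtain ⟨n, k, e, he, rfl⟩ := K0.exists_cls_sub_one x
    obtain ⟨m, l, f, hf, rfl⟩ := K0.exists_cls_sub_one y
    have h' : K0.map ρ₁ (K0.cls e he - K0.cls (1 : Matrix (Fin k) (Fin k) B₁) (one_mul 1)) =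
      K0.map ρ₂ (K0.cls f hf - K0.cls (1 : Matrix (Fin l) (Fin l) B₂) (one_mul 1)) :=
        (sub_eq_zero.1 h).symm
    rw [map_sub, map_sub, K0.map_cls_one, K0.map_cls_one, K0.map_cls, K0.map_cls,
      sub_eq_sub_iff_add_eq_add, ← K0.cls_block, ← K0.cls_block] at h'
    obtain ⟨j, hj⟩ := K0.exists_mvn_of_cls_eq h'
    replace hj := hj j le_rfl
    simp only [← block_one_map] at hj
    obtain ⟨N, g, hg, hg1, hg2⟩ := exists_idem_of_mvn hB hs
      (block_idem (block_idem he (one_mul 1)) (one_mul 1))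
      (block_idem (block_idem hf (one_mul 1)) (one_mul 1)) hj
    -- The components of g are equivalent to e ⊕ I_l ⊕ I_j and f ⊕ I_k ⊕ I_j, so subtracting
    -- I_{k+l+j} leaves [e] - [I_k] and [f] - [I_l].
    refine ⟨K0.cls g hg - K0.cls (1 : Matrix (Fin (k + l + j)) (Fin (k + l + j)) B) (one_mul 1),
      Prod.ext ?_ ?_⟩
    · change K0.map q₁ _ = _
      rw [map_sub, K0.map_cls_one, K0.map_cls,
        K0.cls_eq_of_mvn (hf := block_idem (block_idem he (one_mul 1)) (one_mul 1)) hg1,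
        K0.cls_block (block_idem he (one_mul 1)) (one_mul 1), K0.cls_block he (one_mul 1),
        K0.cls_one_add, K0.cls_one_add]
      abel_nf
    · change K0.map q₂ _ = _
      rw [map_sub, K0.map_cls_one, K0.map_cls,
        K0.cls_eq_of_mvn (hf := block_idem (block_idem hf (one_mul 1)) (one_mul 1)) hg2,
        K0.cls_block (block_idem hf (one_mul 1)) (one_mul 1), K0.cls_block hf (one_mul 1),
        K0.cls_one_add, K0.cls_one_add]
      abel_nf
  · rintro ⟨z, hz⟩
    rw [← hz]
    exact sub_eq_zero.2 (K0.map_map_of_square hB z).symm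

end Milnor

/-! ### Idempotents and projections -/

/-- Every idempotent in a C⋆-algebra has the same range as a projection. -/
theorem exists_projection {R : Type*} [CStarAlgebra R] {e : R} (he : e * e = e) :
    ∃ p : R, p * p = p ∧ star p = p ∧ e * p = p ∧ p * e = e := by
  have hes : star e * star e = star e := by rw [← star_mul, he]
  -- With z = 1 + b⋆b one has ez = ze = e e⋆ e. By positivity z is invertible, it commutes with e
  -- and e⋆, and e e⋆ z⁻¹ is the projection onto the range of e.
  let b := star e - e
  have hu : IsUnit (1 + star b * b) := by
    let _ := CStarAlgebra.spectralOrder R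
    have _ := CStarAlgebra.spectralOrderedRing R
    have h : (-1 : ℝ) ∉ spectrum ℝ (star b * b) := fun h => by
      have := spectrum_star_mul_self_nonneg (-1 : ℝ) h
      linarith
    have h2 := spectrum.notMem_iff.1 h
    rw [map_neg, map_one] at h2
    simpa [sub_eq_add_neg, add_comm] using h2.neg
  obtain ⟨z, hz⟩ := hu
  have hb : star b * b = e * star e - e - star e + star e * e := by
    simp only [b, star_sub, star_star, sub_mul, mul_sub, he, hes]
    abel
  rw [hb] at hz
  have c1 : z.val * e = e * star e * e := by
    rw [hz]
    simp only [add_mul, sub_mul, one_mul, mul_assoc, he]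
    abel
  have c2 : e * z.val = e * star e * e := by
    rw [hz]
    simp only [mul_add, mul_sub, mul_one, ← mul_assoc, he]
    abel
  have c3 : Commute z.val e := c1.trans c2.symm
  have hzs : star z.val = z.val := by
    rw [hz]
    simp only [star_add, star_sub, star_mul, star_star, star_one]
    abel
  have c4 : Commute z.val (star e) := by
    have := c3.star_star
    rwa [hzs] at this
  have d1 : Commute z⁻¹.val e := c3.units_inv_left
  have d2 : Commute z⁻¹.val (star e) := c4.units_inv_left
  have hzi : star z⁻¹.val = z⁻¹.val := by
    have h1 : star z⁻¹.val * z.val = 1 := by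
      have h := congrArg star z.mul_inv
      rwa [star_mul, hzs, star_one] at h
    exact (Units.inv_eq_of_mul_eq_one_left h1).symm
  have hpe : e * star e * z⁻¹.val * e = e := by
    rw [mul_assoc, d1.eq, ← mul_assoc, ← c2, mul_assoc, Units.mul_inv, mul_one]
  refine ⟨e * star e * z⁻¹.val, ?_, ?_, ?_, hpe⟩
  · rw [← mul_assoc, ← mul_assoc, hpe]
  · rw [star_mul, star_mul, star_star, hzi, (d1.mul_right d2).eq]
  · rw [← mul_assoc, ← mul_assoc, he]

theorem exists_isHermitian_mvn {A : Type*} [CStarAlgebra A] {n : ℕ} {e : Matrix (Fin n) (Fin n) A}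
    (he : e * e = e) : ∃ p : Matrix (Fin n) (Fin n) A, p * p = p ∧ p.IsHermitian ∧ MvN e p := by
  let _ := CStarAlgebra.spectralOrder A
  have _ := CStarAlgebra.spectralOrderedRing A
  obtain ⟨p, h1, h2, h3, h4⟩ := exists_projection (R := CStarMatrix (Fin n) (Fin n) A) (e := e) he
  exact ⟨p, h1, h2, p, e, h4, h3⟩

/-- The selfadjoint part of any lift is again a lift when the target is selfadjoint. -/
theorem exists_isHermitian_lift {A B : Type*} [CStarAlgebra A] [CStarAlgebra B] {f : A →⋆ₐ[ℂ] B}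
    (hf : Function.Surjective f) {n : ℕ} {p : Matrix (Fin n) (Fin n) B} (hp : p.IsHermitian) :
    ∃ Q : Matrix (Fin n) (Fin n) A, Q.IsHermitian ∧ Q.map f = p := by
  obtain ⟨Q, rfl⟩ := exists_map_matrix_eq hf p
  refine ⟨(1 / 2 : ℂ) • (Q + Q.conjTranspose), ?_, ?_⟩
  · unfold Matrix.IsHermitian
    rw [Matrix.conjTranspose_smul, Matrix.conjTranspose_add, Matrix.conjTranspose_conjTranspose,
      add_comm]
    simp
  · have h : Q.conjTranspose.map f = Q.map f := by
      conv_rhs => rw [← hp]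
      exact Matrix.ext fun i j => map_star f (Q j i)
    ext i j
    have h' := Matrix.ext_iff.2 h i j
    simp only [Matrix.map_apply] at h'
    simp only [Matrix.map_apply, Matrix.smul_apply, Matrix.add_apply, map_smul, map_add, h']
    rw [← two_smul ℂ, smul_smul]
    norm_num

/-! ### The Bott map -/

section Bott

variable {B B₁ B₂ B₁₂ : Type*} [CStarAlgebra B] [CStarAlgebra B₁] [CStarAlgebra B₂]
  [CStarAlgebra B₁₂] {q₁ : B →⋆ₐ[ℂ] B₁} {q₂ : B →⋆ₐ[ℂ] B₂} {ρ₁ : B₁ →⋆ₐ[ℂ] B₁₂}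
  {ρ₂ : B₂ →⋆ₐ[ℂ] B₁₂}

theorem map_smul_matrix {A C : Type*} [CStarAlgebra A] [CStarAlgebra C] (f : A →⋆ₐ[ℂ] C)
    {ι κ : Type*} (z : ℂ) (M : Matrix ι κ A) : (z • M).map f = z • M.map f :=
  Matrix.ext fun _ _ => map_smul f _ _

/-- `exp(2πiQ)`. -/
def bottExp {A : Type*} [CStarAlgebra A] {n : ℕ} (Q : Matrix (Fin n) (Fin n) A) : GLn n A :=
  expUnit ((2 * Real.pi * Complex.I : ℂ) • Q)

theorem continuous_bottExp {A : Type*} [CStarAlgebra A] {n : ℕ} :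
    Continuous (bottExp : Matrix (Fin n) (Fin n) A → GLn n A) :=
  continuous_expUnit.comp (continuous_const_smul _)

theorem map_bottExp {A C : Type*} [CStarAlgebra A] [CStarAlgebra C] (f : A →⋆ₐ[ℂ] C) {n : ℕ}
    (Q : Matrix (Fin n) (Fin n) A) : GLn.map f n (bottExp Q) = bottExp (Q.map f) := by
  rw [bottExp, map_expUnit, map_smul_matrix]
  rfl

theorem bottExp_idem {A : Type*} [CStarAlgebra A] {n : ℕ} {e : Matrix (Fin n) (Fin n) A}
    (he : e * e = e) : bottExp e = 1 := by
  ext1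
  change NormedSpace.exp _ = _
  rw [exp_smul_idem he, Complex.exp_two_pi_mul_I]
  simp

theorem bottExp_block {A : Type*} [CStarAlgebra A] {n m : ℕ} (Q : Matrix (Fin n) (Fin n) A)
    (Q' : Matrix (Fin m) (Fin m) A) : bottExp (block Q 0 0 Q') = dsum (bottExp Q) (bottExp Q') := by
  ext1
  change NormedSpace.exp _ = block (NormedSpace.exp _) 0 0 (NormedSpace.exp _)
  rw [← exp_block]
  congr 1
  ext i j
  obtain ⟨i | i, rfl⟩ := finSumFinEquiv.surjective i <;>
  obtain ⟨j | j, rfl⟩ := finSumFinEquiv.surjective j <;>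
  simp [block]

theorem bottExp_conj {A : Type*} [CStarAlgebra A] {n : ℕ} (u : GLn n A)
    (Q : Matrix (Fin n) (Fin n) A) : bottExp (u.val * Q * u⁻¹.val) = u * bottExp Q * u⁻¹ := by
  ext1
  change NormedSpace.exp _ = u.val * NormedSpace.exp _ * u⁻¹.val
  rw [← exp_conj_unit]
  simp

/-- `w` is the matrix `(1, exp(2πiQ))`. -/
def BottRep (q₁ : B →⋆ₐ[ℂ] B₁) (q₂ : B →⋆ₐ[ℂ] B₂) {n : ℕ} (Q : Matrix (Fin n) (Fin n) B₂)
    (w : GLn n B) : Prop :=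
  GLn.map q₁ n w = 1 ∧ GLn.map q₂ n w = bottExp Q

theorem isBottMatrix_iff {n : ℕ} {Q : Matrix (Fin n) (Fin n) B₂} {w : GLn n B} :
    IsBottMatrix q₁ q₂ Q w ↔ BottRep q₁ q₂ Q w :=
  and_congr (Units.ext_iff (u := GLn.map q₁ n w) (v := 1)).symm
    (Units.ext_iff (u := GLn.map q₂ n w) (v := bottExp Q)).symm

theorem exists_bottRep (hB : IsPullbackSquare q₁ q₂ ρ₁ ρ₂) {n : ℕ}
    {Q : Matrix (Fin n) (Fin n) B₂} (hQ : Q.map ρ₂ * Q.map ρ₂ = Q.map ρ₂) :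
    ∃ w : GLn n B, BottRep q₁ q₂ Q w :=
  hB.exists_unit (by rw [map_bottExp, bottExp_idem hQ, map_one])

theorem BottRep.dsum {n m : ℕ} {Q : Matrix (Fin n) (Fin n) B₂} {w : GLn n B}
    {Q' : Matrix (Fin m) (Fin m) B₂} {w' : GLn m B} (h : BottRep q₁ q₂ Q w)
    (h' : BottRep q₁ q₂ Q' w') : BottRep q₁ q₂ (CStarK.block Q 0 0 Q') (dsum w w') := by
  refine ⟨?_, ?_⟩
  · rw [map_dsum, h.1, h'.1]
    exact Units.ext block_one
  · rw [map_dsum, h.2, h'.2, bottExp_block]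

/-- Every point of the segment from Q to Q' lifts the same idempotent, so its exponential is 1 over
B₁₂ and glues with the constant path 1 over B₁. The lifts need not be selfadjoint. -/
theorem BottRep.cls_eq_of_lift (hB : IsPullbackSquare q₁ q₂ ρ₁ ρ₂) {n : ℕ}
    {Q Q' : Matrix (Fin n) (Fin n) B₂} {w w' : GLn n B} (h : BottRep q₁ q₂ Q w)
    (h' : BottRep q₁ q₂ Q' w') (hQ : Q.map ρ₂ * Q.map ρ₂ = Q.map ρ₂)
    (hQQ' : Q.map ρ₂ = Q'.map ρ₂) : K1.cls w = K1.cls w' := by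
  refine K1.cls_eq_of_joined (hB.joined_of_path ((Path.refl 1).cast h.1 h'.1)
    (Path.cast ⟨⟨fun t => bottExp ((1 - (t : ℝ)) • Q + (t : ℝ) • Q'),
      continuous_bottExp.comp (by fun_prop)⟩, by simp, by simp⟩ h.2 h'.2) fun t => ?_)
  have e : ((1 - (t : ℝ)) • Q + (t : ℝ) • Q').map ρ₂ = Q.map ρ₂ := by
    ext i j
    have h1 : ρ₂ (Q i j) = ρ₂ (Q' i j) := Matrix.ext_iff.2 hQQ' i j
    have h2 (r : ℝ) (x : B₂) : ρ₂ (r • x) = r • ρ₂ x := by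
      rw [← Complex.coe_smul, map_smul, Complex.coe_smul]
    simp [h2, h1, ← add_smul]
  change GLn.map ρ₁ n 1 = GLn.map ρ₂ n (bottExp _)
  rw [map_bottExp, e, bottExp_idem hQ, map_one]

/-- Conjugating exp(2πiQ) along a path from 1 to u gives a path that is constantly 1 over B₁₂, since
exp(2πiQ) is 1 there. -/
theorem BottRep.cls_eq_of_conj (hB : IsPullbackSquare q₁ q₂ ρ₁ ρ₂) {n : ℕ}
    {Q : Matrix (Fin n) (Fin n) B₂} {w w' : GLn n B} {u : GLn n B₂} (hu : Joined 1 u)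
    (h : BottRep q₁ q₂ Q w) (h' : BottRep q₁ q₂ (u.val * Q * u⁻¹.val) w')
    (hQ : Q.map ρ₂ * Q.map ρ₂ = Q.map ρ₂) : K1.cls w = K1.cls w' := by
  obtain ⟨γ⟩ := hu
  refine K1.cls_eq_of_joined (hB.joined_of_path ((Path.refl 1).cast h.1 h'.1)
    (Path.cast ⟨⟨fun t => γ t * bottExp Q * (γ t)⁻¹, by fun_prop⟩, by simp, ?_⟩ h.2 h'.2)
    fun t => ?_)
  · simp [bottExp_conj]
  · change GLn.map ρ₁ n 1 = GLn.map ρ₂ n (γ t * bottExp Q * (γ t)⁻¹)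
    rw [map_mul, map_mul, map_bottExp, bottExp_idem hQ, map_inv]
    simp

theorem BottRep.zero (n : ℕ) :
    BottRep q₁ q₂ (0 : Matrix (Fin n) (Fin n) B₂) (1 : GLn n B) :=
  ⟨map_one _, by rw [map_one, bottExp_idem (zero_mul 0)]⟩

/-- Lifting the swap matrix gives an invertible W over B₂, joined to 1, for which W(0 ⊕ Q')W⁻¹ and Q
⊕ 0 lift the same idempotent. Invariance under conjugation and under change of lift then compares
the classes. -/
theorem BottRep.cls_eq_of_mvn (hB : IsPullbackSquare q₁ q₂ ρ₁ ρ₂) (hs : Function.Surjective ρ₂)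
    {n m : ℕ} {Q : Matrix (Fin n) (Fin n) B₂} {w : GLn n B} {Q' : Matrix (Fin m) (Fin m) B₂}
    {w' : GLn m B} (h : BottRep q₁ q₂ Q w) (h' : BottRep q₁ q₂ Q' w')
    (hQ : Q.map ρ₂ * Q.map ρ₂ = Q.map ρ₂) (hQ' : Q'.map ρ₂ * Q'.map ρ₂ = Q'.map ρ₂)
    (hm : MvN (Q.map ρ₂) (Q'.map ρ₂)) : K1.cls w = K1.cls w' := by
  obtain ⟨x, y, h1, h2, h3, h4, h5, h6⟩ := hm.exists_normalized hQ hQ'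
  obtain ⟨x', rfl⟩ := exists_map_matrix_eq hs x
  obtain ⟨y', rfl⟩ := exists_map_matrix_eq hs y
  have h7 := swapUnit_mul h1 h2 h3 h4
  rw [← map_swapUnit] at h7
  have hj := joined_swapUnit x' y'
  set W := swapUnit x' y'
  have hl : (W.val * block 0 0 0 Q' * W⁻¹.val).map ρ₂ = (block Q 0 0 0).map ρ₂ := by
    rw [Matrix.map_mul, Matrix.map_mul, block_map, block_map]
    have e1 : W.val.map ρ₂ = (GLn.map ρ₂ _ W).val := rfl
    have e2 : W⁻¹.val.map ρ₂ = (GLn.map ρ₂ _ W)⁻¹.val := rfl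
    simp only [Matrix.map_zero _ (map_zero ρ₂)]
    rw [e1, e2, h7, Matrix.mul_assoc, Units.mul_inv, Matrix.mul_one]
  have hb : (block Q 0 0 (0 : Matrix (Fin m) (Fin m) B₂)).map ρ₂ *
      (block Q 0 0 (0 : Matrix (Fin m) (Fin m) B₂)).map ρ₂ =
      (block Q 0 0 (0 : Matrix (Fin m) (Fin m) B₂)).map ρ₂ := by
    rw [block_map]
    simp only [Matrix.map_zero _ (map_zero ρ₂)]
    exact block_idem hQ (zero_mul 0)
  have hb' : (block (0 : Matrix (Fin n) (Fin n) B₂) 0 0 Q').map ρ₂ *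
      (block (0 : Matrix (Fin n) (Fin n) B₂) 0 0 Q').map ρ₂ =
      (block (0 : Matrix (Fin n) (Fin n) B₂) 0 0 Q').map ρ₂ := by
    rw [block_map]
    simp only [Matrix.map_zero _ (map_zero ρ₂)]
    exact block_idem (zero_mul 0) hQ'
  obtain ⟨w'', hw''⟩ := exists_bottRep hB (Q := W.val * block 0 0 0 Q' * W⁻¹.val)
    (by rw [hl, hb])
  have e1 := (h.dsum (BottRep.zero m)).cls_eq_of_lift hB hw'' hb hl.symm
  have e2 := ((BottRep.zero n).dsum h').cls_eq_of_conj hB hj hw'' hb'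
  rw [K1.cls_dsum, K1.cls_one, add_zero] at e1
  rw [K1.cls_dsum, K1.cls_one, zero_add] at e2
  exact e1.trans e2.symm

theorem exists_bottRep_lift (hB : IsPullbackSquare q₁ q₂ ρ₁ ρ₂) (hs : Function.Surjective ρ₂)
    {n : ℕ} {e : Matrix (Fin n) (Fin n) B₁₂} (he : e * e = e) :
    ∃ w : GLn n B, ∃ Q : Matrix (Fin n) (Fin n) B₂, Q.map ρ₂ = e ∧ BottRep q₁ q₂ Q w := by
  obtain ⟨Q, rfl⟩ := exists_map_matrix_eq hs e
  obtain ⟨w, hw⟩ := exists_bottRep hB he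
  exact ⟨w, Q, rfl, hw⟩

/-- The Bott map on classes of idempotents. -/
def bottV (hB : IsPullbackSquare q₁ q₂ ρ₁ ρ₂) (hs : Function.Surjective ρ₂) : V B₁₂ →+ K1 B where
  toFun := Quotient.lift (fun e => K1.cls (exists_bottRep_lift hB hs e.idem).choose) fun e f h => by
    obtain ⟨Q, hQ, hw⟩ := (exists_bottRep_lift hB hs e.idem).choose_spec
    obtain ⟨Q', hQ', hw'⟩ := (exists_bottRep_lift hB hs f.idem).choose_spec
    exact hw.cls_eq_of_mvn hB hs hw' (by rw [hQ, e.idem]) (by rw [hQ', f.idem])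
      (by rw [hQ, hQ']; exact h)
  map_zero' := by
    change K1.cls (exists_bottRep_lift hB hs (e := (0 : Matrix (Fin 0) (Fin 0) B₁₂))
      (zero_mul 0)).choose = 0
    rw [Subsingleton.elim (exists_bottRep_lift hB hs (e := (0 : Matrix (Fin 0) (Fin 0) B₁₂))
      (zero_mul 0)).choose 1, K1.cls_one]
  map_add' := by
    rintro ⟨e⟩ ⟨f⟩
    obtain ⟨Q, hQ, hw⟩ := (exists_bottRep_lift hB hs e.idem).choose_spec
    obtain ⟨Q', hQ', hw'⟩ := (exists_bottRep_lift hB hs f.idem).choose_spec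
    obtain ⟨Q'', hQ'', hw''⟩ := (exists_bottRep_lift hB hs (e.sum f).idem).choose_spec
    refine Eq.trans ?_ (K1.cls_dsum _ _)
    refine hw''.cls_eq_of_lift hB (hw.dsum hw') (by rw [hQ'', (e.sum f).idem]) ?_
    rw [hQ'']
    change block e.mat 0 0 f.mat = (block Q 0 0 Q').map ρ₂
    rw [block_map, hQ, hQ']
    simp only [Matrix.map_zero _ (map_zero ρ₂)]

/-- The Bott map `K₀(B₁₂) → K₁(B)` of a pullback square. -/
def bottMap (hB : IsPullbackSquare q₁ q₂ ρ₁ ρ₂) (hs : Function.Surjective ρ₂) : K0 B₁₂ →+ K1 B :=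
  Algebra.GrothendieckAddGroup.lift (bottV hB hs)

theorem bottMap_cls (hB : IsPullbackSquare q₁ q₂ ρ₁ ρ₂) (hs : Function.Surjective ρ₂) {n : ℕ}
    {e : Matrix (Fin n) (Fin n) B₁₂} (he : e * e = e) {Q : Matrix (Fin n) (Fin n) B₂} {w : GLn n B}
    (hQ : Q.map ρ₂ = e) (h : BottRep q₁ q₂ Q w) :
    bottMap hB hs (K0.cls e he) = K1.cls w := by
  obtain ⟨Q', hQ', hw'⟩ := (exists_bottRep_lift hB hs he).choose_spec
  refine Eq.trans (DFunLike.congr_fun (Algebra.GrothendieckAddGroup.lift.symm_apply_apply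
    (bottV hB hs)) _) ?_
  exact hw'.cls_eq_of_lift hB h (by rw [hQ', he]) (by rw [hQ, hQ'])

theorem isBottMap_bottMap (hB : IsPullbackSquare q₁ q₂ ρ₁ ρ₂) (hs : Function.Surjective ρ₂) :
    IsBottMap q₁ q₂ ρ₂ (bottMap hB hs) := by
  rintro n p hp Q - - rfl
  obtain ⟨w, hw⟩ := exists_bottRep hB hp
  exact ⟨w, isBottMatrix_iff.2 hw, bottMap_cls hB hs hp rfl hw⟩

theorem K0.hom_ext {A G : Type*} [Ring A] [AddCommGroup G] {f g : K0 A →+ G}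
    (h : ∀ (n : ℕ) (e : Matrix (Fin n) (Fin n) A) (he : e * e = e),
      f (K0.cls e he) = g (K0.cls e he)) : f = g := by
  ext x
  obtain ⟨n, k, e, he, rfl⟩ := K0.exists_cls_sub_one x
  rw [map_sub, map_sub, h, h]

/-- Although the formula speaks only of projections and selfadjoint lifts, the classes of
projections generate K₀ and each projection has such a lift. -/
theorem IsBottMap.eq (hB : IsPullbackSquare q₁ q₂ ρ₁ ρ₂) (hs : Function.Surjective ρ₂)
    {D : K0 B₁₂ →+ K1 B} (hD : IsBottMap q₁ q₂ ρ₂ D) : D = bottMap hB hs := by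
  refine K0.hom_ext fun n e he => ?_
  obtain ⟨p, hp, hh, hm⟩ := exists_isHermitian_mvn he
  obtain ⟨Q, hQ, hQp⟩ := exists_isHermitian_lift hs hh
  obtain ⟨w, hw, hw'⟩ := hD n p hp Q hh hQ hQp
  rw [K0.cls_eq_of_mvn (hf := hp) hm, hw', bottMap_cls hB hs hp hQp (isBottMatrix_iff.1 hw)]

end Bott

/-! ### Approximation by partitions of unity -/

theorem exists_finite_partition {X E : Type*} [TopologicalSpace X] [CompactSpace X] [T2Space X]
    [NormedAddCommGroup E] (f : C(X, E)) {ε : ℝ} (hε : 0 < ε) :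
    ∃ (s : Finset X) (φ : X → C(X, ℝ)), (∀ i x, 0 ≤ φ i x) ∧ (∀ x, ∑ i ∈ s, φ i x = 1) ∧
      ∀ i x, φ i x ≠ 0 → ‖f x - f i‖ < ε := by
  obtain ⟨ρ, hρ⟩ := PartitionOfUnity.exists_isSubordinate (X := X) (s := Set.univ) isClosed_univ
    (fun i : X => {x | ‖f x - f i‖ < ε})
    (fun i => isOpen_lt (by fun_prop) continuous_const)
    (fun x _ => Set.mem_iUnion.2 ⟨x, by simpa using hε⟩)
  have hfin := ρ.locallyFinite.finite_nonempty_of_compact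
  refine ⟨hfin.toFinset, ρ, ρ.nonneg, fun x => ?_, fun i x h => hρ i (subset_tsupport _ h)⟩
  rw [← ρ.sum_eq_one (Set.mem_univ x)]
  refine (finsum_eq_sum_of_support_subset _ fun i hi => ?_).symm
  simp only [Set.Finite.coe_toFinset, Set.mem_ofPred_eq]
  exact ⟨x, hi⟩

theorem norm_sub_sum_smul_le {X E : Type*} [TopologicalSpace X] [CompactSpace X]
    [NormedAddCommGroup E] [NormedSpace ℝ E] {f : C(X, E)} {ε : ℝ} (hε : 0 < ε) {s : Finset X}
    {φ : X → C(X, ℝ)} (h0 : ∀ i x, 0 ≤ φ i x) (h1 : ∀ x, ∑ i ∈ s, φ i x = 1)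
    (h2 : ∀ i x, φ i x ≠ 0 → ‖f x - f i‖ < ε) :
    ‖f - ∑ i ∈ s, φ i • ContinuousMap.const X (f i)‖ ≤ ε := by
  refine (ContinuousMap.norm_le _ hε.le).2 fun x => ?_
  have e : (f - ∑ i ∈ s, φ i • ContinuousMap.const X (f i)) x = ∑ i ∈ s, φ i x • (f x - f i) := by
    simp only [smul_sub, Finset.sum_sub_distrib, ← Finset.sum_smul, h1, one_smul]
    simp
  rw [e]
  calc ‖∑ i ∈ s, φ i x • (f x - f i)‖ ≤ ∑ i ∈ s, φ i x * ε := by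
        refine norm_sum_le_of_le _ fun i _ => ?_
        rw [norm_smul, Real.norm_of_nonneg (h0 i x)]
        by_cases h : φ i x = 0
        · simp [h]
        · exact mul_le_mul_of_nonneg_left (h2 i x h).le (h0 i x)
    _ = ε := by rw [← Finset.sum_mul, h1, one_mul]

/-- Approximate solutions are corrected repeatedly. The error halves each time and the corrections
are dominated by a geometric series. -/
theorem surjective_of_approx {E F : Type*} [NormedAddCommGroup E] [NormedSpace ℂ E]
    [CompleteSpace E] [NormedAddCommGroup F] [NormedSpace ℂ F] (T : E →L[ℂ] F) (C : ℝ)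
    (h : ∀ y, ∃ x, ‖x‖ ≤ C * ‖y‖ ∧ ‖y - T x‖ ≤ ‖y‖ / 2) : Function.Surjective T := by
  intro y
  choose g hg hg' using h
  let r : ℕ → F := fun k => (fun y => y - T (g y))^[k] y
  have hr (k : ℕ) : r (k + 1) = r k - T (g (r k)) := Function.iterate_succ_apply' _ _ _
  have hn (k : ℕ) : ‖r k‖ ≤ ‖y‖ * (1 / 2) ^ k := by
    induction k with
    | zero => simp [r]
    | succ k ih =>
      rw [hr]
      refine (hg' _).trans ?_
      rw [pow_succ]
      linarith
  have hs : Summable fun k => g (r k) := by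
    refine Summable.of_norm_bounded (g := fun k => |C| * (‖y‖ * (1 / 2) ^ k))
      ((summable_geometric_two.mul_left _).mul_left _) fun k => (hg _).trans ?_
    exact mul_le_mul (le_abs_self C) (hn k) (norm_nonneg _) (abs_nonneg C)
  have hp (n : ℕ) : ∑ k ∈ Finset.range n, T (g (r k)) = y - r n := by
    induction n with
    | zero => simp [r]
    | succ n ih => rw [Finset.sum_range_succ, ih, hr]; abel
  have h0 : Filter.Tendsto r Filter.atTop (nhds 0) := by
    refine squeeze_zero_norm hn ?_
    simpa using (tendsto_pow_atTop_nhds_zero_of_lt_one (r := (1 / 2 : ℝ)) (by norm_num)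
      (by norm_num)).const_mul ‖y‖
  refine ⟨∑' k, g (r k), ?_⟩
  have h1 := (T.hasSum hs.hasSum).tendsto_sum_nat
  simp only [hp] at h1
  refine tendsto_nhds_unique h1 ?_
  simpa using tendsto_const_nhds.sub h0

/-! ### Loop algebras -/

/-- The C⋆-algebra of continuous functions from the circle to `A`. -/
abbrev Loop (A : Type*) [CStarAlgebra A] : Type _ := C(UnitAddCircle, A)

namespace Loop

variable {A B : Type*} [CStarAlgebra A] [CStarAlgebra B]

/-- Evaluation at a point of the circle. -/
def ev (t : UnitAddCircle) : Loop A →⋆ₐ[ℂ] A where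
  toFun f := f t
  map_one' := rfl
  map_mul' _ _ := rfl
  map_zero' := rfl
  map_add' _ _ := rfl
  commutes' _ := rfl
  map_star' _ := rfl

/-- Constant loops. -/
def const : A →⋆ₐ[ℂ] Loop A where
  toFun a := ContinuousMap.const _ a
  map_one' := rfl
  map_mul' _ _ := rfl
  map_zero' := rfl
  map_add' _ _ := rfl
  commutes' _ := rfl
  map_star' _ := rfl

/-- The map between loop algebras given by composition. -/
def map (f : A →⋆ₐ[ℂ] B) : Loop A →⋆ₐ[ℂ] Loop B :=
  ContinuousMap.compStarAlgHom UnitAddCircle f (continuous_starAlgHom f)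

/-- The open mapping theorem gives preimages with a uniform norm bound. Interpolating preimages of
finitely many values by a partition of unity lifts a loop up to half its norm, so no continuous
section of f is needed. -/
theorem map_surjective {f : A →⋆ₐ[ℂ] B} (hf : Function.Surjective f) :
    Function.Surjective (map f) := by
  let T₀ : A →L[ℂ] B := ⟨(f : A →ₐ[ℂ] B).toLinearMap, continuous_starAlgHom f⟩
  obtain ⟨C, hC, hT₀⟩ := T₀.exists_preimage_norm_le hf
  let T : Loop A →L[ℂ] Loop B := ⟨(map f : Loop A →ₐ[ℂ] Loop B).toLinearMap,
    continuous_starAlgHom (map f)⟩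
  refine surjective_of_approx T C fun y => ?_
  by_cases hy : y = 0
  · exact ⟨0, by simp [hy]⟩
  have hpos : 0 < ‖y‖ / 2 := by positivity
  obtain ⟨s, φ, h0, h1, h2⟩ := exists_finite_partition y hpos
  choose g hg hg' using hT₀
  refine ⟨∑ i ∈ s, φ i • ContinuousMap.const _ (g (y i)), ?_, ?_⟩
  · refine (ContinuousMap.norm_le _ (by positivity)).2 fun x => ?_
    calc ‖(∑ i ∈ s, φ i • ContinuousMap.const _ (g (y i)) : Loop A) x‖
        = ‖∑ i ∈ s, φ i x • g (y i)‖ := by simp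
      _ ≤ ∑ i ∈ s, φ i x * (C * ‖y‖) := by
        refine norm_sum_le_of_le _ fun i _ => ?_
        rw [norm_smul, Real.norm_of_nonneg (h0 i x)]
        refine mul_le_mul_of_nonneg_left ((hg' _).trans ?_) (h0 i x)
        exact mul_le_mul_of_nonneg_left (y.norm_coe_le_norm i) hC.le
      _ = C * ‖y‖ := by rw [← Finset.sum_mul, h1, one_mul]
  · have e : T (∑ i ∈ s, φ i • ContinuousMap.const _ (g (y i))) =
        ∑ i ∈ s, φ i • ContinuousMap.const _ (y i) := by
      ext x
      have h3 (r : ℝ) (a : A) : f (r • a) = r • f a := by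
        rw [← Complex.coe_smul, map_smul, Complex.coe_smul]
      have h4 (a : B) : f (g a) = a := hg a
      change f ((∑ i ∈ s, φ i • ContinuousMap.const _ (g (y i)) : Loop A) x) = _
      simp [h3, h4]
    rw [e]
    exact norm_sub_sum_smul_le hpos h0 h1 h2

/-! ### Trigonometric monomials -/

/-- The central loop `z ^ k`. -/
def mono (k : ℤ) : Loop A := ⟨fun t => algebraMap ℂ A (fourier k t), by fun_prop⟩

theorem mono_apply (k : ℤ) (t : UnitAddCircle) :
    (mono k : Loop A) t = algebraMap ℂ A (fourier k t) := rfl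

theorem mono_mul_apply (k : ℤ) (f : Loop A) (t : UnitAddCircle) :
    ((mono k : Loop A) * f) t = fourier k t • f t := (Algebra.smul_def _ _).symm

theorem mono_add (k l : ℤ) : (mono (k + l) : Loop A) = mono k * mono l := by
  ext t
  rw [mono_mul_apply, mono_apply, mono_apply, fourier_add, map_mul, Algebra.smul_def]

theorem mono_zero : (mono 0 : Loop A) = 1 := by
  ext t
  rw [mono_apply, fourier_zero, map_one]
  rfl

theorem mono_mul_comm (k : ℤ) (f : Loop A) : mono k * f = f * mono k :=
  ContinuousMap.ext fun _ => Algebra.commutes _ _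

theorem map_mono (f : A →⋆ₐ[ℂ] B) (k : ℤ) : map f (mono k) = mono k :=
  ContinuousMap.ext fun _ => AlgHomClass.commutes f _

open AddCircle MeasureTheory

/-- The Fourier coefficients of a loop. -/
def coeff (k : ℤ) : Loop A →L[ℂ] A :=
  LinearMap.mkContinuous
    { toFun := fun f => fourierCoeff f k
      map_add' := fun f g => congrFun (fourierCoeff.add
        (f.continuous.integrable_of_hasCompactSupport (HasCompactSupport.of_compactSpace _))
        (g.continuous.integrable_of_hasCompactSupport (HasCompactSupport.of_compactSpace _))) k
      map_smul' := fun c f => fourierCoeff.const_smul f c k } 1 (fun f => by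
        change ‖∫ t, fourier (-k) t • f t ∂haarAddCircle‖ ≤ _
        refine (norm_integral_le_of_norm_le_const (C := ‖f‖) (Filter.Eventually.of_forall
          fun t => ?_)).trans (by simp)
        rw [norm_smul]
        have : ‖fourier (-k) t‖ = 1 := by rw [fourier_apply]; exact Circle.norm_coe _
        rw [this, one_mul]
        exact f.norm_coe_le_norm t)

theorem coeff_apply (k : ℤ) (f : Loop A) :
    coeff k f = ∫ t, fourier (-k) t • f t ∂haarAddCircle := rfl

theorem norm_coeff_le (k : ℤ) (f : Loop A) : ‖coeff k f‖ ≤ ‖f‖ := by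
  refine (norm_integral_le_of_norm_le_const (C := ‖f‖) (Filter.Eventually.of_forall
    fun t => ?_)).trans (by simp)
  rw [norm_smul, fourier_apply, Circle.norm_coe, one_mul]
  exact f.norm_coe_le_norm t

theorem coeff_mono_mul (k l : ℤ) (f : Loop A) : coeff k (mono l * f) = coeff (k - l) f := by
  rw [coeff_apply, coeff_apply]
  congr 1
  ext t
  rw [mono_mul_apply, smul_smul, ← fourier_add, neg_add_eq_sub, neg_sub]

theorem integrable (f : Loop A) : Integrable f haarAddCircle :=
  f.continuous.integrable_of_hasCompactSupport (HasCompactSupport.of_compactSpace _)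

theorem coeff_const_mul (k : ℤ) (a : A) (f : Loop A) :
    coeff k (const a * f) = a * coeff k f := by
  rw [coeff_apply, coeff_apply, ← integral_const_mul_of_integrable (f.integrable.fourier_smul _)]
  congr 1
  ext t
  exact (mul_smul_comm _ _ _).symm

theorem coeff_mul_const (k : ℤ) (a : A) (f : Loop A) :
    coeff k (f * const a) = coeff k f * a := by
  rw [coeff_apply, coeff_apply, ← integral_mul_const_of_integrable (f.integrable.fourier_smul _)]
  congr 1
  ext t
  exact (smul_mul_assoc _ _ _).symm

theorem coeff_one (k : ℤ) : coeff k (1 : Loop A) = if k = 0 then 1 else 0 := by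
  have e : coeff k (1 : Loop A) =
      (∫ t : UnitAddCircle, fourier (-k) t ∂haarAddCircle) • (1 : A) := by
    rw [coeff_apply, ← integral_smul_const]
    rfl
  have h := congrFun (fourierCoeff_fourier (T := 1) 0) k
  simp only [fourierCoeff, fourier_zero, smul_eq_mul, mul_one] at h
  rw [e, h, Pi.single_apply]
  split_ifs <;> simp

theorem coeff_mono_mul_const (k l : ℤ) (a : A) :
    coeff k (mono l * const a) = if k = l then a else 0 := by
  rw [coeff_mono_mul, ← mul_one (const a), coeff_const_mul, coeff_one]
  simp [sub_eq_zero]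

/-! ### Loops with spectrum in an interval -/

/-- The loops whose only nonzero Fourier coefficients are those of index `p, …, q`. -/
def band (A : Type*) [CStarAlgebra A] (p q : ℤ) : Submodule ℂ (Loop A) where
  carrier := {f | f = ∑ k ∈ Finset.Icc p q, mono k * const (coeff k f)}
  zero_mem' := by simp
  add_mem' {f g} hf hg := by
    change f + g = _
    conv_lhs => rw [show f = _ from hf, show g = _ from hg]
    simp [mul_add, Finset.sum_add_distrib]
  smul_mem' c f hf := by
    change c • f = _
    conv_lhs => rw [show f = _ from hf]
    simp [Finset.smul_sum, mul_smul_comm]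

theorem eq_sum_of_mem_band {p q : ℤ} {f : Loop A} (hf : f ∈ band A p q) :
    f = ∑ k ∈ Finset.Icc p q, mono k * const (coeff k f) := hf

theorem mono_mul_const_mem_band {p q k : ℤ} (hk : k ∈ Finset.Icc p q) (a : A) :
    mono k * const a ∈ band A p q := by
  change _ = _
  simp only [coeff_mono_mul_const]
  rw [Finset.sum_eq_single_of_mem k hk]
  · simp
  · intro b _ hb
    simp [hb]

theorem coeff_eq_zero_of_mem_band {p q k : ℤ} {f : Loop A} (hf : f ∈ band A p q)
    (hk : k ∉ Finset.Icc p q) : coeff k f = 0 := by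
  rw [eq_sum_of_mem_band hf, map_sum]
  refine Finset.sum_eq_zero fun l hl => ?_
  rw [coeff_mono_mul_const, if_neg]
  rintro rfl
  exact hk hl

theorem band_induction {p q : ℤ} {S : AddSubmonoid (Loop A)}
    (h : ∀ k, p ≤ k → k ≤ q → ∀ a, mono k * const a ∈ S) {f : Loop A} (hf : f ∈ band A p q) :
    f ∈ S := by
  rw [eq_sum_of_mem_band hf]
  exact S.sum_mem fun k hk => h k (Finset.mem_Icc.1 hk).1 (Finset.mem_Icc.1 hk).2 _

theorem band_le {p q p' q' : ℤ} (hp : p' ≤ p) (hq : q ≤ q') : band A p q ≤ band A p' q' :=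
  fun _ hf => band_induction (S := (band A p' q').toAddSubmonoid)
    (fun _ h1 h2 a => mono_mul_const_mem_band
      (Finset.mem_Icc.2 ⟨hp.trans h1, h2.trans hq⟩) a) hf

theorem mono_mul_mem_band {p q : ℤ} (d : ℤ) {f : Loop A} (hf : f ∈ band A p q) :
    mono d * f ∈ band A (d + p) (d + q) := by
  refine band_induction (S := (band A (d + p) (d + q)).toAddSubmonoid.comap
    (AddMonoidHom.mulLeft (mono d))) (fun k h1 h2 a => ?_) hf
  change mono d * (mono k * const a) ∈ band A (d + p) (d + q)
  rw [← mul_assoc, ← mono_add]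
  exact mono_mul_const_mem_band (Finset.mem_Icc.2 ⟨by omega, by omega⟩) a

theorem const_mem_band {p q : ℤ} (hp : p ≤ 0) (hq : 0 ≤ q) (c : A) : const c ∈ band A p q := by
  have := mono_mul_const_mem_band (Finset.mem_Icc.2 ⟨hp, hq⟩) c
  rwa [mono_zero, one_mul] at this

/-- A partition of unity approximates f by sums of scalar functions times constants, and scalar
functions on the circle are uniform limits of trigonometric polynomials. -/
theorem mem_closure_band (f : Loop A) : f ∈ closure {g : Loop A | ∃ d : ℕ, g ∈ band A (-d) d} := by
  let S : Submodule ℂ (Loop A) :=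
    { carrier := {g : Loop A | ∃ d : ℕ, g ∈ band A (-d) d}
      zero_mem' := ⟨0, zero_mem _⟩
      add_mem' := by
        rintro f g ⟨d, hd⟩ ⟨e, he⟩
        exact ⟨max d e, add_mem (band_le (by simp) (by simp) hd)
          (band_le (by simp) (by simp) he)⟩
      smul_mem' := fun c f ⟨d, hd⟩ => ⟨d, Submodule.smul_mem _ c hd⟩ }
  have h1 (a : A) (φ : C(UnitAddCircle, ℂ)) :
      (ContinuousLinearMap.toSpanSingleton ℂ a).compLeftContinuous ℂ UnitAddCircle φ ∈
        S.topologicalClosure := by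
    have h2 : (Submodule.span ℂ (Set.range (@fourier 1))).topologicalClosure ≤
        S.topologicalClosure.comap ((ContinuousLinearMap.toSpanSingleton ℂ a).compLeftContinuous ℂ
          UnitAddCircle : C(UnitAddCircle, ℂ) →ₗ[ℂ] Loop A) := by
      refine Submodule.topologicalClosure_minimal _ (Submodule.span_le.2 ?_)
        (S.isClosed_topologicalClosure.preimage (ContinuousLinearMap.continuous _))
      rintro _ ⟨k, rfl⟩
      refine S.le_topologicalClosure ⟨k.natAbs, ?_⟩
      have e : (ContinuousLinearMap.toSpanSingleton ℂ a).compLeftContinuous ℂ UnitAddCircle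
          (fourier k) = mono k * const a := by
        ext t
        rw [mono_mul_apply]
        rfl
      change _ ∈ band A _ _
      erw [e]
      exact mono_mul_const_mem_band (Finset.mem_Icc.2 ⟨by omega, by omega⟩) a
    rw [span_fourier_closure_eq_top] at h2
    exact h2 trivial
  change f ∈ (S.topologicalClosure : Set (Loop A))
  rw [← S.isClosed_topologicalClosure.closure_eq]
  refine Metric.mem_closure_iff.2 fun ε hε => ?_
  obtain ⟨s, φ, h2, h3, h4⟩ := exists_finite_partition f (half_pos hε)
  refine ⟨_, ?_, lt_of_le_of_lt ((dist_eq_norm _ _).trans_le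
    (norm_sub_sum_smul_le (half_pos hε) h2 h3 h4)) (half_lt_self hε)⟩
  refine Submodule.sum_mem _ fun i _ => ?_
  convert! h1 (f i) (Complex.ofRealCLM.compLeftContinuous ℝ UnitAddCircle (φ i)) using 1

/-- This is the Riemann–Lebesgue lemma: a trigonometric polynomial has finitely many nonzero
coefficients, and coefficients are contractive in the loop. -/
theorem tendsto_coeff (f : Loop A) :
    Filter.Tendsto (fun k => coeff k f) Filter.cofinite (nhds 0) := by
  refine Metric.tendsto_nhds.2 fun ε hε => ?_
  obtain ⟨g, ⟨d, hg⟩, hfg⟩ := Metric.mem_closure_iff.1 (mem_closure_band f) ε hε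
  have h := (Finset.Icc (-d : ℤ) d).eventually_cofinite_notMem
  filter_upwards [h] with k hk
  have := coeff_eq_zero_of_mem_band hg hk
  rw [dist_zero_right, ← sub_zero (coeff k f), ← this, ← map_sub]
  refine (norm_coeff_le _ _).trans_lt ?_
  rwa [← dist_eq_norm]

end Loop

namespace Loop

variable {A B : Type*} [CStarAlgebra A] [CStarAlgebra B]

/-! ### Matrices over loop algebras -/

theorem unit_ext {n : ℕ} {u v : GLn n (Loop A)}
    (h : ∀ t, GLn.map (ev t) n u = GLn.map (ev t) n v) : u = v := by
  ext i j t
  exact Matrix.ext_iff.2 (congrArg Units.val (h t)) i j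

theorem continuous_ev_unit {n : ℕ} (u : GLn n (Loop A)) :
    Continuous fun t => GLn.map (ev t) n u :=
  (isOpenEmbedding_unitsVal n).continuous_iff.2
    (continuous_matrix fun i j => (u.val i j).continuous)

/-- A closed path of matrices is a matrix over the loop algebra. -/
theorem exists_matrix {ι κ : Type*} {γ : unitInterval → Matrix ι κ A} (hγ : Continuous γ)
    (h01 : γ 0 = γ 1) : ∃ M : Matrix ι κ (Loop A), ∀ (t : unitInterval) i j,
      (M i j : Loop A) ((t : ℝ) : UnitAddCircle) = γ t i j := by
  have h (i : ι) (j : κ) : ∃ f : Loop A, ∀ t : unitInterval, f ((t : ℝ) : UnitAddCircle) =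
      γ t i j := by
    let g : ℝ → A := Set.IccExtend zero_le_one fun t => γ t i j
    have g0 : g 0 = γ 0 i j := Set.IccExtend_left _ _
    have g1 : g 1 = γ 1 i j := Set.IccExtend_right _ _
    have hc : Continuous g := (hγ.matrix_elem i j).Icc_extend'
    refine ⟨⟨AddCircle.liftIco 1 0 g, AddCircle.liftIco_zero_continuous (by rw [g0, g1, h01])
      hc.continuousOn⟩, fun t => ?_⟩
    change AddCircle.liftIco 1 0 g _ = _
    by_cases ht : (t : ℝ) < 1
    · rw [AddCircle.liftIco_zero_coe_apply ⟨t.2.1, ht⟩]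
      exact Set.IccExtend_of_mem _ _ t.2
    · have ht : t = 1 := Subtype.ext (le_antisymm t.2.2 (not_lt.1 ht))
      subst ht
      have e : (((1 : unitInterval) : ℝ) : UnitAddCircle) = ((0 : ℝ) : UnitAddCircle) := by
        simp
      rw [e, AddCircle.liftIco_zero_coe_apply ⟨le_rfl, one_pos⟩, g0, h01]
  choose f hf using h
  exact ⟨f, fun t i j => hf i j t⟩

theorem exists_unitInterval (t : UnitAddCircle) :
    ∃ s : unitInterval, ((s : ℝ) : UnitAddCircle) = t := by
  obtain ⟨s, hs, rfl⟩ := (AddCircle.coe_image_Icc_eq (1 : ℝ) 0).symm ▸ Set.mem_univ t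
  exact ⟨⟨s, hs.1, by simpa using hs.2⟩, rfl⟩

/-- A closed path of invertible matrices is an invertible matrix over the loop algebra. -/
theorem exists_unit {n : ℕ} {γ : unitInterval → GLn n A} (hγ : Continuous γ) (h01 : γ 0 = γ 1) :
    ∃ u : GLn n (Loop A), ∀ t : unitInterval, GLn.map (ev ((t : ℝ) : UnitAddCircle)) n u = γ t := by
  obtain ⟨M, hM⟩ := exists_matrix (Units.continuous_val.comp hγ) (congrArg Units.val h01)
  obtain ⟨N, hN⟩ := exists_matrix (γ := fun t => (γ t)⁻¹.val)
    (Units.continuous_val.comp hγ.inv) (congrArg (fun u => u⁻¹.val) h01)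
  have eM (t : unitInterval) : M.map (ev ((t : ℝ) : UnitAddCircle)) = (γ t).val :=
    Matrix.ext (hM t)
  have eN (t : unitInterval) : N.map (ev ((t : ℝ) : UnitAddCircle)) = (γ t)⁻¹.val :=
    Matrix.ext (hN t)
  have key {P : Matrix (Fin n) (Fin n) (Loop A)} (h : ∀ t : unitInterval,
      P.map (ev ((t : ℝ) : UnitAddCircle)) = 1) : P = 1 := by
    refine Matrix.ext fun i j => ContinuousMap.ext fun t => ?_
    obtain ⟨s, rfl⟩ := exists_unitInterval t
    refine (Matrix.ext_iff.2 (h s) i j).trans ?_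
    rw [Matrix.one_apply, Matrix.one_apply]
    split_ifs <;> rfl
  refine ⟨⟨M, N, key fun t => ?_, key fun t => ?_⟩, fun t => Units.ext (eM t)⟩
  · rw [Matrix.map_mul, eM, eN, Units.mul_inv]
  · rw [Matrix.map_mul, eM, eN, Units.inv_mul]

/-- A matrix over `A`, as a constant matrix over the loop algebra. -/
def cst {ι κ : Type*} (M : Matrix ι κ A) : Matrix ι κ (Loop A) := M.map const

theorem cst_mul {ι κ μ : Type*} [Fintype κ] (M : Matrix ι κ A) (N : Matrix κ μ A) :
    cst (M * N) = cst M * cst N := Matrix.map_mul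

theorem cst_one {ι : Type*} [DecidableEq ι] : cst (1 : Matrix ι ι A) = 1 := by
  simp [cst]

theorem cst_zero {ι κ : Type*} : cst (0 : Matrix ι κ A) = 0 := by
  simp [cst]

theorem cst_sub {ι κ : Type*} (M N : Matrix ι κ A) : cst (M - N) = cst M - cst N := by
  ext; simp [cst]

theorem cst_add {ι κ : Type*} (M N : Matrix ι κ A) : cst (M + N) = cst M + cst N := by
  ext; simp [cst]

theorem cst_pow {ι : Type*} [Fintype ι] [DecidableEq ι] (M : Matrix ι ι A) (k : ℕ) :
    cst (M ^ k) = cst M ^ k :=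
  map_pow (RingHom.mapMatrix (m := ι) (const : A →⋆ₐ[ℂ] Loop A).toRingHom) M k

/-- The matrix of Fourier coefficients of a matrix of loops. -/
def mcoeff {ι κ : Type*} (k : ℤ) (M : Matrix ι κ (Loop A)) : Matrix ι κ A := M.map (coeff k)

theorem continuous_mcoeff {ι κ : Type*} (k : ℤ) :
    Continuous (mcoeff k : Matrix ι κ (Loop A) → Matrix ι κ A) :=
  Continuous.matrix_map continuous_id (coeff k).continuous

/-- The scalar matrix `z ^ k`. -/
def zmat (n : ℕ) (k : ℤ) : GLn n (Loop A) where
  val := Matrix.diagonal fun _ => mono k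
  inv := Matrix.diagonal fun _ => mono (-k)
  val_inv := by simp [← mono_add, mono_zero]
  inv_val := by simp [← mono_add, mono_zero]

section

variable {n : ℕ}

theorem zmat_mul_apply (k : ℤ) (M : Matrix (Fin n) (Fin n) (Loop A)) (i j : Fin n) :
    ((zmat n k).val * M : Matrix (Fin n) (Fin n) (Loop A)) i j = mono k * M i j :=
        Matrix.diagonal_mul _ _ _ _

theorem zmat_commute (k : ℤ) (M : Matrix (Fin n) (Fin n) (Loop A)) :
    Commute (zmat n k).val M := by
  ext i j : 1
  rw [zmat_mul_apply, mono_mul_comm]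
  exact (Matrix.mul_diagonal (fun _ => mono k) M i j).symm

theorem zmat_add (k l : ℤ) : (zmat n (k + l) : GLn n (Loop A)) = zmat n k * zmat n l := by
  ext1
  simp [zmat, mono_add]

theorem zmat_zero : (zmat n 0 : GLn n (Loop A)) = 1 := by
  ext1
  simp [zmat, mono_zero]

theorem mcoeff_zmat_mul (k l : ℤ) (M : Matrix (Fin n) (Fin n) (Loop A)) :
    mcoeff k ((zmat n l).val * M) = mcoeff (k - l) M := by
  ext i j
  change coeff k (((zmat n l).val * M : Matrix (Fin n) (Fin n) (Loop A)) i j) = _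
  rw [zmat_mul_apply, coeff_mono_mul]
  rfl

theorem mcoeff_cst_mul (k : ℤ) (a : Matrix (Fin n) (Fin n) A)
    (M : Matrix (Fin n) (Fin n) (Loop A)) : mcoeff k (cst a * M) = a * mcoeff k M := by
  ext i j
  change coeff k (∑ l, const (a i l) * M l j) = ∑ l, a i l * coeff k (M l j)
  simp [map_sum, coeff_const_mul]

theorem mcoeff_mul_cst (k : ℤ) (a : Matrix (Fin n) (Fin n) A)
    (M : Matrix (Fin n) (Fin n) (Loop A)) : mcoeff k (M * cst a) = mcoeff k M * a := by
  ext i j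
  change coeff k (∑ l, M i l * const (a l j)) = ∑ l, coeff k (M i l) * a l j
  simp [map_sum, coeff_mul_const]

theorem mcoeff_one (k : ℤ) :
    mcoeff k (1 : Matrix (Fin n) (Fin n) (Loop A)) = if k = 0 then 1 else 0 := by
  ext i j
  change coeff k ((1 : Matrix (Fin n) (Fin n) (Loop A)) i j) = _
  rw [Matrix.one_apply, apply_ite (coeff k), coeff_one, map_zero]
  split_ifs with h h' <;> simp [Matrix.one_apply, *]

theorem mcoeff_cst (k : ℤ) (a : Matrix (Fin n) (Fin n) A) :
    mcoeff k (cst a) = if k = 0 then a else 0 := by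
  rw [← mul_one (cst a), mcoeff_cst_mul, mcoeff_one]
  split_ifs <;> simp

theorem mcoeff_add (k : ℤ) (M N : Matrix (Fin n) (Fin n) (Loop A)) :
    mcoeff k (M + N) = mcoeff k M + mcoeff k N := by
  ext; simp [mcoeff]

theorem mcoeff_sum {ι : Type*} (s : Finset ι) (k : ℤ) (M : ι → Matrix (Fin n) (Fin n) (Loop A)) :
    mcoeff k (∑ i ∈ s, M i) = ∑ i ∈ s, mcoeff k (M i) := by
  ext; simp [mcoeff, Matrix.sum_apply]

variable (n A) in
/-- The matrices over the loop algebra with spectrum in an interval. -/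
def mband (p q : ℤ) : Submodule ℂ (Matrix (Fin n) (Fin n) (Loop A)) where
  carrier := {M | ∀ i j, M i j ∈ band A p q}
  zero_mem' _ _ := zero_mem _
  add_mem' h h' i j := add_mem (h i j) (h' i j)
  smul_mem' c _ h i j := Submodule.smul_mem _ c (h i j)

theorem eq_sum_of_mem_mband {p q : ℤ} {M : Matrix (Fin n) (Fin n) (Loop A)}
    (h : M ∈ mband A n p q) :
    M = ∑ k ∈ Finset.Icc p q, (zmat n k).val * cst (mcoeff k M) := by
  ext i j : 1
  rw [Matrix.sum_apply]
  simp only [zmat_mul_apply]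
  exact eq_sum_of_mem_band (h i j)

theorem mcoeff_eq_zero_of_mem_mband {p q k : ℤ} {M : Matrix (Fin n) (Fin n) (Loop A)}
    (h : M ∈ mband A n p q) (hk : k ∉ Finset.Icc p q) : mcoeff k M = 0 :=
  Matrix.ext fun i j => coeff_eq_zero_of_mem_band (h i j) hk

theorem mband_le {p q p' q' : ℤ} (hp : p' ≤ p) (hq : q ≤ q') : mband A n p q ≤ mband A n p' q' :=
  fun _ h i j => band_le hp hq (h i j)

theorem zmat_mul_mem_mband {p q : ℤ} (d : ℤ) {M : Matrix (Fin n) (Fin n) (Loop A)}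
    (h : M ∈ mband A n p q) : (zmat n d).val * M ∈ mband A n (d + p) (d + q) := fun i j => by
  rw [zmat_mul_apply]
  exact mono_mul_mem_band d (h i j)

theorem cst_mem_mband {p q : ℤ} (hp : p ≤ 0) (hq : 0 ≤ q) (c : Matrix (Fin n) (Fin n) A) :
    cst c ∈ mband A n p q := fun i j => const_mem_band hp hq (c i j)

theorem exists_mem_mband (W : Set (Matrix (Fin n) (Fin n) (Loop A))) (hW : IsOpen W)
    (hne : W.Nonempty) : ∃ M ∈ W, ∃ d : ℕ, M ∈ mband A n (-d) d := by
  have h0 : Dense {g : Loop A | ∃ d : ℕ, g ∈ band A (-d) d} := fun f => mem_closure_band f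
  have h1 : Dense {M : Fin n → Fin n → Loop A | ∀ i j, ∃ d : ℕ, M i j ∈ band A (-d) d} := by
    have := dense_pi Set.univ (fun (i : Fin n) _ => dense_pi Set.univ (fun (j : Fin n) _ => h0))
    refine this.mono fun M hM i j => ?_
    exact hM i trivial j trivial
  obtain ⟨M, hM, hM'⟩ := h1.inter_open_nonempty W hW hne
  choose d hd using hM'
  refine ⟨M, hM, Finset.univ.sup fun p : Fin n × Fin n => d p.1 p.2, fun i j => ?_⟩
  have : d i j ≤ Finset.univ.sup fun p : Fin n × Fin n => d p.1 p.2 :=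
    Finset.le_sup (f := fun p : Fin n × Fin n => d p.1 p.2) (Finset.mem_univ (i, j))
  exact band_le (by simpa using this) (by simpa using this) (hd i j)

end

/-! ### The Bott homomorphism into the loop algebra -/

/-- The loop `1 - e + z e`. -/
def bottLoop {n : ℕ} (e : Matrix (Fin n) (Fin n) A) (he : e * e = e) : GLn n (Loop A) where
  val := cst (1 - e) + (zmat n 1).val * cst e
  inv := cst (1 - e) + (zmat n (-1)).val * cst e
  val_inv := by
    have h1 : cst (1 - e) * cst e = 0 := by rw [← cst_mul]; simp [sub_mul, he, cst_zero]
    have h2 : cst e * cst (1 - e) = 0 := by rw [← cst_mul]; simp [mul_sub, he, cst_zero]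
    have h3 : cst (1 - e) * cst (1 - e) = cst (1 - e) := by rw [← cst_mul, one_sub_idem he]
    have h4 : cst e * cst e = cst e := by rw [← cst_mul, he]
    rw [mul_add, add_mul, add_mul, h3, mul_assoc, h2, ← mul_assoc, ← (zmat_commute _ _).eq,
      mul_assoc, h1, ← mul_assoc, mul_assoc _ (cst e), ← (zmat_commute (-1) (cst e)).eq,
      ← mul_assoc, mul_assoc _ (cst e), h4, ← Units.val_mul, ← zmat_add]
    simp [zmat_zero, ← cst_add, cst_one]
  inv_val := by
    have h1 : cst (1 - e) * cst e = 0 := by rw [← cst_mul]; simp [sub_mul, he, cst_zero]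
    have h2 : cst e * cst (1 - e) = 0 := by rw [← cst_mul]; simp [mul_sub, he, cst_zero]
    have h3 : cst (1 - e) * cst (1 - e) = cst (1 - e) := by rw [← cst_mul, one_sub_idem he]
    have h4 : cst e * cst e = cst e := by rw [← cst_mul, he]
    rw [mul_add, add_mul, add_mul, h3, mul_assoc, h2, ← mul_assoc, ← (zmat_commute _ _).eq,
      mul_assoc, h1, ← mul_assoc, mul_assoc _ (cst e), ← (zmat_commute 1 (cst e)).eq,
      ← mul_assoc, mul_assoc _ (cst e), h4, ← Units.val_mul, ← zmat_add]
    simp [zmat_zero, ← cst_add, cst_one]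

theorem map_cst (f : A →⋆ₐ[ℂ] B) {ι κ : Type*} (M : Matrix ι κ A) :
    (cst M).map (map f) = cst (M.map f) := rfl

theorem map_zmat (f : A →⋆ₐ[ℂ] B) (n : ℕ) (k : ℤ) :
    GLn.map (map f) n (zmat n k) = zmat n k := by
  ext1
  change (Matrix.diagonal fun _ => mono k).map (map f) = Matrix.diagonal fun _ => mono k
  rw [Matrix.diagonal_map (map_zero _)]
  simp [map_mono]

theorem map_bottLoop (f : A →⋆ₐ[ℂ] B) {n : ℕ} {e : Matrix (Fin n) (Fin n) A} (he : e * e = e) :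
    GLn.map (map f) n (bottLoop e he) = bottLoop (e.map f) (by rw [← Matrix.map_mul, he]) := by
  ext1
  change RingHom.mapMatrix (m := Fin n) (map f : Loop A →+* Loop B)
    (cst (1 - e) + (zmat n 1).val * cst e) = _
  rw [_root_.map_add, _root_.map_mul]
  congr 1
  · change (cst (1 - e)).map (map f) = cst (1 - e.map f)
    rw [map_cst]
    congr 1
    ext i j
    simp [Matrix.one_apply, apply_ite f]
  · congr 1
    exact congrArg Units.val (map_zmat f n 1)

/-- For idempotent e both sides are 1 - e + exp(2πit)e. This links loops to the Bott map and reduces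
block sums and conjugates of such loops to properties of the exponential. -/
theorem ev_bottLoop {n : ℕ} {e : Matrix (Fin n) (Fin n) A} (he : e * e = e) (t : ℝ) :
    GLn.map (ev (t : UnitAddCircle)) n (bottLoop e he) = bottExp ((t : ℂ) • e) := by
  ext1
  change _ = NormedSpace.exp _
  rw [smul_smul, exp_smul_idem he]
  ext i j
  change ((cst (1 - e) + (zmat n 1).val * cst e : Matrix (Fin n) (Fin n) (Loop A)) i j)
    (t : UnitAddCircle) = _
  rw [Matrix.add_apply, zmat_mul_apply, ContinuousMap.add_apply, mono_mul_apply, fourier_coe_apply,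
    Matrix.add_apply, Matrix.smul_apply]
  congr 3
  push_cast
  ring_nf

theorem ev_zero_bottLoop {n : ℕ} {e : Matrix (Fin n) (Fin n) A} (he : e * e = e) :
    GLn.map (ev 0) n (bottLoop e he) = 1 := by
  have := ev_bottLoop he 0
  rw [Complex.ofReal_zero, zero_smul, bottExp_idem (zero_mul 0)] at this
  exact this

theorem bottLoop_block {n m : ℕ} {e : Matrix (Fin n) (Fin n) A} {f : Matrix (Fin m) (Fin m) A}
    (he : e * e = e) (hf : f * f = f) :
    bottLoop (block e 0 0 f) (block_idem he hf) = dsum (bottLoop e he) (bottLoop f hf) := by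
  refine unit_ext fun t => ?_
  obtain ⟨s, rfl⟩ := exists_unitInterval t
  rw [map_dsum, ev_bottLoop, ev_bottLoop, ev_bottLoop, ← bottExp_block]
  congr 1
  ext i j
  obtain ⟨i | i, rfl⟩ := finSumFinEquiv.surjective i <;>
  obtain ⟨j | j, rfl⟩ := finSumFinEquiv.surjective j <;>
  simp [block]

theorem bottLoop_zero (n : ℕ) : bottLoop (0 : Matrix (Fin n) (Fin n) A) (zero_mul 0) = 1 := by
  ext1
  simp [bottLoop, cst_zero, cst_one]

theorem bottLoop_one (n : ℕ) : bottLoop (1 : Matrix (Fin n) (Fin n) A) (one_mul 1) = zmat n 1 := by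
  ext1
  simp [bottLoop, cst_zero, cst_one]

/-- The loops of e ⊕ 0 and 0 ⊕ f are conjugate by a constant invertible matrix. -/
theorem cls_bottLoop_eq_of_mvn {n m : ℕ} {e : Matrix (Fin n) (Fin n) A}
    {f : Matrix (Fin m) (Fin m) A} (he : e * e = e) (hf : f * f = f) (h : MvN e f) :
    K1.cls (bottLoop e he) = K1.cls (bottLoop f hf) := by
  obtain ⟨x, y, h1, h2, h3, h4, -, -⟩ := h.exists_normalized he hf
  have h5 := swapUnit_mul h1 h2 h3 h4
  set W := swapUnit x y
  have h6 : bottLoop (block e 0 0 (0 : Matrix (Fin m) (Fin m) A)) (block_idem he (zero_mul 0)) =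
      GLn.map const _ W * bottLoop (block (0 : Matrix (Fin n) (Fin n) A) 0 0 f)
        (block_idem (zero_mul 0) hf) * (GLn.map const _ W)⁻¹ := by
    refine unit_ext fun t => ?_
    obtain ⟨s, rfl⟩ := exists_unitInterval t
    have e1 : GLn.map (ev ((s : ℝ) : UnitAddCircle)) _ (GLn.map const _ W) = W := rfl
    rw [_root_.map_mul, _root_.map_mul, map_inv, e1, ev_bottLoop, ev_bottLoop, ← bottExp_conj]
    congr 1
    rw [Matrix.mul_smul, Matrix.smul_mul, h5, Matrix.mul_assoc, Units.mul_inv, Matrix.mul_one]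
  have h7 := congrArg K1.cls h6
  rwa [K1.cls_conj, bottLoop_block he (zero_mul 0), bottLoop_block (zero_mul 0) hf, K1.cls_dsum,
    K1.cls_dsum, bottLoop_zero, bottLoop_zero, K1.cls_one, K1.cls_one, add_zero, zero_add] at h7

variable (A) in
/-- The Bott homomorphism on classes of idempotents. -/
def bottHomV : V A →+ K1 (Loop A) where
  toFun := Quotient.lift (fun e => K1.cls (bottLoop e.mat e.idem)) fun e f h =>
    cls_bottLoop_eq_of_mvn e.idem f.idem h
  map_zero' := (congrArg K1.cls (bottLoop_zero 0)).trans (K1.cls_one 0)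
  map_add' := by
    rintro ⟨e⟩ ⟨f⟩
    exact (congrArg K1.cls (bottLoop_block e.idem f.idem)).trans (K1.cls_dsum _ _)

variable (A) in
/-- The Bott homomorphism `K₀(A) → K₁(C(𝕋, A))`. -/
def bottHom : K0 A →+ K1 (Loop A) := Algebra.GrothendieckAddGroup.lift (bottHomV A)

theorem bottHom_cls {n : ℕ} {e : Matrix (Fin n) (Fin n) A} (he : e * e = e) :
    bottHom A (K0.cls e he) = K1.cls (bottLoop e he) :=
  DFunLike.congr_fun (Algebra.GrothendieckAddGroup.lift.symm_apply_apply (bottHomV A)) _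

theorem map_bottHom (f : A →⋆ₐ[ℂ] B) (x : K0 A) :
    K1.map (map f) (bottHom A x) = bottHom B (K0.map f x) := by
  have : (K1.map (map f)).comp (bottHom A) = (bottHom B).comp (K0.map f) := by
    refine K0.hom_ext fun n e he => ?_
    rw [AddMonoidHom.comp_apply, AddMonoidHom.comp_apply, bottHom_cls, K0.map_cls, bottHom_cls,
      K1.map_cls, map_bottLoop]
  exact DFunLike.congr_fun this x

theorem ev_zero_bottHom (x : K0 A) : K1.map (ev 0) (bottHom A x) = 0 := by
  have : (K1.map (ev 0)).comp (bottHom A) = 0 := by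
    refine K0.hom_ext fun n e he => ?_
    rw [AddMonoidHom.comp_apply, bottHom_cls, K1.map_cls, ev_zero_bottLoop, K1.cls_one]
    rfl
  exact DFunLike.congr_fun this x

end Loop

/-! ### Block Toeplitz matrices -/

section Toeplitz

variable {S : Type*} [Ring S] {m : ℕ}

/-- The Toeplitz matrix `(c (r + i - j))`. -/
def toep (m : ℕ) (c : ℤ → S) (r : ℤ) : Matrix (Fin m) (Fin m) S :=
  Matrix.of fun i j => c (r + (i : ℕ) - (j : ℕ))

/-- For i < m the window -i, …, 2m - 1 - i contains the support 0, …, m. A window of length 2m is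
then cut into two blocks of length m. -/
theorem sum_window_right {h : ℤ → S} (hh : ∀ k ∉ Finset.Icc (0 : ℤ) m, h k = 0) {i : ℕ}
    (hi : i < m) : ∑ s ∈ Finset.Icc (0 : ℤ) m, h s = ∑ x ∈ Finset.range (m + m), h (x - i) := by
  refine Finset.sum_of_injOn (fun s : ℤ => (s + i).toNat) ?_ ?_ ?_ ?_
  · intro s hs t ht hst
    simp only [Finset.coe_Icc, Set.mem_Icc] at hs ht
    simp only at hst
    omega
  · intro s hs
    simp only [Finset.coe_Icc, Set.mem_Icc] at hs
    simp only [Finset.coe_range, Set.mem_Iio]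
    omega
  · intro x _ hx
    refine hh _ fun hx' => hx ⟨x - i, Finset.mem_coe.2 hx', ?_⟩
    simp
  · intro s hs
    simp only [Finset.mem_Icc] at hs
    congr 1
    omega

theorem sum_window_left {h : ℤ → S} (hh : ∀ k ∉ Finset.Icc (0 : ℤ) m, h k = 0) {i : ℕ}
    (hi : i < m) : ∑ s ∈ Finset.Icc (0 : ℤ) m, h s =
      ∑ x ∈ Finset.range (m + m), h (m + i - x) := by
  refine Finset.sum_of_injOn (fun s : ℤ => (m + i - s).toNat) ?_ ?_ ?_ ?_
  · intro s hs t ht hst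
    simp only [Finset.coe_Icc, Set.mem_Icc] at hs ht
    simp only at hst
    omega
  · intro s hs
    simp only [Finset.coe_Icc, Set.mem_Icc] at hs
    simp only [Finset.coe_range, Set.mem_Iio]
    omega
  · intro x _ hx
    refine hh _ fun hx' => hx ⟨m + i - x, Finset.mem_coe.2 hx', ?_⟩
    simp
  · intro s hs
    simp only [Finset.mem_Icc] at hs
    congr 1
    omega

variable {c g : ℤ → S} (hc : ∀ k ∉ Finset.Icc (0 : ℤ) m, c k = 0)
include hc

/-- Grouping coefficients in blocks of length m turns a polynomial of degree at most m into one of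
degree one, with coefficients `toep m c 0` and `toep m c m`. The blocks `toep m g (k * m)` are then
the coefficients of its inverse. -/
theorem toep_mul_toep (hcg : ∀ k, ∑ s ∈ Finset.Icc (0 : ℤ) m, c s * g (k - s) =
    if k = 0 then 1 else 0)
    (k : ℤ) : toep m c 0 * toep m g (k * m) + toep m c m * toep m g ((k - 1) * m) =
      if k = 0 then 1 else 0 := by
  ext i j
  have h1 := hcg (k * m + i - j)
  rw [sum_window_left (h := fun s => c s * g (k * m + i - j - s))
    (fun s hs => by rw [hc s hs, zero_mul]) i.2, Finset.sum_range_add] at h1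
  have h2 : (if k * m + (i : ℕ) - (j : ℕ) = 0 then (1 : S) else 0) =
      (if k = 0 then (1 : Matrix (Fin m) (Fin m) S) else 0) i j := by
    -- Since i and j are less than m, their difference is a multiple of m only when it is 0.
    have h3 : k * m + (i : ℕ) - (j : ℕ) = 0 ↔ k = 0 ∧ i = j := by
      constructor
      · intro h
        have hk : k = 0 := by
          have hi := i.2
          have hj := j.2
          by_contra hk
          rcases lt_or_gt_of_ne hk with hk | hk <;> nlinarith
        subst hk
        exact ⟨rfl, Fin.ext (by omega)⟩
      · rintro ⟨rfl, rfl⟩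
        ring
    rw [if_congr h3 rfl rfl]
    by_cases hk : k = 0
    · simp [hk, Matrix.one_apply]
    · simp [hk]
  rw [← h2, ← h1, Matrix.add_apply, Matrix.mul_apply, Matrix.mul_apply, add_comm]
  rw [← Fin.sum_univ_eq_sum_range fun x => c (m + (i : ℕ) - x) * g (k * m + (i : ℕ) - (j : ℕ) -
      (m + (i : ℕ) - x)), ← Fin.sum_univ_eq_sum_range fun x => c (m + (i : ℕ) - (m + x : ℕ)) *
      g (k * m + (i : ℕ) - (j : ℕ) - (m + (i : ℕ) - (m + x : ℕ)))]
  congr 1 <;> refine Finset.sum_congr rfl fun l _ => ?_ <;> simp only [toep, Matrix.of_apply] <;>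
  congr 2 <;> push_cast <;> ring

theorem toep_mul_toep' (hcg : ∀ k, ∑ s ∈ Finset.Icc (0 : ℤ) m, g (k - s) * c s =
    if k = 0 then 1 else 0)
    (k : ℤ) : toep m g (k * m) * toep m c 0 + toep m g ((k - 1) * m) * toep m c m =
      if k = 0 then 1 else 0 := by
  ext i j
  have h1 := hcg (k * m + i - j)
  rw [sum_window_right (h := fun s => g (k * m + i - j - s) * c s)
    (fun s hs => by rw [hc s hs, mul_zero]) j.2, Finset.sum_range_add] at h1
  have h2 : (if k * m + (i : ℕ) - (j : ℕ) = 0 then (1 : S) else 0) =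
      (if k = 0 then (1 : Matrix (Fin m) (Fin m) S) else 0) i j := by
    have h3 : k * m + (i : ℕ) - (j : ℕ) = 0 ↔ k = 0 ∧ i = j := by
      constructor
      · intro h
        have hk : k = 0 := by
          have hi := i.2
          have hj := j.2
          by_contra hk
          rcases lt_or_gt_of_ne hk with hk | hk <;> nlinarith
        subst hk
        exact ⟨rfl, Fin.ext (by omega)⟩
      · rintro ⟨rfl, rfl⟩
        ring
    rw [if_congr h3 rfl rfl]
    by_cases hk : k = 0
    · simp [hk, Matrix.one_apply]
    · simp [hk]
  rw [← h2, ← h1, Matrix.add_apply, Matrix.mul_apply, Matrix.mul_apply]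
  rw [← Fin.sum_univ_eq_sum_range fun x => g (k * m + (i : ℕ) - (j : ℕ) - (x - (j : ℕ))) *
      c (x - (j : ℕ)), ← Fin.sum_univ_eq_sum_range fun x => g (k * m + (i : ℕ) - (j : ℕ) -
      ((m + x : ℕ) - (j : ℕ))) * c ((m + x : ℕ) - (j : ℕ))]
  congr 1 <;> refine Finset.sum_congr rfl fun l _ => ?_ <;> simp only [toep, Matrix.of_apply] <;>
  congr 2 <;> push_cast <;> ring

end Toeplitz

/-- The projection onto a spectral subspace, given by the coefficients of the resolvent. -/
theorem idem_of_resolvent {T : Type*} [Ring T] [TopologicalSpace T] [IsTopologicalRing T]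
    [T2Space T]
    {α β : T} {G : ℤ → T} (h1 : ∀ k, α * G k + β * G (k - 1) = if k = 0 then 1 else 0)
    (h2 : ∀ k, G k * α + G (k - 1) * β = if k = 0 then 1 else 0)
    (hG : Filter.Tendsto G Filter.cofinite (nhds 0)) : α * G 0 * (α * G 0) = α * G 0 := by
  -- The relations at -j - 1 and j + 1 make this product independent of j. As the coefficients tend
  -- to 0, it vanishes, and this removes the error term in the idempotent equation.
  have step (j : ℕ) : G j * β * G (-j - 1) = G 0 * β * G (-1) := by
    induction j with
    | zero => simp
    | succ j ih =>
      have e1 := h1 (-(j : ℤ) - 1)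
      have e2 := h2 ((j : ℤ) + 1)
      rw [if_neg (by omega)] at e1 e2
      rw [← ih]
      push_cast
      have e3 : -((j : ℤ) + 1) - 1 = -(j : ℤ) - 1 - 1 := by ring
      have e4 : (j : ℤ) + 1 - 1 = j := by ring
      rw [e4] at e2
      rw [e3, mul_assoc, eq_neg_of_add_eq_zero_right e1, mul_neg, ← mul_assoc,
        eq_neg_of_add_eq_zero_left e2, neg_mul, neg_neg]
  have inj1 : Function.Injective fun j : ℕ => (j : ℤ) := Nat.cast_injective
  have inj2 : Function.Injective fun j : ℕ => (-j - 1 : ℤ) := fun a b h => by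
    simpa using h
  have lim : Filter.Tendsto (fun j : ℕ => G j * β * G (-j - 1)) Filter.atTop (nhds 0) := by
    have l1 := hG.comp inj1.tendsto_cofinite
    have l2 := hG.comp inj2.tendsto_cofinite
    rw [Nat.cofinite_eq_atTop] at l1 l2
    simpa using (l1.mul_const β).mul l2
  simp only [step] at lim
  have h0 : G 0 * β * G (-1) = 0 := tendsto_nhds_unique tendsto_const_nhds lim
  have e0 := h1 0
  rw [if_pos rfl, zero_sub] at e0
  calc α * G 0 * (α * G 0) = α * G 0 * (α * G 0 + β * G (-1)) - α * (G 0 * β * G (-1)) := by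
        noncomm_ring
    _ = α * G 0 := by rw [e0, h0]; simp

/-! ### Classes of idempotents along paths -/

section Homotopy

variable {A : Type*} [CStarAlgebra A] {ι : Type*} [Fintype ι] [DecidableEq ι]

theorem isOpen_isUnit_matrix : IsOpen {x : Matrix ι ι A | IsUnit x} := by
  let i := Matrix.linftyOpNormedRing (n := ι) (α := A)
  have : @CompleteSpace (Matrix ι ι A) i.toPseudoMetricSpace.toUniformSpace :=
    Matrix.instCompleteSpace ι ι A
  exact Units.isOpen (R := Matrix ι ι A)

/-- The element fe + (1 - f)(1 - e) intertwines e and f: multiplied by e on the right or by f on the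
left it gives fe. -/
theorem mvnEquiv_of_isUnit {e f : Matrix ι ι A} (he : e * e = e) (hf : f * f = f)
    (h : IsUnit (f * e + (1 - f) * (1 - e))) : MvNEquiv e f := by
  obtain ⟨u, hu⟩ := h
  have h1 : u.val * e = f * u.val := by
    rw [hu]
    simp only [add_mul, mul_add, mul_sub, sub_mul, mul_one, one_mul, mul_assoc, he]
    simp only [← mul_assoc, hf]
    abel
  refine ⟨e * u⁻¹.val, u.val * e, ?_, ?_⟩
  · rw [mul_assoc, ← mul_assoc u⁻¹.val, Units.inv_mul, one_mul, he]
  · rw [mul_assoc, ← mul_assoc e, he, ← mul_assoc, h1, mul_assoc, Units.mul_inv, mul_one]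

/-- For nearby idempotents the intertwiner is close to 1, hence invertible. So the class is locally
constant, and the interval is connected. -/
theorem V.cls_eq_of_path {γ : unitInterval → Matrix ι ι A} (hγ : Continuous γ)
    (h : ∀ t, γ t * γ t = γ t) (s t : unitInterval) :
    V.cls (γ s) (h s) = V.cls (γ t) (h t) := by
  refine IsLocallyConstant.apply_eq_of_isPreconnected (f := fun t => V.cls (γ t) (h t))
    ((IsLocallyConstant.iff_eventually_eq _).2 fun s => ?_) isPreconnected_univ
    (Set.mem_univ s) (Set.mem_univ t)
  have hc : Continuous fun t => γ s * γ t + (1 - γ s) * (1 - γ t) := by fun_prop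
  have hu : IsUnit (γ s * γ s + (1 - γ s) * (1 - γ s)) := by
    rw [h, one_sub_idem (h s)]
    simp
  filter_upwards [hc.continuousAt.preimage_mem_nhds (isOpen_isUnit_matrix.mem_nhds hu)] with t ht
  exact V.cls_eq_iff.2 (mvnEquiv_of_isUnit (h t) (h s) ht)

/-- The class in `K₀` of a matrix if it is idempotent, and `0` otherwise. -/
def idemClass {ι : Type*} [Fintype ι] (e : Matrix ι ι A) : K0 A :=
  open Classical in
  if he : e * e = e then Algebra.GrothendieckAddGroup.of (V.cls e he) else 0

theorem idemClass_eq {ι : Type*} [Fintype ι] {e : Matrix ι ι A} (he : e * e = e) :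
    idemClass e = Algebra.GrothendieckAddGroup.of (V.cls e he) := dif_pos he

theorem comp_diagonal_idem {κ : Type*} [Fintype κ] [DecidableEq κ] {f : ι → Matrix κ κ A}
    (hf : ∀ i, f i * f i = f i) :
    Matrix.compRingEquiv ι κ A (Matrix.diagonal f) * Matrix.compRingEquiv ι κ A (Matrix.diagonal f)
      = Matrix.compRingEquiv ι κ A (Matrix.diagonal f) := by
  rw [← map_mul, Matrix.diagonal_mul_diagonal]
  simp only [hf]

theorem V.cls_comp_diagonal {κ : Type*} [Fintype κ] [DecidableEq κ] {f : ι → Matrix κ κ A}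
    (hf : ∀ i, f i * f i = f i) :
    V.cls (Matrix.compRingEquiv ι κ A (Matrix.diagonal f)) (comp_diagonal_idem hf) =
      ∑ i, V.cls (f i) (hf i) := by
  -- Induct on the set of diagonal blocks that are kept, the others being replaced by 0; a new block
  -- is orthogonal to those already present.
  have key (s : Finset ι) : V.cls (Matrix.compRingEquiv ι κ A
      (Matrix.diagonal fun i => if i ∈ s then f i else 0))
      (comp_diagonal_idem fun i => by split_ifs <;> simp [hf]) = ∑ i ∈ s, V.cls (f i) (hf i) := by
    induction s using Finset.induction_on with
    | empty =>
      simp only [Finset.notMem_empty, if_false, Finset.sum_empty]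
      rw [← V.cls_zero (n := 0)]
      refine V.cls_eq_iff.2 ⟨0, 0, ?_, by simp⟩
      rw [Matrix.zero_mul, show (Matrix.diagonal fun _ : ι => (0 : Matrix κ κ A)) = 0 from
        Matrix.diagonal_zero, map_zero]
    | insert a s ha ih =>
      rw [Finset.sum_insert ha, ← ih]
      have hz (g : ι → Matrix κ κ A) (hg : ∀ i, g i = 0) :
          Matrix.compRingEquiv ι κ A (Matrix.diagonal g) = 0 := by
        rw [show g = fun _ => 0 from funext hg, Matrix.diagonal_zero, map_zero]
      have hd : (Matrix.diagonal fun i => if i ∈ insert a s then f i else 0) =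
          Matrix.diagonal (Pi.single a (f a)) + Matrix.diagonal fun i => if i ∈ s then f i else 0
              := by
        rw [Matrix.diagonal_add]
        congr 1
        ext1 i
        by_cases hi : i = a
        · subst hi; simp [ha]
        · simp [hi]
      have hs : Matrix.compRingEquiv ι κ A (Matrix.diagonal (Pi.single a (f a))) *
          Matrix.compRingEquiv ι κ A (Matrix.diagonal (Pi.single a (f a))) =
          Matrix.compRingEquiv ι κ A (Matrix.diagonal (Pi.single a (f a))) :=
        comp_diagonal_idem fun i => by
          by_cases hi : i = a
          · subst hi; simp [hf]
          · simp [hi]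
      have e1 : V.cls (f a) (hf a) =
          V.cls (Matrix.compRingEquiv ι κ A (Matrix.diagonal (Pi.single a (f a)))) hs := by
        refine V.cls_eq_iff.2 ⟨Matrix.of fun i p => if p.1 = a then f a i p.2 else 0,
          Matrix.of fun p i => if p.1 = a then f a p.2 i else 0, ?_, ?_⟩
        · conv_rhs => rw [← hf a]
          ext i j
          simp only [Matrix.mul_apply, Fintype.sum_prod_type, Matrix.of_apply]
          rw [Finset.sum_eq_single a]
          · simp
          · intro b _ hb; simp [hb]
          · simp
        · ext ⟨i, k⟩ ⟨j, l⟩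
          have := Matrix.ext_iff.2 (hf a) k l
          simp only [Matrix.mul_apply] at this
          by_cases hi : i = a
          · subst hi
            by_cases hj : i = j
            · subst hj
              simp [Matrix.mul_apply, Matrix.comp_apply, this]
            · simp [Matrix.mul_apply, Matrix.comp_apply, hj, Ne.symm hj]
          · by_cases hj : i = j
            · subst hj
              simp [Matrix.mul_apply, Matrix.comp_apply, hi]
            · simp [Matrix.mul_apply, Matrix.comp_apply, hi, hj]
      rw [e1, ← V.cls_add_of_orthogonal]
      · congr 1
        rw [← map_add, ← hd]
      · rw [← map_mul, Matrix.diagonal_mul_diagonal]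
        refine hz _ fun i => ?_
        by_cases hi : i = a
        · subst hi; simp [ha]
        · simp [hi]
      · rw [← map_mul, Matrix.diagonal_mul_diagonal]
        refine hz _ fun i => ?_
        by_cases hi : i = a
        · subst hi; simp [ha]
        · simp [hi]
      · rw [← map_add, ← hd]
        exact comp_diagonal_idem fun i => by split_ifs <;> simp [hf]
  have := key Finset.univ
  simpa only [Finset.mem_univ, if_true] using this

end Homotopy

/-! ### Spectral idempotents and injectivity of the Bott homomorphism -/

namespace Loop

variable {A : Type*} [CStarAlgebra A] {n : ℕ}

open Filter

theorem sum_mcoeff_mul {m : ℤ} {F : Matrix (Fin n) (Fin n) (Loop A)} (hF : F ∈ mband A n 0 m)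
    (G : Matrix (Fin n) (Fin n) (Loop A)) (k : ℤ) :
    mcoeff k (F * G) = ∑ s ∈ Finset.Icc 0 m, mcoeff s F * mcoeff (k - s) G := by
  conv_lhs => rw [eq_sum_of_mem_mband hF]
  rw [Finset.sum_mul, mcoeff_sum]
  refine Finset.sum_congr rfl fun s _ => ?_
  rw [mul_assoc, mcoeff_zmat_mul, mcoeff_cst_mul]

theorem sum_mul_mcoeff {m : ℤ} {F : Matrix (Fin n) (Fin n) (Loop A)} (hF : F ∈ mband A n 0 m)
    (G : Matrix (Fin n) (Fin n) (Loop A)) (k : ℤ) :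
    mcoeff k (G * F) = ∑ s ∈ Finset.Icc 0 m, mcoeff (k - s) G * mcoeff s F := by
  conv_lhs => rw [eq_sum_of_mem_mband hF]
  rw [Finset.mul_sum, mcoeff_sum]
  refine Finset.sum_congr rfl fun s _ => ?_
  rw [← mul_assoc, ← (zmat_commute s G).eq, mul_assoc, mcoeff_zmat_mul, mcoeff_mul_cst]

theorem tendsto_mcoeff (G : Matrix (Fin n) (Fin n) (Loop A)) :
    Tendsto (fun k => mcoeff k G) cofinite (nhds 0) :=
  tendsto_pi_nhds.2 fun i => tendsto_pi_nhds.2 fun j => tendsto_coeff (G i j)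

theorem tendsto_toep_mcoeff {m : ℕ} (hm : 0 < m) (G : Matrix (Fin n) (Fin n) (Loop A)) :
    Tendsto (fun k : ℤ => toep m (fun k => mcoeff k G) (k * m)) cofinite (nhds 0) := by
  refine tendsto_pi_nhds.2 fun i => tendsto_pi_nhds.2 fun j => ?_
  have inj : Function.Injective fun k : ℤ => k * m + (i : ℕ) - (j : ℕ) := fun a b h => by
    have h' : a * m = b * m := by simpa using h
    exact mul_right_cancel₀ (by omega) h'
  exact (tendsto_mcoeff G).comp inj.tendsto_cofinite

/-- The spectral idempotent of a polynomial loop of invertible matrices. -/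
def specIdem (m : ℕ) (F : GLn n (Loop A)) : Matrix (Fin m × Fin n) (Fin m × Fin n) A :=
  Matrix.compRingEquiv (Fin m) (Fin n) A
    (toep m (fun k => mcoeff k F.val) 0 * toep m (fun k => mcoeff k F⁻¹.val) 0)

/-- Comparing coefficients in F F⁻¹ = 1 and F⁻¹ F = 1 gives the two resolvent identities for the
Toeplitz blocks, and the Riemann–Lebesgue lemma gives the decay. -/
theorem specIdem_idem {m : ℕ} {F : GLn n (Loop A)} (hF : F.val ∈ mband A n 0 m) :
    specIdem m F * specIdem m F = specIdem m F := by
  -- For m = 0 the matrix is empty. Positive m is needed because the decay is along the indices km +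
  -- i - j.
  rcases Nat.eq_zero_or_pos m with rfl | hm
  · exact Subsingleton.elim _ _
  unfold specIdem
  rw [← map_mul]
  congr 1
  have hc : ∀ k ∉ Finset.Icc (0 : ℤ) m, mcoeff k F.val = 0 :=
    fun k hk => mcoeff_eq_zero_of_mem_mband hF hk
  have h1 := toep_mul_toep (c := fun k => mcoeff k F.val) (g := fun k => mcoeff k F⁻¹.val) hc
    fun k => by rw [← sum_mcoeff_mul hF, Units.mul_inv, mcoeff_one]
  have h2 := toep_mul_toep' (c := fun k => mcoeff k F.val) (g := fun k => mcoeff k F⁻¹.val) hc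
    fun k => by rw [← sum_mul_mcoeff hF, Units.inv_mul, mcoeff_one]
  have := idem_of_resolvent (G := fun k : ℤ => toep m (fun k => mcoeff k F⁻¹.val) (k * m)) h1 h2
    (tendsto_toep_mcoeff hm _)
  simpa using this

theorem continuous_specIdem (m : ℕ) :
    Continuous (specIdem m : GLn n (Loop A) → Matrix (Fin m × Fin n) (Fin m × Fin n) A) := by
  have h1 : Continuous fun F : GLn n (Loop A) => toep m (fun k => mcoeff k F.val) 0 :=
    continuous_matrix fun i j => (continuous_mcoeff _).comp Units.continuous_val
  have h2 : Continuous fun F : GLn n (Loop A) => toep m (fun k => mcoeff k F⁻¹.val) 0 :=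
    continuous_matrix fun i j => (continuous_mcoeff _).comp
      (Units.continuous_val.comp continuous_inv)
  exact continuous_matrix fun p q => ((h1.matrix_mul h2).matrix_elem p.1 q.1).matrix_elem p.2 q.2

/-- Two loops have, after multiplication by a large power of `z`, spectral idempotents of the
same class. -/
def SpecEq (F F' : GLn n (Loop A)) : Prop :=
  ∀ᶠ d : ℕ in atTop, ∀ᶠ m : ℕ in atTop,
    idemClass (specIdem m (zmat n d * F)) = idemClass (specIdem m (zmat n d * F'))

theorem SpecEq.symm {F F' : GLn n (Loop A)} (h : SpecEq F F') : SpecEq F' F :=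
  h.mono fun _ h => h.mono fun _ h => h.symm

theorem SpecEq.trans {F F' F'' : GLn n (Loop A)} (h : SpecEq F F') (h' : SpecEq F' F'') :
    SpecEq F F'' :=
  (h.and h').mono fun _ h => (h.1.and h.2).mono fun _ h => h.1.trans h.2

/-- Matrices of Laurent polynomials. -/
def IsLaurent (M : Matrix (Fin n) (Fin n) (Loop A)) : Prop := ∃ d : ℕ, M ∈ mband A n (-d) d

/-- The segment between the loops consists of invertible Laurent polynomials of bounded degree.
After one shift by a power of z, its spectral idempotents form a continuous path. -/
theorem specEq_of_convex {W : Set (Matrix (Fin n) (Fin n) (Loop A))} (hW : Convex ℝ W)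
    (hu : ∀ x ∈ W, IsUnit x) {F F' : GLn n (Loop A)} (hF : F.val ∈ W) (hF' : F'.val ∈ W)
    (hL : IsLaurent F.val) (hL' : IsLaurent F'.val) : SpecEq F F' := by
  obtain ⟨d₁, h1⟩ := hL
  obtain ⟨d₂, h2⟩ := hL'
  filter_upwards [eventually_ge_atTop (max d₁ d₂)] with d hd
  -- Multiplication by z^d moves the degrees -d, …, d to 0, …, 2d, so block size 2d suffices.
  filter_upwards [eventually_ge_atTop (d + d)] with m hm
  have hd1 : d₁ ≤ d := (le_max_left _ _).trans hd
  have hd2 : d₂ ≤ d := (le_max_right _ _).trans hd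
  replace h1 : F.val ∈ mband A n (-d) d := mband_le (by simpa) (by simpa) h1
  replace h2 : F'.val ∈ mband A n (-d) d := mband_le (by simpa) (by simpa) h2
  have hmem (t : unitInterval) : (1 - (t : ℝ)) • F.val + (t : ℝ) • F'.val ∈ W :=
    hW hF hF' (by linarith [t.2.2]) t.2.1 (by ring)
  let γ : unitInterval → GLn n (Loop A) := fun t => (hu _ (hmem t)).unit
  have hγ : Continuous γ := by
    refine (isOpenEmbedding_unitsVal n).continuous_iff.2 ?_
    change Continuous fun t : unitInterval => (1 - (t : ℝ)) • F.val + (t : ℝ) • F'.val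
    fun_prop
  have hb (t : unitInterval) : (zmat n d * γ t).val ∈ mband A n 0 m := by
    have h3 : (γ t).val ∈ mband A n (-d) d := by
      change (1 - (t : ℝ)) • F.val + (t : ℝ) • F'.val ∈ _
      have e (r : ℝ) (M : Matrix (Fin n) (Fin n) (Loop A)) : r • M = (r : ℂ) • M := by
        ext i j t
        exact (Complex.coe_smul r (M i j t)).symm
      rw [e, e]
      exact add_mem (Submodule.smul_mem _ _ h1) (Submodule.smul_mem _ _ h2)
    exact mband_le (by simp) (by exact_mod_cast hm) (zmat_mul_mem_mband d h3)
  have hz (M : Matrix (Fin n) (Fin n) (Loop A)) : (0 : ℝ) • M = 0 := by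
    ext i j t
    exact zero_smul ℝ (M i j t)
  have h0 : γ 0 = F := Units.ext (by
    change (1 - (0 : ℝ)) • F.val + (0 : ℝ) • F'.val = F.val
    rw [sub_zero, one_smul, hz, add_zero])
  have h1 : γ 1 = F' := Units.ext (by
    change (1 - (1 : ℝ)) • F.val + (1 : ℝ) • F'.val = F'.val
    rw [sub_self, one_smul, hz, zero_add])
  have := V.cls_eq_of_path (γ := fun t => specIdem m (zmat n d * γ t))
    ((continuous_specIdem m).comp (continuous_const.mul hγ)) (fun t => specIdem_idem (hb t)) 0 1
  rw [← h0, ← h1, idemClass_eq (specIdem_idem (hb 0)), idemClass_eq (specIdem_idem (hb 1)), this]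

theorem exists_laurent_unit {W : Set (Matrix (Fin n) (Fin n) (Loop A))} (hW : IsOpen W)
    (hu : ∀ x ∈ W, IsUnit x) (hne : W.Nonempty) :
    ∃ F : GLn n (Loop A), F.val ∈ W ∧ IsLaurent F.val := by
  obtain ⟨M, hM, h⟩ := exists_mem_mband W hW hne
  obtain ⟨F, rfl⟩ := hu M hM
  exact ⟨F, hM, h⟩

/-- The path need not pass through Laurent polynomials. The relation `P s t` therefore compares all
Laurent invertibles in convex neighbourhoods of the two points. It is symmetric, transitive, and
holds for nearby parameters, so it propagates along the interval. -/
theorem specEq_of_joined {F F' : GLn n (Loop A)} (h : Joined F F') (hL : IsLaurent F.val)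
    (hL' : IsLaurent F'.val) : SpecEq F F' := by
  obtain ⟨γ⟩ := h
  let P (s t : unitInterval) : Prop := ∀ (L L' : GLn n (Loop A))
    (W W' : Set (Matrix (Fin n) (Fin n) (Loop A))), IsLaurent L.val → IsLaurent L'.val →
    IsOpen W → IsOpen W' → Convex ℝ W → Convex ℝ W' → (∀ x ∈ W, IsUnit x) →
    (∀ x ∈ W', IsUnit x) → (γ s).val ∈ W → (γ t).val ∈ W' → L.val ∈ W → L'.val ∈ W' → SpecEq L L'
  have hsymm : Std.Symm P := ⟨fun s t hst L L' W W' h1 h2 h3 h4 h5 h6 h7 h8 h9 h10 h11 h12 =>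
    (hst L' L W' W h2 h1 h4 h3 h6 h5 h8 h7 h10 h9 h12 h11).symm⟩
  have htrans : IsTrans unitInterval P :=
    ⟨fun s t r hst htr L L' W W' h1 h2 h3 h4 h5 h6 h7 h8 h9 h10 h11 h12 => by
      obtain ⟨U, hU1, hU2, hU3, hU4⟩ := exists_convex_nhds_unit (γ t)
      obtain ⟨K, hK1, hK2⟩ := exists_laurent_unit hU1 hU4 ⟨_, hU2⟩
      exact (hst L K W U h1 hK2 h3 hU1 h5 hU3 h7 hU4 h9 hU2 h11 hK1).trans
        (htr K L' U W' hK2 h2 hU1 h4 hU3 h6 hU4 h8 hU2 h10 hK1 h12)⟩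
  have hloc (s : unitInterval) : ∀ᶠ t in nhds s, P s t := by
    obtain ⟨U, hU1, hU2, hU3, hU4⟩ := exists_convex_nhds_unit (γ s)
    filter_upwards [(Units.continuous_val.comp γ.continuous).continuousAt.preimage_mem_nhds
      (hU1.mem_nhds hU2)] with t ht L L' W W' h1 h2 h3 h4 h5 h6 h7 h8 h9 h10 h11 h12
    obtain ⟨K, hK1, hK2⟩ := exists_laurent_unit (h3.inter hU1) (fun x hx => h7 x hx.1)
      ⟨_, h9, hU2⟩
    obtain ⟨K', hK1', hK2'⟩ := exists_laurent_unit (h4.inter hU1) (fun x hx => h8 x hx.1)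
      ⟨_, h10, ht⟩
    exact ((specEq_of_convex h5 h7 h11 hK1.1 h1 hK2).trans
      (specEq_of_convex hU3 hU4 hK1.2 hK1'.2 hK2 hK2')).trans
      (specEq_of_convex h6 h8 hK1'.1 h12 hK2' h2)
  obtain ⟨U, hU1, hU2, hU3, hU4⟩ := exists_convex_nhds_unit F
  obtain ⟨U', hU1', hU2', hU3', hU4'⟩ := exists_convex_nhds_unit F'
  refine PreconnectedSpace.induction₂ P hloc htrans 0 1 F F' U U' hL hL' hU1 hU1' hU3 hU3' hU4 hU4'
    ?_ ?_ hU2 hU2'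
  · simpa using hU2
  · simpa using hU2'

theorem isLaurent_bottLoop {e : Matrix (Fin n) (Fin n) A} (he : e * e = e) :
    IsLaurent (bottLoop e he).val := by
  refine ⟨1, add_mem (cst_mem_mband (by simp) (by simp) _) ?_⟩
  exact mband_le (by simp) (by simp)
    (zmat_mul_mem_mband 1 (cst_mem_mband (p := -1) (q := 0) (by simp) (by simp) e))

/-- The diagonal blocks of the spectral idempotent of `z ^ d (1 - e + z e)`. -/
def specBlock (d : ℕ) (e : Matrix (Fin n) (Fin n) A) (i : ℕ) : Matrix (Fin n) (Fin n) A :=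
  (if d ≤ i then 1 - e else 0) + if d + 1 ≤ i then e else 0

theorem specBlock_idem (d : ℕ) {e : Matrix (Fin n) (Fin n) A} (he : e * e = e) (i : ℕ) :
    specBlock d e i * specBlock d e i = specBlock d e i := by
  unfold specBlock
  split_ifs
  · simp
  · simpa using one_sub_idem he
  · omega
  · simp

/-- The loop has coefficients only in degrees d and d + 1, its inverse only in degrees -d and -d -
1. Mixed products vanish because e(1 - e) = 0, so the Toeplitz product is block diagonal with blocks
0 before position d, 1 - e at d, and 1 afterwards. -/
theorem specIdem_bottLoop (d m : ℕ) {e : Matrix (Fin n) (Fin n) A} (he : e * e = e) :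
    specIdem m (zmat n d * bottLoop e he) =
      Matrix.compRingEquiv (Fin m) (Fin n) A (Matrix.diagonal fun i => specBlock d e i) := by
  have h1 (k : ℤ) : mcoeff k (zmat n d * bottLoop e he).val =
      (if k = d then 1 - e else 0) + if k = d + 1 then e else 0 := by
    change mcoeff k ((zmat n d).val * (cst (1 - e) + (zmat n 1).val * cst e)) = _
    rw [mcoeff_zmat_mul, mcoeff_add, mcoeff_zmat_mul, mcoeff_cst, mcoeff_cst]
    congr 1 <;> refine if_congr (by omega) rfl rfl
  have h2 (k : ℤ) : mcoeff k (zmat n d * bottLoop e he)⁻¹.val =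
      (if k = -d then 1 - e else 0) + if k = -d - 1 then e else 0 := by
    have : (zmat n d * bottLoop e he)⁻¹.val =
        (zmat n d)⁻¹.val * (cst (1 - e) + (zmat n (-1)).val * cst e) := by
      rw [mul_inv_rev, Units.val_mul]
      exact ((zmat_commute d _).units_inv_left).eq.symm
    have h3 : ((zmat n d)⁻¹ : GLn n (Loop A)) = zmat n (-d) := by
      rw [inv_eq_iff_mul_eq_one, ← zmat_add, add_neg_cancel, zmat_zero]
    rw [this, h3, mcoeff_zmat_mul, mcoeff_add, mcoeff_zmat_mul, mcoeff_cst, mcoeff_cst]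
    congr 1 <;> refine if_congr (by omega) rfl rfl
  unfold specIdem
  congr 1
  refine Matrix.ext fun i j => ?_
  rw [Matrix.mul_apply]
  simp only [toep, Matrix.of_apply, h1, h2]
  have e1 : e * (1 - e) = 0 := by rw [mul_sub, he, mul_one, sub_self]
  have e2 : (1 - e) * e = 0 := by rw [sub_mul, he, one_mul, sub_self]
  by_cases hij : i = j
  · subst hij
    rw [Matrix.diagonal_apply_eq]
    have key (l : Fin m) : ((if 0 + (i : ℕ) - (l : ℕ) = (d : ℤ) then 1 - e else 0) +
        if 0 + (i : ℕ) - (l : ℕ) = (d : ℤ) + 1 then e else 0) *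
        ((if 0 + (l : ℕ) - (i : ℕ) = -(d : ℤ) then 1 - e else 0) +
        if 0 + (l : ℕ) - (i : ℕ) = -(d : ℤ) - 1 then e else 0) =
        (if (i : ℕ) = l + d then 1 - e else 0) + if (i : ℕ) = l + (d + 1) then e else 0 := by
      split_ifs <;> first | omega | simp [he, one_sub_idem he]
    rw [Finset.sum_congr rfl fun l _ => key l, Finset.sum_add_distrib]
    have key2 (r : ℕ) (x : Matrix (Fin n) (Fin n) A) :
        ∑ l : Fin m, (if (i : ℕ) = l + r then x else 0) = if r ≤ i then x else 0 := by
      split_ifs with h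
      · rw [Finset.sum_eq_single (⟨i - r, by omega⟩ : Fin m)]
        · simp [h]
        · intro b _ hb
          refine if_neg fun h' => hb (Fin.ext ?_)
          simp only
          omega
        · simp
      · exact Finset.sum_eq_zero fun l _ => if_neg (by omega)
    rw [key2, key2]
    rfl
  · rw [Matrix.diagonal_apply_ne _ hij]
    have hij' : (i : ℕ) ≠ j := fun h => hij (Fin.ext h)
    refine Finset.sum_eq_zero fun l _ => ?_
    split_ifs <;> first | omega | simp [e1, e2]

/-- Only the diagonal block at position d depends on the idempotent. Cancelling the other blocks in
K₀ leaves [1 - e] = [1 - f]. -/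
theorem K0_cls_eq_of_bottLoop_joined {e f : Matrix (Fin n) (Fin n) A} (he : e * e = e)
    (hf : f * f = f) (h : Joined (bottLoop e he) (bottLoop f hf)) :
    K0.cls e he = K0.cls f hf := by
  obtain ⟨d, hd⟩ := (specEq_of_joined h (isLaurent_bottLoop he) (isLaurent_bottLoop hf)).exists
  -- The strict inequality d < m ensures that the decisive block is present.
  obtain ⟨m, hm, hdm⟩ := (hd.and (eventually_gt_atTop d)).exists
  rw [specIdem_bottLoop, specIdem_bottLoop,
    idemClass_eq (comp_diagonal_idem fun i : Fin m => specBlock_idem d he i),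
    idemClass_eq (comp_diagonal_idem fun i : Fin m => specBlock_idem d hf i),
    V.cls_comp_diagonal (fun i : Fin m => specBlock_idem d he i),
    V.cls_comp_diagonal (fun i : Fin m => specBlock_idem d hf i), map_sum, map_sum,
    ← Finset.add_sum_erase _ _ (Finset.mem_univ (⟨d, hdm⟩ : Fin m)),
    ← Finset.add_sum_erase _ _ (Finset.mem_univ (⟨d, hdm⟩ : Fin m))] at hm
  have h1 (i : Fin m) (hi : i ∈ Finset.univ.erase (⟨d, hdm⟩ : Fin m)) :
      specBlock d e i = specBlock d f i := by
    have hi' : (i : ℕ) ≠ d := fun h => (Finset.mem_erase.1 hi).1 (Fin.ext h)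
    unfold specBlock
    split_ifs <;> first | omega | simp
  have h2 : ∑ i ∈ Finset.univ.erase (⟨d, hdm⟩ : Fin m), Algebra.GrothendieckAddGroup.of
      (V.cls (specBlock d e i) (specBlock_idem d he i)) =
      ∑ i ∈ Finset.univ.erase (⟨d, hdm⟩ : Fin m), Algebra.GrothendieckAddGroup.of
      (V.cls (specBlock d f i) (specBlock_idem d hf i)) := by
    refine Finset.sum_congr rfl fun i hi => ?_
    congr 2
    exact h1 i hi
  rw [h2, add_left_inj] at hm
  have h3 : specBlock d e d = 1 - e := by simp [specBlock]
  have h4 : specBlock d f d = 1 - f := by simp [specBlock]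
  simp only [h3, h4] at hm
  rw [← K0.cls_eq, ← K0.cls_eq] at hm
  have h5 := K0.cls_add_cls_one_sub he
  rw [hm, ← K0.cls_add_cls_one_sub hf] at h5
  exact add_right_cancel h5

variable (A) in
/-- The Bott homomorphism is injective. -/
theorem bottHom_injective : Function.Injective (bottHom A) := by
  refine (injective_iff_map_eq_zero _).2 fun x hx => ?_
  obtain ⟨n, k, e, he, rfl⟩ := K0.exists_cls_sub_one x
  -- The two classes are represented by idempotents of the common size n + k, so that their loops
  -- can be compared by a homotopy.
  have h1 : K0.cls e he =
      K0.cls (block e 0 0 (0 : Matrix (Fin k) (Fin k) A)) (block_idem he (zero_mul 0)) := by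
    rw [K0.cls_block he (zero_mul 0), K0.cls_zero, add_zero]
  have h2 : K0.cls (1 : Matrix (Fin k) (Fin k) A) (one_mul 1) =
      K0.cls (block (0 : Matrix (Fin n) (Fin n) A) 0 0 (1 : Matrix (Fin k) (Fin k) A))
        (block_idem (zero_mul 0) (one_mul 1)) := by
    rw [K0.cls_block (zero_mul 0) (one_mul 1), K0.cls_zero, zero_add]
  rw [h1, h2, map_sub, sub_eq_zero, bottHom_cls, bottHom_cls] at hx
  obtain ⟨m, hm⟩ := K1.exists_joined_of_cls_eq hx
  rw [← bottLoop_zero m, ← bottLoop_block, ← bottLoop_block] at hm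
  have h3 := K0_cls_eq_of_bottLoop_joined _ _ hm
  rw [K0.cls_block (block_idem he (zero_mul 0)) (zero_mul 0),
    K0.cls_block (block_idem (zero_mul 0) (one_mul 1)) (zero_mul 0), add_left_inj] at h3
  rw [h1, h2, h3, sub_self]

end Loop

/-! ### Linearization and surjectivity in Bott periodicity -/

open Filter

/-- The part of the loop `α + z β` on the spectral subspace where `α` is invertible. -/
theorem exists_unit_of_resolvent {T : Type*} [Ring T] [TopologicalSpace T] [IsTopologicalRing T]
    {α β e : T} {g : ℕ → T} (he : e * e = e) (h1 : α * g 0 = e) (h2 : g 0 * α = e)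
    (hαβ : Commute α β) (hg : Commute β (g 0)) (h : ∀ k, α * g (k + 1) + β * g k = 0)
    (hlim : Tendsto g atTop (nhds 0)) :
    ∃ (u : Tˣ) (c : T), u.val = e * α + (1 - e) ∧ u.val * c = -(e * β) ∧
      Tendsto (fun k => c ^ k) atTop (nhds 0) := by
  have ce1 : Commute e α := by
    change e * α = α * e
    conv_lhs => rw [← h1]
    rw [mul_assoc, h2]
  have ce2 : Commute e (g 0) := by
    change e * g 0 = g 0 * e
    conv_lhs => rw [← h2]
    rw [mul_assoc, h1]
  have ce3 : Commute e β := by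
    rw [← h1]
    exact hαβ.mul_left hg.symm
  have u1 : (e * α + (1 - e)) * (e * g 0 + (1 - e)) = 1 := by
    have a1 : e * α * (e * g 0) = e := by
      rw [ce1.eq, mul_assoc, ← mul_assoc e, he, ce2.eq, ← mul_assoc, h1, he]
    have a2 : e * α * (1 - e) = 0 := by rw [ce1.eq, mul_assoc, mul_sub, he, mul_one, sub_self,
        mul_zero]
    have a3 : (1 - e) * (e * g 0) = 0 := by rw [← mul_assoc, sub_mul, he, one_mul, sub_self,
        zero_mul]
    rw [mul_add, add_mul, add_mul, a1, a2, a3, one_sub_idem he]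
    simp
  have u2 : (e * g 0 + (1 - e)) * (e * α + (1 - e)) = 1 := by
    have a1 : e * g 0 * (e * α) = e := by
      rw [ce2.eq, mul_assoc, ← mul_assoc e, he, ce1.eq, ← mul_assoc, h2, he]
    have a2 : e * g 0 * (1 - e) = 0 := by rw [ce2.eq, mul_assoc, mul_sub, he, mul_one, sub_self,
        mul_zero]
    have a3 : (1 - e) * (e * α) = 0 := by rw [← mul_assoc, sub_mul, he, one_mul, sub_self, zero_mul]
    rw [mul_add, add_mul, add_mul, a1, a2, a3, one_sub_idem he]
    simp
  -- On the range of e the loop is α(1 - zc), since g 0 inverts α there. The recursion α g(k+1) = -β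
  -- g(k) gives e g(k+1) = c e g(k), so the powers of c decay with the coefficients g(k).
  let c : T := -(e * (g 0 * β))
  have ec : e * c = c := by simp only [c, mul_neg]; rw [← mul_assoc, he]
  have key (k : ℕ) : c ^ k * e = e * g k * α := by
    induction k with
    | zero => rw [pow_zero, one_mul, mul_assoc, h2, he]
    | succ k ih =>
      have e1 : e * g (k + 1) = c * (e * g k) := by
        have e2 : e * g (k + 1) = -(g 0 * β * g k) := by
          conv_lhs => rw [← h2]
          rw [mul_assoc, eq_neg_of_add_eq_zero_left (h k), mul_neg, mul_assoc]
        have e3 : e * g (k + 1) = e * (e * g (k + 1)) := by rw [← mul_assoc, he]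
        have e4 : c * e = c := by
          simp only [c, neg_mul]
          rw [mul_assoc, ← (ce2.mul_right ce3).eq, ← mul_assoc, he]
        rw [← mul_assoc, e4, e3, e2]
        simp only [c]
        noncomm_ring
      rw [pow_succ', mul_assoc, ih, e1]
      simp only [mul_assoc]
  refine ⟨⟨_, _, u1, u2⟩, c, rfl, ?_, ?_⟩
  · have a1 : e * α * (e * (g 0 * β)) = e * β := by
      rw [ce1.eq, mul_assoc, ← mul_assoc e, he, ← mul_assoc e, ce2.eq, mul_assoc, ← mul_assoc, h1,
        ← mul_assoc, he]
    have a2 : (1 - e) * (e * (g 0 * β)) = 0 := by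
      rw [← mul_assoc, sub_mul, he, one_mul, sub_self, zero_mul]
    change (e * α + (1 - e)) * -(e * (g 0 * β)) = _
    rw [mul_neg, add_mul, a1, a2, add_zero]
  · refine (tendsto_add_atTop_iff_nat 1).1 ?_
    have e5 (k : ℕ) : c ^ (k + 1) = e * g k * α * c := by rw [← key, pow_succ, mul_assoc, ec]
    simp only [e5]
    simpa using ((hlim.const_mul e).mul_const α).mul_const c

namespace Loop

variable {A : Type*} [CStarAlgebra A] {n : ℕ}

/-- Some 1 - x^k is close to 1 and hence invertible. The factor 1 - x commutes with the geometric
sum, so it is invertible too, even if the norm of x is not small. -/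
theorem isUnit_one_sub_of_tendsto {x : Matrix (Fin n) (Fin n) A}
    (hx : Tendsto (fun k => x ^ k) atTop (nhds 0)) : IsUnit (1 - x) := by
  have h1 : Tendsto (fun k => 1 - x ^ k) atTop (nhds 1) := by
    simpa using tendsto_const_nhds.sub hx
  obtain ⟨k, hk⟩ := (h1.eventually_mem (isOpen_isUnit_matrix.mem_nhds isUnit_one)).exists
  change IsUnit (1 - x ^ k) at hk
  rw [← mul_neg_geom_sum] at hk
  exact ((Commute.sum_right _ _ _ fun i _ =>
    ((Commute.one_left _).sub_left (Commute.pow_right (Commute.refl x) i))).isUnit_mul_iff.1 hk).1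

/-- The powers of sx still tend to 0 for 0 ≤ s ≤ 1, so 1 - sx is a path of invertibles. -/
theorem exists_unit_one_sub {x : Matrix (Fin n) (Fin n) A}
    (hx : Tendsto (fun k => x ^ k) atTop (nhds 0)) :
    ∃ v : GLn n A, v.val = 1 - x ∧ Joined 1 v := by
  have hu (s : unitInterval) : IsUnit (1 - ((s : ℝ) : ℂ) • x) := by
    refine isUnit_one_sub_of_tendsto ?_
    refine tendsto_pi_nhds.2 fun i => tendsto_pi_nhds.2 fun j => ?_
    have h0 : Tendsto (fun k => (x ^ k) i j) atTop (nhds 0) :=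
      tendsto_pi_nhds.1 (tendsto_pi_nhds.1 hx i) j
    refine squeeze_zero_norm (fun k => ?_) (tendsto_zero_iff_norm_tendsto_zero.1 h0)
    rw [smul_pow, Matrix.smul_apply, norm_smul, norm_pow, Complex.norm_real,
      Real.norm_of_nonneg s.2.1]
    exact mul_le_of_le_one_left (norm_nonneg _) (pow_le_one₀ s.2.1 s.2.2)
  have h1 := hu 1
  have e1 : 1 - (((1 : unitInterval) : ℝ) : ℂ) • x = 1 - x := by simp
  rw [e1] at h1
  refine ⟨h1.unit, rfl, joined_of_isUnit ⟨⟨fun s => 1 - ((s : ℝ) : ℂ) • x, by fun_prop⟩, ?_, ?_⟩ hu⟩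
  · simp
  · simp

theorem zmat_pow (l : ℤ) (k : ℕ) : (zmat n l : GLn n (Loop A)) ^ k = zmat n (l * k) := by
  induction k with
  | zero => simp [zmat_zero]
  | succ k ih => rw [pow_succ, ih, ← zmat_add]; push_cast; ring_nf

theorem tendsto_zmat_mul_cst_pow (l : ℤ) {c : Matrix (Fin n) (Fin n) A}
    (hc : Tendsto (fun k => c ^ k) atTop (nhds 0)) :
    Tendsto (fun k => ((zmat n l).val * cst c) ^ k) atTop (nhds 0) := by
  have e (k : ℕ) : ((zmat n l).val * cst c) ^ k = (zmat n (l * k)).val * cst (c ^ k) := by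
    rw [(zmat_commute l (cst c)).mul_pow, cst_pow, ← zmat_pow]
    rfl
  simp only [e]
  refine tendsto_pi_nhds.2 fun i => tendsto_pi_nhds.2 fun j => ?_
  have h0 : Tendsto (fun k => (c ^ k) i j) atTop (nhds 0) :=
    tendsto_pi_nhds.1 (tendsto_pi_nhds.1 hc i) j
  refine squeeze_zero_norm (fun k => ?_) (tendsto_zero_iff_norm_tendsto_zero.1 h0)
  rw [zmat_mul_apply]
  refine (ContinuousMap.norm_le _ (norm_nonneg _)).2 fun t => ?_
  rw [mono_mul_apply, norm_smul, fourier_apply, Circle.norm_coe, one_mul]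
  exact le_rfl

variable (A) in
/-- The subgroup of `K₁(C(𝕋, A))` generated by constant loops and the image of the Bott
homomorphism. -/
def constSupBott : AddSubgroup (K1 (Loop A)) :=
  (K1.map (const : A →⋆ₐ[ℂ] Loop A)).range ⊔ (bottHom A).range

theorem cls_const_mem (u : GLn n A) : K1.cls (GLn.map const n u) ∈ constSupBott A :=
  le_sup_left (a := (K1.map (const : A →⋆ₐ[ℂ] Loop A)).range) ⟨K1.cls u, rfl⟩

theorem cls_bottLoop_mem {e : Matrix (Fin n) (Fin n) A} (he : e * e = e) :
    K1.cls (bottLoop e he) ∈ constSupBott A :=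
  le_sup_right (a := (K1.map (const : A →⋆ₐ[ℂ] Loop A)).range) ⟨K0.cls e he, bottHom_cls he⟩

theorem cls_zmat_mem (d : ℕ) : K1.cls (zmat n d : GLn n (Loop A)) ∈ constSupBott A := by
  induction d with
  | zero => simp [zmat_zero, K1.cls_one]
  | succ d ih =>
    rw [Nat.cast_succ, zmat_add, K1.cls_mul, ← bottLoop_one]
    exact add_mem ih (cls_bottLoop_mem _)

theorem val_const_unit (u : GLn n A) : (GLn.map const n u).val = cst u.val := rfl

/-- Since β = 1 - α, all coefficients involved commute with α and the spectral idempotent e splits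
the loop. On e it is a constant times 1 - zc; on 1 - e it is z times a constant times 1 - z⁻¹c'. As
the powers of c and c' tend to 0, these two factors are joined to 1. What remains is two constants
and the loop of 1 - e. -/
theorem cls_mem_of_normalized {F : GLn n (Loop A)} {α β : Matrix (Fin n) (Fin n) A}
    (hF : F.val = cst α + (zmat n 1).val * cst β) (hαβ : α + β = 1) :
    K1.cls F ∈ constSupBott A := by
  let g : ℤ → Matrix (Fin n) (Fin n) A := fun k => mcoeff k F⁻¹.val
  have hβ : β = 1 - α := eq_sub_of_add_eq' hαβ
  have r1 (k : ℤ) : α * g k + β * g (k - 1) = if k = 0 then 1 else 0 := by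
    rw [← mcoeff_one, ← F.mul_inv, hF, add_mul, mcoeff_add, mul_assoc, mcoeff_zmat_mul,
      mcoeff_cst_mul, mcoeff_cst_mul]
  -- The constant loop α commutes with F and hence with its inverse; compare Fourier coefficients.
  have cα (k : ℤ) : Commute α (g k) := by
    have h1 : Commute (cst α) F.val := by
      rw [hF]
      refine (Commute.refl _).add_right ((zmat_commute 1 (cst α)).symm.mul_right ?_)
      change _ * _ = _ * _
      rw [hβ, ← cst_mul, ← cst_mul, mul_sub, sub_mul, mul_one, one_mul]
    have h2 := congrArg (mcoeff k) (h1.units_inv_right).eq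
    rwa [mcoeff_cst_mul, mcoeff_mul_cst] at h2
  have cβ (k : ℤ) : Commute β (g k) := by
    rw [hβ]
    exact (Commute.one_left _).sub_left (cα k)
  have cαβ : Commute α β := by
    rw [hβ]
    exact (Commute.one_right _).sub_right (Commute.refl _)
  have r2 (k : ℤ) : g k * α + g (k - 1) * β = if k = 0 then 1 else 0 := by
    rw [← (cα k).eq, ← (cβ _).eq, r1]
  have hlim : Tendsto g cofinite (nhds 0) := tendsto_mcoeff _
  have he := idem_of_resolvent r1 r2 hlim
  set e := α * g 0 with e_def
  have hf := one_sub_idem he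
  have hf1 : β * g (-1) = 1 - e := by
    have := r1 0
    rw [if_pos rfl, zero_sub] at this
    exact eq_sub_of_add_eq' this
  have inj1 : Function.Injective fun j : ℕ => (j : ℤ) := Nat.cast_injective
  have inj2 : Function.Injective fun j : ℕ => (-1 - j : ℤ) := fun a b h => by
    simpa using h
  obtain ⟨u, c, hu, hc, hcl⟩ := exists_unit_of_resolvent (α := α) (β := β)
    (g := fun k : ℕ => g k) he rfl (cα 0).eq.symm cαβ (cβ 0) (fun k => by
      have := r1 (k + 1)
      rw [if_neg (by omega), add_sub_cancel_right] at this
      exact_mod_cast this) (by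
      have := hlim.comp inj1.tendsto_cofinite
      rwa [Nat.cofinite_eq_atTop] at this)
  -- On the complement α and β exchange roles, and the coefficients of the inverse are read
  -- backwards from index -1.
  obtain ⟨u', c', hu', hc', hcl'⟩ := exists_unit_of_resolvent (α := β) (β := α)
    (g := fun k : ℕ => g (-1 - k)) hf (by simpa using hf1)
    (by simpa using (cβ (-1)).eq.symm.trans hf1) cαβ.symm (cα _) (fun k => by
      have := r1 (-1 - k)
      rw [if_neg (by omega)] at this
      rw [add_comm, ← this]
      congr 3
      push_cast
      ring) (by
      have := hlim.comp inj2.tendsto_cofinite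
      rwa [Nat.cofinite_eq_atTop] at this)
  obtain ⟨v, hv, hvj⟩ := exists_unit_one_sub (tendsto_zmat_mul_cst_pow 1 hcl)
  obtain ⟨v', hv', hvj'⟩ := exists_unit_one_sub (tendsto_zmat_mul_cst_pow (-1) hcl')
  have ceα : Commute e α := by
    change α * g 0 * α = α * (α * g 0)
    rw [mul_assoc, (cα 0).eq]
  have ceβ : Commute e β := by
    rw [hβ]
    exact (Commute.one_right _).sub_right ceα
  have p1 : (GLn.map const n u * v).val = cst (e * α + (1 - e)) + (zmat n 1).val * cst (e * β) := by
    rw [Units.val_mul, hv, val_const_unit, mul_sub, mul_one, ← mul_assoc,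
      ← (zmat_commute 1 (cst u.val)).eq, mul_assoc, ← cst_mul, hc, hu]
    rw [show -(e * β) = 0 - e * β by simp, cst_sub, cst_zero]
    simp
  have p2 : (GLn.map const n u' * v').val =
      cst ((1 - e) * β + e) + (zmat n (-1)).val * cst ((1 - e) * α) := by
    rw [Units.val_mul, hv', val_const_unit, mul_sub, mul_one, ← mul_assoc,
      ← (zmat_commute (-1) (cst u'.val)).eq, mul_assoc, ← cst_mul, hc', hu']
    rw [show -((1 - e) * α) = 0 - (1 - e) * α by simp, cst_sub, cst_zero, sub_sub_cancel]
    simp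
  have z1 : (zmat n 1).val * (zmat n (-1)).val = (1 : Matrix (Fin n) (Fin n) (Loop A)) := by
    rw [← Units.val_mul, ← zmat_add]
    simp [zmat_zero]
  have p3 : (bottLoop (1 - e) hf * (GLn.map const n u' * v')).val =
      cst (e + (1 - e) * α) + (zmat n 1).val * cst ((1 - e) * β) := by
    rw [Units.val_mul, p2]
    change (cst (1 - (1 - e)) + (zmat n 1).val * cst (1 - e)) * _ = _
    rw [sub_sub_cancel, add_mul, mul_add, mul_add, ← mul_assoc (cst e),
      ← (zmat_commute (-1) (cst e)).eq, mul_assoc _ (cst e), mul_assoc (zmat n 1).val (cst (1 - e)),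
      mul_assoc (zmat n 1).val (cst (1 - e)), ← mul_assoc (cst (1 - e)) (zmat n (-1)).val,
      ← (zmat_commute (-1) (cst (1 - e))).eq, mul_assoc (zmat n (-1)).val,
      ← mul_assoc (zmat n 1).val (zmat n (-1)).val, z1, one_mul]
    simp only [← cst_mul]
    have a1 : e * ((1 - e) * β + e) = e := by
      rw [mul_add, ← mul_assoc, mul_sub, he, mul_one, sub_self, zero_mul, zero_add]
    have a2 : e * ((1 - e) * α) = 0 := by
      rw [← mul_assoc, mul_sub, he, mul_one, sub_self, zero_mul]
    have a3 : (1 - e) * ((1 - e) * β + e) = (1 - e) * β := by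
      rw [mul_add, ← mul_assoc, hf, sub_mul 1 e e, he, one_mul, sub_self, add_zero]
    have a4 : (1 - e) * ((1 - e) * α) = (1 - e) * α := by rw [← mul_assoc, hf]
    rw [a1, a2, a3, a4, cst_zero, mul_zero, add_zero, cst_add]
    abel
  have p4 : F = (GLn.map const n u * v) * (bottLoop (1 - e) hf * (GLn.map const n u' * v')) := by
    ext1
    rw [Units.val_mul, p1, p3, hF, add_mul, mul_add, mul_add]
    have b1 : (e * α + (1 - e)) * (e + (1 - e) * α) = α := by
      have a1 : e * α * e = e * α := by rw [mul_assoc, ← ceα.eq, ← mul_assoc, he]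
      have a2 : e * α * ((1 - e) * α) = 0 := by
        rw [← mul_assoc, mul_sub, a1, mul_one, sub_self, zero_mul]
      have a3 : (1 - e) * e = 0 := by rw [sub_mul, he, one_mul, sub_self]
      rw [mul_add, add_mul, add_mul, a1, a2, a3, ← mul_assoc, hf, sub_mul, one_mul]
      abel
    have b2 : (e * α + (1 - e)) * ((1 - e) * β) = (1 - e) * β := by
      have a1 : e * α * ((1 - e) * β) = 0 := by
        rw [← mul_assoc, mul_sub, mul_one, mul_assoc e α e, ← ceα.eq, ← mul_assoc, he, sub_self,
          zero_mul]
      rw [add_mul, a1, ← mul_assoc, hf, zero_add]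
    have b3 : e * β * (e + (1 - e) * α) = e * β := by
      have a1 : e * β * e = e * β := by rw [mul_assoc, ← ceβ.eq, ← mul_assoc, he]
      rw [mul_add, a1, ← mul_assoc, mul_sub, a1, mul_one, sub_self, zero_mul, add_zero]
    have b4 : e * β * ((1 - e) * β) = 0 := by
      rw [← mul_assoc, mul_sub, mul_one, mul_assoc e β e, ← ceβ.eq, ← mul_assoc, he, sub_self,
        zero_mul]
    rw [← cst_mul, b1, ← mul_assoc (cst _) (zmat n 1).val, ← (zmat_commute 1 (cst _)).eq,
      mul_assoc (zmat n 1).val (cst (e * α + (1 - e))), ← cst_mul, b2,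
      mul_assoc (zmat n 1).val (cst (e * β)), ← cst_mul, b3,
      mul_assoc (zmat n 1).val (cst (e * β)), ← mul_assoc (cst (e * β)) (zmat n 1).val,
      ← (zmat_commute 1 (cst (e * β))).eq, mul_assoc (zmat n 1).val (cst (e * β)), ← cst_mul, b4,
      cst_zero, mul_zero, mul_zero, add_zero, add_assoc, ← mul_add, ← cst_add, ← add_mul]
    simp
  rw [p4, K1.cls_mul, K1.cls_mul, K1.cls_mul, K1.cls_mul, K1.cls_eq_zero_of_joined hvj,
    K1.cls_eq_zero_of_joined hvj', add_zero, add_zero]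
  exact add_mem (cls_const_mem u) (add_mem (cls_bottLoop_mem hf) (cls_const_mem u'))

/-- Dividing by the value a + b at the base point, a constant invertible, normalizes the two
coefficients to have sum 1. -/
theorem cls_mem_of_linear {F : GLn n (Loop A)} (hF : F.val ∈ mband A n 0 1) :
    K1.cls F ∈ constSupBott A := by
  have h1 := eq_sum_of_mem_mband hF
  set a := mcoeff 0 F.val
  set b := mcoeff 1 F.val
  have h2 : F.val = cst a + (zmat n 1).val * cst b := by
    rw [h1, show Finset.Icc (0 : ℤ) 1 = {0, 1} from rfl, Finset.sum_pair zero_ne_one, zmat_zero]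
    simp [a, b]
  let u := GLn.map (ev 0) n F
  have hu : u.val = a + b := by
    ext i j
    change (F.val i j) 0 = _
    rw [h2, Matrix.add_apply, zmat_mul_apply, ContinuousMap.add_apply, mono_mul_apply,
      fourier_eval_zero, one_smul]
    rfl
  have h3 : F = GLn.map const n u * ((GLn.map const n u)⁻¹ * F) := by group
  rw [h3, K1.cls_mul]
  refine add_mem (cls_const_mem u) (cls_mem_of_normalized (α := u⁻¹.val * a) (β := u⁻¹.val * b)
    ?_ ?_)
  · rw [Units.val_mul, ← map_inv, val_const_unit, h2, mul_add, cst_mul, cst_mul, ← mul_assoc,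
      ← (zmat_commute 1 (cst u⁻¹.val)).eq, mul_assoc]
  · rw [← mul_add, ← hu, Units.inv_mul]

theorem block_mem_mband {n m : ℕ} {p q : ℤ} {a : Matrix (Fin n) (Fin n) (Loop A)}
    {b : Matrix (Fin n) (Fin m) (Loop A)} {c : Matrix (Fin m) (Fin n) (Loop A)}
    {d : Matrix (Fin m) (Fin m) (Loop A)} (ha : ∀ i j, a i j ∈ band A p q)
    (hb : ∀ i j, b i j ∈ band A p q) (hc : ∀ i j, c i j ∈ band A p q)
    (hd : ∀ i j, d i j ∈ band A p q) : block a b c d ∈ mband A (n + m) p q := by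
  intro i j
  obtain ⟨i | i, rfl⟩ := finSumFinEquiv.surjective i <;>
  obtain ⟨j | j, rfl⟩ := finSumFinEquiv.surjective j <;>
  simp [block, ha, hb, hc, hd]

theorem exists_eq_cst_add_zmat_mul {q : ℤ} (hq : 0 ≤ q) {P : Matrix (Fin n) (Fin n) (Loop A)}
    (hP : P ∈ mband A n 0 (q + 1)) : ∃ (c : Matrix (Fin n) (Fin n) A), ∃ P₁ ∈ mband A n 0 q,
      P = cst c + (zmat n 1).val * P₁ := by
  refine ⟨mcoeff 0 P, ∑ k ∈ (Finset.Icc 0 (q + 1)).erase 0, (zmat n (k - 1)).val * cst (mcoeff k P),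
    Submodule.sum_mem _ fun k hk => ?_, ?_⟩
  · simp only [Finset.mem_erase, Finset.mem_Icc] at hk
    exact mband_le (by omega) (by omega) (zmat_mul_mem_mband (k - 1)
      (cst_mem_mband le_rfl le_rfl _))
  · conv_lhs => rw [eq_sum_of_mem_mband hP, ← Finset.add_sum_erase _ _
      (Finset.mem_Icc.2 ⟨le_rfl, by omega⟩ : (0 : ℤ) ∈ Finset.Icc 0 (q + 1)), zmat_zero]
    rw [Units.val_one, one_mul, Finset.mul_sum]
    congr 1
    refine Finset.sum_congr rfl fun k _ => ?_
    rw [← mul_assoc, ← Units.val_mul, ← zmat_add, add_sub_cancel]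

/-- If P = c + zP₁, elementary operations on P ⊕ 1 produce the matrix with rows (c, P₁) and (-z, 1).
This lowers the degree by one while doubling the size, so the induction must allow all sizes. -/
theorem cls_mem_of_polynomial (m : ℕ) : ∀ {n : ℕ} {P : GLn n (Loop A)},
    P.val ∈ mband A n 0 (m + 1) → K1.cls P ∈ constSupBott A := by
  induction m with
  | zero => exact fun hP => cls_mem_of_linear (by simpa using hP)
  | succ m ih =>
    intro n P hP
    obtain ⟨c, P₁, hP₁, e⟩ := exists_eq_cst_add_zmat_mul (q := m + 1) (by omega)
      (by simpa using hP)
    let U : GLn (n + n) (Loop A) := elemUpper P₁ * dsum P 1 * elemLower (-(zmat n 1).val)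
    have hU : U.val = block (cst c) P₁ (-(zmat n 1).val) 1 := by
      change block 1 P₁ 0 1 * block P.val 0 0 1 * block 1 0 (-(zmat n 1).val) 1 = _
      rw [block_mul, block_mul]
      congr 1
      · rw [e, (zmat_commute 1 P₁).eq]
        simp
      · simp
      · simp
      · simp
    have h1 : K1.cls U = K1.cls P := by
      rw [K1.cls_mul, K1.cls_mul, K1.cls_eq_zero_of_joined (joined_elemUpper _),
        K1.cls_eq_zero_of_joined (joined_elemLower _), K1.cls_dsum, K1.cls_one]
      simp
    rw [← h1]
    refine ih ?_
    rw [hU]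
    refine block_mem_mband (cst_mem_mband le_rfl (by omega) c) hP₁ ?_ ?_
    · have := zmat_mul_mem_mband (p := 0) (q := 0) 1 (cst_mem_mband le_rfl le_rfl
        (1 : Matrix (Fin n) (Fin n) A))
      rw [cst_one, mul_one] at this
      exact neg_mem (mband_le (by omega) (by omega) this)
    · have := cst_mem_mband (p := 0) (q := m + 1) le_rfl (by omega) (1 : Matrix (Fin n) (Fin n) A)
      rwa [cst_one] at this

-- An invertible loop is joined to a nearby Laurent polynomial, and multiplication by z^d makes it a
-- polynomial. The class of z^d lies in the subgroup because z is the loop of the idempotent 1.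
variable (A) in
theorem constSupBott_eq_top : constSupBott A = ⊤ := by
  refine eq_top_iff.2 fun x _ => ?_
  obtain ⟨n, hn⟩ := x.exists_cls
  obtain ⟨u, rfl⟩ := hn n le_rfl
  obtain ⟨W, hW1, hW2, hW3, hW4⟩ := exists_convex_nhds_unit u
  obtain ⟨F, hF, d, hd⟩ := exists_laurent_unit hW1 hW4 ⟨_, hW2⟩
  rw [K1.cls_eq_of_joined (joined_of_convex hW3 hW4 hW2 hF)]
  have h1 : K1.cls (zmat n d * F) ∈ constSupBott A := cls_mem_of_polynomial (d + d)
    (mband_le (by simp) (by push_cast; omega) (zmat_mul_mem_mband d hd))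
  rw [K1.cls_mul] at h1
  exact (AddSubgroup.add_mem_cancel_left _ (cls_zmat_mem d)).1 h1

/-- A class in `K₁(C(𝕋, A))` that vanishes at the base point comes from `K₀(A)`. -/
theorem exists_bottHom_eq {x : K1 (Loop A)} (hx : K1.map (ev 0) x = 0) :
    ∃ y : K0 A, bottHom A y = x := by
  obtain ⟨_, ⟨a, rfl⟩, _, ⟨y, rfl⟩, rfl⟩ := AddSubgroup.mem_sup.1
    (constSupBott_eq_top A ▸ AddSubgroup.mem_top x)
  rw [map_add, ev_zero_bottHom, add_zero, ← AddMonoidHom.comp_apply, ← K1.map_comp] at hx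
  -- Evaluation at the base point is a left inverse of the inclusion of constants and kills the Bott
  -- part.
  have h1 : a = 0 := by
    obtain ⟨n, hn⟩ := a.exists_cls
    obtain ⟨u, rfl⟩ := hn n le_rfl
    exact hx
  exact ⟨y, by rw [h1, map_zero, zero_add]⟩

end Loop

/-! ### Exactness at K₀(B₁₂) and K₁(B) -/

section Exactness

variable {B B₁ B₂ B₁₂ : Type*} [CStarAlgebra B] [CStarAlgebra B₁] [CStarAlgebra B₂]
  [CStarAlgebra B₁₂] {q₁ : B →⋆ₐ[ℂ] B₁} {q₂ : B →⋆ₐ[ℂ] B₂} {ρ₁ : B₁ →⋆ₐ[ℂ] B₁₂}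
  {ρ₂ : B₂ →⋆ₐ[ℂ] B₁₂}

theorem continuous_dsum {A : Type*} [CStarAlgebra A] {n m : ℕ} :
    Continuous fun p : GLn n A × GLn m A => dsum p.1 p.2 := by
  refine (isOpenEmbedding_unitsVal _).continuous_iff.2 ?_
  exact (Continuous.matrix_fromBlocks (Units.continuous_val.comp continuous_fst) continuous_const
    continuous_const (Units.continuous_val.comp continuous_snd)).matrix_submatrix _ _

theorem dsum_one {A : Type*} [CStarAlgebra A] (n m : ℕ) :
    dsum (1 : GLn n A) (1 : GLn m A) = 1 := Units.ext block_one

theorem dsum_mul {A : Type*} [CStarAlgebra A] {n m : ℕ} (a b : GLn n A) (c d : GLn m A) :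
    dsum (a * b) (c * d) = dsum a c * dsum b d := by
  ext1
  simp [dsum, block_mul]

theorem dsum_inv {A : Type*} [CStarAlgebra A] {n m : ℕ} (a : GLn n A) (c : GLn m A) :
    (dsum a c)⁻¹ = dsum a⁻¹ c⁻¹ := by
  rw [inv_eq_iff_mul_eq_one, ← dsum_mul, mul_inv_cancel, mul_inv_cancel, dsum_one]

theorem continuous_bottExp_smul {A : Type*} [CStarAlgebra A] {n : ℕ}
    (Q : Matrix (Fin n) (Fin n) A) :
    Continuous fun t : unitInterval => bottExp (((t : ℝ) : ℂ) • Q) :=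
  continuous_bottExp.comp ((Complex.continuous_ofReal.comp continuous_subtype_val).smul
    continuous_const)

theorem map_bottExp_smul {A C : Type*} [CStarAlgebra A] [CStarAlgebra C] (f : A →⋆ₐ[ℂ] C) {n : ℕ}
    (z : ℂ) (Q : Matrix (Fin n) (Fin n) A) :
    GLn.map f n (bottExp (z • Q)) = bottExp (z • Q.map f) := by
  rw [map_bottExp, map_smul_matrix]

/-- The standard path from `1` to `exp(2πiQ)`. -/
def bottPath {A : Type*} [CStarAlgebra A] {n : ℕ} (Q : Matrix (Fin n) (Fin n) A) :
    Path 1 (bottExp Q) where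
  toFun t := bottExp (((t : ℝ) : ℂ) • Q)
  continuous_toFun := continuous_bottExp_smul Q
  source' := by simp [bottExp_idem]
  target' := by simp

theorem bottPath_apply {A : Type*} [CStarAlgebra A] {n : ℕ} (Q : Matrix (Fin n) (Fin n) A)
    (t : unitInterval) : bottPath Q t = bottExp (((t : ℝ) : ℂ) • Q) := rfl

/-- The image of an idempotent over B₂ can be lifted to that idempotent, and exp(2πie) = 1. -/
theorem bottMap_map_right (hB : IsPullbackSquare q₁ q₂ ρ₁ ρ₂) (hs : Function.Surjective ρ₂)
    (x : K0 B₂) : bottMap hB hs (K0.map ρ₂ x) = 0 := by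
  have : (bottMap hB hs).comp (K0.map ρ₂) = 0 := by
    refine K0.hom_ext fun n e he => ?_
    rw [AddMonoidHom.comp_apply, K0.map_cls, bottMap_cls hB hs (Q := e) (w := 1)]
    · exact K1.cls_one n
    · rfl
    · exact ⟨map_one _, by rw [map_one, bottExp_idem he]⟩
  exact DFunLike.congr_fun this x

/-- If Q lifts ρ₁(e), then exp(2πite) and exp(2πitQ) agree over B₁₂ and glue to a path from 1 to the
Bott matrix. -/
theorem bottMap_map_left (hB : IsPullbackSquare q₁ q₂ ρ₁ ρ₂) (hs : Function.Surjective ρ₂)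
    (x : K0 B₁) : bottMap hB hs (K0.map ρ₁ x) = 0 := by
  have : (bottMap hB hs).comp (K0.map ρ₁) = 0 := by
    refine K0.hom_ext fun n e he => ?_
    obtain ⟨w, Q, hQ, hw⟩ := exists_bottRep_lift hB hs (e := e.map ρ₁) (by rw [← Matrix.map_mul,
        he])
    rw [AddMonoidHom.comp_apply, K0.map_cls, bottMap_cls hB hs _ hQ hw]
    refine K1.cls_eq_zero_of_joined (hB.joined_of_path
      ((bottPath e).cast (map_one _) (hw.1.trans (bottExp_idem he).symm))
      ((bottPath Q).cast (map_one _) hw.2) fun t => ?_)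
    change GLn.map ρ₁ n (bottExp _) = GLn.map ρ₂ n (bottExp _)
    rw [map_bottExp_smul, map_bottExp_smul, hQ]
  exact DFunLike.congr_fun this x

/-- A path γ from 1 to the stabilized Bott matrix is closed over B₁, giving a loop U. Over B₂ the
product exp(2πitQ) q₂(γ)⁻¹ is also closed, giving a loop Y. Over B₁₂ the product of Y and U is the
loop of e ⊕ 0. Both are 1 at the base point, so periodicity replaces them by K₀ classes, and
injectivity gives the equation in K₀(B₁₂). -/
theorem exact_bottMap_left (hB : IsPullbackSquare q₁ q₂ ρ₁ ρ₂) (hs : Function.Surjective ρ₂) :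
    Function.Exact (diffMap (K0.map ρ₁) (K0.map ρ₂)) (bottMap hB hs) := by
  intro x
  constructor
  · intro hx
    obtain ⟨n, m, e, he, rfl⟩ := K0.exists_cls_sub_one x
    obtain ⟨w, Q, hQ, hw⟩ := exists_bottRep_lift hB hs he
    have h1 : K0.cls (1 : Matrix (Fin m) (Fin m) B₁₂) (one_mul 1) =
        K0.map ρ₂ (K0.cls (1 : Matrix (Fin m) (Fin m) B₂) (one_mul 1)) := (K0.map_cls_one ρ₂).symm
    rw [map_sub, h1, bottMap_map_right, sub_zero, bottMap_cls hB hs he hQ hw, ← K1.cls_one n] at hx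
    obtain ⟨k, hk⟩ := K1.exists_joined_of_cls_eq hx
    rw [dsum_one] at hk
    obtain ⟨γ⟩ := hk.symm
    have hw' := hw.dsum (BottRep.zero k)
    have hQ' : (block Q 0 0 (0 : Matrix (Fin k) (Fin k) B₂)).map ρ₂ = block e 0 0 0 := by
      rw [block_map, hQ]
      simp only [Matrix.map_zero _ (map_zero ρ₂)]
    set w' := dsum w (1 : GLn k B)
    set Q' := block Q 0 0 (0 : Matrix (Fin k) (Fin k) B₂)
    have he' := block_idem he (zero_mul (0 : Matrix (Fin k) (Fin k) B₁₂))
    obtain ⟨U, hU⟩ := Loop.exists_unit (γ := fun t => GLn.map q₁ _ (γ t))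
      ((GLn.continuous_map q₁ _).comp γ.continuous) (by simp [hw'.1])
    obtain ⟨Y, hY⟩ := Loop.exists_unit
      (γ := fun t => bottPath Q' t * (GLn.map q₂ _ (γ t))⁻¹)
      ((bottPath Q').continuous.mul ((GLn.continuous_map q₂ _).comp γ.continuous).inv)
      (by simp [hw'.2])
    have hYU : GLn.map (Loop.map ρ₂) _ Y * GLn.map (Loop.map ρ₁) _ U =
        Loop.bottLoop (block e 0 0 0) he' := by
      refine Loop.unit_ext fun t => ?_
      obtain ⟨s, rfl⟩ := Loop.exists_unitInterval t
      have e1 : GLn.map (Loop.ev ((s : ℝ) : UnitAddCircle)) _ (GLn.map (Loop.map ρ₂) _ Y) =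
          GLn.map ρ₂ _ (GLn.map (Loop.ev ((s : ℝ) : UnitAddCircle)) _ Y) := rfl
      have e2 : GLn.map (Loop.ev ((s : ℝ) : UnitAddCircle)) _ (GLn.map (Loop.map ρ₁) _ U) =
          GLn.map ρ₁ _ (GLn.map (Loop.ev ((s : ℝ) : UnitAddCircle)) _ U) := rfl
      rw [map_mul, e1, e2, hY, hU, map_mul, map_inv, hB.map_map_unit, inv_mul_cancel_right,
        bottPath_apply, map_bottExp_smul, hQ', Loop.ev_bottLoop]
    have hU0 : K1.map (Loop.ev 0) (K1.cls U) = 0 := by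
      have := hU 0
      simp only [Set.Icc.coe_zero, AddCircle.coe_zero, Path.source, map_one] at this
      rw [K1.map_cls, this, K1.cls_one]
    have hY0 : K1.map (Loop.ev 0) (K1.cls Y) = 0 := by
      have := hY 0
      simp only [Set.Icc.coe_zero, AddCircle.coe_zero, Path.source, map_one, inv_one,
        mul_one] at this
      rw [K1.map_cls, this, K1.cls_one]
    obtain ⟨z, hz⟩ := Loop.exists_bottHom_eq hU0
    obtain ⟨y, hy⟩ := Loop.exists_bottHom_eq hY0
    have h2 := congrArg K1.cls hYU
    rw [K1.cls_mul, ← K1.map_cls, ← K1.map_cls, ← hz, ← hy, Loop.map_bottHom, Loop.map_bottHom,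
      ← map_add, ← Loop.bottHom_cls] at h2
    have h3 := Loop.bottHom_injective _ h2
    rw [K0.cls_block he (zero_mul 0), K0.cls_zero, add_zero] at h3
    -- The sign compensates for the minus sign in `diffMap`, since [e] is the sum of the images of y
    -- and z.
    refine ⟨(-z, y - K0.cls (1 : Matrix (Fin m) (Fin m) B₂) (one_mul 1)), ?_⟩
    change K0.map ρ₂ (y - K0.cls (1 : Matrix (Fin m) (Fin m) B₂) (one_mul 1)) -
      K0.map ρ₁ (-z) = _
    rw [map_sub, map_neg, h1, ← h3]
    abel
  · rintro ⟨⟨y, z⟩, rfl⟩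
    change bottMap hB hs (K0.map ρ₂ z - K0.map ρ₁ y) = 0
    rw [map_sub, bottMap_map_left, bottMap_map_right, sub_zero]

/-- The loop `L` over `B₁₂` is the quotient of paths from `1` to the components of `w`. -/
def IsClutching (q₁ : B →⋆ₐ[ℂ] B₁) (q₂ : B →⋆ₐ[ℂ] B₂) (ρ₁ : B₁ →⋆ₐ[ℂ] B₁₂) (ρ₂ : B₂ →⋆ₐ[ℂ] B₁₂)
    {n : ℕ} (w : GLn n B) (L : GLn n (Loop B₁₂)) : Prop :=
  ∃ (u : Path 1 (GLn.map q₁ n w)) (v : Path 1 (GLn.map q₂ n w)), ∀ t : unitInterval,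
    GLn.map (Loop.ev ((t : ℝ) : UnitAddCircle)) n L = (GLn.map ρ₁ n (u t))⁻¹ * GLn.map ρ₂ n (v t)

/-- The quotient closes up because both paths end at the same matrix over B₁₂, namely the image of
w. -/
theorem IsClutching.exists (hB : IsPullbackSquare q₁ q₂ ρ₁ ρ₂) {n : ℕ} {w : GLn n B}
    (h1 : Joined 1 (GLn.map q₁ n w)) (h2 : Joined 1 (GLn.map q₂ n w)) :
    ∃ L, IsClutching q₁ q₂ ρ₁ ρ₂ w L := by
  obtain ⟨u⟩ := h1
  obtain ⟨v⟩ := h2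
  obtain ⟨L, hL⟩ := Loop.exists_unit
    (γ := fun t => (GLn.map ρ₁ n (u t))⁻¹ * GLn.map ρ₂ n (v t))
    (((GLn.continuous_map ρ₁ n).comp u.continuous).inv.mul
      ((GLn.continuous_map ρ₂ n).comp v.continuous)) (by simp [hB.map_map_unit])
  exact ⟨L, u, v, hL⟩

theorem IsClutching.dsum {n m : ℕ} {w : GLn n B} {L : GLn n (Loop B₁₂)} {w' : GLn m B}
    {L' : GLn m (Loop B₁₂)} (h : IsClutching q₁ q₂ ρ₁ ρ₂ w L)
    (h' : IsClutching q₁ q₂ ρ₁ ρ₂ w' L') :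
    IsClutching q₁ q₂ ρ₁ ρ₂ (dsum w w') (dsum L L') := by
  obtain ⟨u, v, h⟩ := h
  obtain ⟨u', v', h'⟩ := h'
  refine ⟨⟨⟨fun t => CStarK.dsum (u t) (u' t),
      continuous_dsum.comp (u.continuous.prodMk u'.continuous)⟩, ?_, ?_⟩,
    ⟨⟨fun t => CStarK.dsum (v t) (v' t),
      continuous_dsum.comp (v.continuous.prodMk v'.continuous)⟩, ?_, ?_⟩, fun t => ?_⟩
  · simp [dsum_one]
  · simp [map_dsum]
  · simp [dsum_one]
  · simp [map_dsum]
  · change _ = (GLn.map ρ₁ _ (CStarK.dsum (u t) (u' t)))⁻¹ *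
      GLn.map ρ₂ _ (CStarK.dsum (v t) (v' t))
    rw [map_dsum, map_dsum, map_dsum, h, h', dsum_inv, dsum_mul]

theorem IsClutching.one (n : ℕ) : IsClutching q₁ q₂ ρ₁ ρ₂ (1 : GLn n B) (1 : GLn n (Loop B₁₂)) :=
  ⟨(Path.refl 1).cast rfl (map_one _), (Path.refl 1).cast rfl (map_one _), fun t => by simp⟩

/-- Winding once around the scalars over B₂ shows that w = 1 also has a nontrivial clutching loop.
Such summands absorb the term -[I_m] of a class [e] - [I_m]. -/
theorem IsClutching.bottLoop_one (n : ℕ) : IsClutching q₁ q₂ ρ₁ ρ₂ (1 : GLn n B)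
    (Loop.bottLoop (1 : Matrix (Fin n) (Fin n) B₁₂) (one_mul 1)) := by
  refine ⟨(Path.refl 1).cast rfl (map_one _),
    (bottPath (1 : Matrix (Fin n) (Fin n) B₂)).cast rfl
      ((map_one _).trans (bottExp_idem (one_mul 1)).symm), fun t => ?_⟩
  change _ = (GLn.map ρ₁ n 1)⁻¹ * GLn.map ρ₂ n (bottExp _)
  rw [map_one, inv_one, one_mul, map_bottExp_smul, Loop.ev_bottLoop]
  simp

/-- The quotient of the two homotopic loops lifts to an invertible loop M over B₂. Correcting v by
M, and dividing by exp(2πitQ), makes it agree with u over B₁₂. The glued path joins 1 to w w'⁻¹,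
where w' is the Bott matrix. -/
theorem IsClutching.cls_eq (hB : IsPullbackSquare q₁ q₂ ρ₁ ρ₂) (hs : Function.Surjective ρ₂)
    {n : ℕ} {w : GLn n B} {L : GLn n (Loop B₁₂)} (h : IsClutching q₁ q₂ ρ₁ ρ₂ w L)
    {e : Matrix (Fin n) (Fin n) B₁₂} (he : e * e = e) (hL : Joined L (Loop.bottLoop e he)) :
    bottMap hB hs (K0.cls e he) = K1.cls w := by
  obtain ⟨u, v, h⟩ := h
  have hj : Joined 1 (L⁻¹ * Loop.bottLoop e he) := by
    simpa using! (Joined.refl L⁻¹).mul hL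
  obtain ⟨M, -, hM⟩ := exists_lift_of_joined (Loop.map_surjective hs) hj
  obtain ⟨w', Q, hQ, hw⟩ := exists_bottRep_lift hB hs he
  have eM (t : UnitAddCircle) : GLn.map ρ₂ n (GLn.map (Loop.ev t) n M) =
      (GLn.map (Loop.ev t) n L)⁻¹ * GLn.map (Loop.ev t) n (Loop.bottLoop e he) := by
    rw [← map_inv, ← map_mul, ← hM]
    rfl
  have hL0 : GLn.map (Loop.ev 0) n L = 1 := by simpa using h 0
  have eM0 : GLn.map ρ₂ n (GLn.map (Loop.ev 0) n M) = 1 := by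
    rw [eM, hL0, Loop.ev_zero_bottLoop, inv_one, mul_one]
  rw [bottMap_cls hB hs he hQ hw]
  have key : Joined 1 (w * w'⁻¹) := by
    -- The factor M(0)⁻¹ makes the path start at 1 and, M being closed, end at q₂(w w'⁻¹). Its image
    -- over B₁₂ is 1, so compatibility is not affected.
    refine hB.joined_of_path (u.cast (map_one _) (by rw [map_mul, map_inv, hw.1]; simp))
      ⟨⟨fun t => v t * (GLn.map (Loop.ev ((t : ℝ) : UnitAddCircle)) n M *
        (GLn.map (Loop.ev 0) n M)⁻¹) * (bottPath Q t)⁻¹, ?_⟩, ?_, ?_⟩ fun t => ?_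
    · refine (v.continuous.mul (Continuous.mul ?_ continuous_const)).mul
        (bottPath Q).continuous.inv
      exact (Loop.continuous_ev_unit M).comp (AddCircle.continuous_mk' 1 |>.comp
        continuous_subtype_val)
    · simp
    · have h0 : ((1 : ℝ) : UnitAddCircle) = 0 := AddCircle.coe_period 1
      simp [hw.2, h0]
    · change GLn.map ρ₁ n (u t) = GLn.map ρ₂ n (v t * (GLn.map (Loop.ev _) n M *
        (GLn.map (Loop.ev 0) n M)⁻¹) * (bottPath Q t)⁻¹)
      rw [map_mul, map_mul, map_mul, map_inv, map_inv, eM0, eM, h, Loop.ev_bottLoop,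
        bottPath_apply, map_bottExp_smul, hQ]
      group
  have := K1.cls_eq_zero_of_joined key
  rw [K1.cls_mul, K1.cls_inv, add_neg_eq_zero] at this
  exact this.symm

/-- A class that dies over B₁ and B₂ has, after stabilization, a clutching loop. That loop is 1 at
the base point, so periodicity makes it stably homotopic to the loop of an idempotent, up to loops
of identity matrices. -/
theorem exact_bottMap_right (hB : IsPullbackSquare q₁ q₂ ρ₁ ρ₂) (hs : Function.Surjective ρ₂) :
    Function.Exact (bottMap hB hs) ((K1.map q₁).prod (K1.map q₂)) := by
  intro x
  constructor
  · intro hx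
    obtain ⟨n₀, hn⟩ := x.exists_cls
    obtain ⟨w₀, rfl⟩ := hn n₀ le_rfl
    have hx1 : K1.cls (GLn.map q₁ n₀ w₀) = K1.cls (1 : GLn n₀ B₁) := by
      rw [K1.cls_one]; exact congrArg Prod.fst hx
    have hx2 : K1.cls (GLn.map q₂ n₀ w₀) = K1.cls (1 : GLn n₀ B₂) := by
      rw [K1.cls_one]; exact congrArg Prod.snd hx
    obtain ⟨n, w, hw, hw1, hw2⟩ : ∃ (n : ℕ) (w : GLn n B), K1.cls w = K1.cls w₀ ∧
        Joined 1 (GLn.map q₁ n w) ∧ Joined 1 (GLn.map q₂ n w) := by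
      obtain ⟨m₁, h1⟩ := K1.exists_joined_of_cls_eq hx1
      have hx2' : K1.cls (CStarK.dsum (GLn.map q₂ n₀ w₀) (1 : GLn m₁ B₂)) =
          K1.cls (1 : GLn (n₀ + m₁) B₂) := by
        rw [K1.cls_dsum, hx2, K1.cls_one, K1.cls_one, K1.cls_one, add_zero]
      obtain ⟨m₂, h2⟩ := K1.exists_joined_of_cls_eq hx2'
      rw [dsum_one] at h1 h2
      refine ⟨_, dsum (dsum w₀ (1 : GLn m₁ B)) (1 : GLn m₂ B), ?_, ?_, ?_⟩
      · rw [K1.cls_dsum, K1.cls_dsum, K1.cls_one, K1.cls_one, add_zero, add_zero]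
      · rw [map_dsum, map_dsum, map_one, map_one]
        have hc : Continuous fun a : GLn (n₀ + m₁) B₁ => dsum a (1 : GLn m₂ B₁) :=
          continuous_dsum.comp (continuous_id.prodMk continuous_const)
        have := h1.symm.map hc
        rwa [dsum_one] at this
      · rw [map_dsum, map_dsum, map_one, map_one]
        exact h2.symm
    rw [← hw]
    obtain ⟨L, hL⟩ := IsClutching.exists hB hw1 hw2
    have hL0 : K1.map (Loop.ev 0) (K1.cls L) = 0 := by
      obtain ⟨u, v, h⟩ := hL
      have := h 0
      simp only [Set.Icc.coe_zero, AddCircle.coe_zero, Path.source, map_one, inv_one,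
        mul_one] at this
      rw [K1.map_cls, this, K1.cls_one]
    obtain ⟨y, hy⟩ := Loop.exists_bottHom_eq hL0
    obtain ⟨k, m, e, he, rfl⟩ := K0.exists_cls_sub_one y
    rw [map_sub, Loop.bottHom_cls, Loop.bottHom_cls, sub_eq_iff_eq_add] at hy
    have hz := block_idem (block_idem (zero_mul (0 : Matrix (Fin n) (Fin n) B₁₂))
      (zero_mul (0 : Matrix (Fin m) (Fin m) B₁₂))) he
    -- Both sides are brought to size n + m + k: the clutching loop gains the loop of I_m and an
    -- identity, and e is preceded by zero blocks.
    have h1 : K1.cls (dsum (dsum L (Loop.bottLoop (1 : Matrix (Fin m) (Fin m) B₁₂) (one_mul 1)))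
        (1 : GLn k (Loop B₁₂))) = K1.cls (Loop.bottLoop _ hz) := by
      rw [K1.cls_dsum, K1.cls_dsum, Loop.bottLoop_block (block_idem (zero_mul 0)
        (zero_mul 0)) he, Loop.bottLoop_block (zero_mul 0) (zero_mul 0), K1.cls_dsum, K1.cls_dsum,
        Loop.bottLoop_zero, Loop.bottLoop_zero, hy]
      simp [K1.cls_one]
    obtain ⟨j, hj⟩ := K1.exists_joined_of_cls_eq h1
    rw [← Loop.bottLoop_zero j, ← Loop.bottLoop_block hz, Loop.bottLoop_zero j] at hj
    have hcl := (((hL.dsum (IsClutching.bottLoop_one m)).dsum (IsClutching.one k)).dsum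
      (IsClutching.one j)).cls_eq hB hs _ hj
    refine ⟨_, hcl.trans ?_⟩
    simp [K1.cls_dsum, K1.cls_one]
  · rintro ⟨y, rfl⟩
    have : ((K1.map q₁).prod (K1.map q₂)).comp (bottMap hB hs) = 0 := by
      refine K0.hom_ext fun n e he => ?_
      obtain ⟨w, Q, hQ, hw⟩ := exists_bottRep_lift hB hs he
      rw [AddMonoidHom.comp_apply, bottMap_cls hB hs he hQ hw]
      refine Prod.ext ?_ ?_
      · change K1.cls (GLn.map q₁ n w) = 0
        rw [hw.1, K1.cls_one]
      · change K1.cls (GLn.map q₂ n w) = 0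
        rw [hw.2]
        exact K1.cls_eq_zero_of_joined ⟨bottPath Q⟩
    exact DFunLike.congr_fun this y

end Exactness

/-! ### Homomorphisms into a pullback -/

section Pullback

theorem IsPullbackSquare.existsUnique_nonUnitalStarAlgHom {A B B₁ B₂ B₁₂ : Type*}
    [NonUnitalCStarAlgebra A] [NonUnitalCStarAlgebra B] [NonUnitalCStarAlgebra B₁]
    [NonUnitalCStarAlgebra B₂] [NonUnitalCStarAlgebra B₁₂] {q₁ : B →⋆ₙₐ[ℂ] B₁} {q₂ : B →⋆ₙₐ[ℂ] B₂}
    {ρ₁ : B₁ →⋆ₙₐ[ℂ] B₁₂} {ρ₂ : B₂ →⋆ₙₐ[ℂ] B₁₂} (hB : IsPullbackSquare q₁ q₂ ρ₁ ρ₂)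
    {α₁ : A →⋆ₙₐ[ℂ] B₁} {α₂ : A →⋆ₙₐ[ℂ] B₂} (h : ∀ a, ρ₁ (α₁ a) = ρ₂ (α₂ a)) :
    ∃! φ : A →⋆ₙₐ[ℂ] B, q₁.comp φ = α₁ ∧ q₂.comp φ = α₂ := by
  choose φ h1 h2 using fun a => (hB.2 _ _ (h a)).exists
  refine ⟨⟨⟨⟨⟨φ, fun c a => ?_⟩, ?_, fun a b => ?_⟩, fun a b => ?_⟩, fun a => ?_⟩,
    ⟨NonUnitalStarAlgHom.ext h1, NonUnitalStarAlgHom.ext h2⟩, ?_⟩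
  · exact hB.eq_of_eq (by simp [h1]) (by simp [h2])
  · exact hB.eq_of_eq (by simp [h1]) (by simp [h2])
  · exact hB.eq_of_eq (by simp [h1]) (by simp [h2])
  · exact hB.eq_of_eq (by simp [h1]) (by simp [h2])
  · exact hB.eq_of_eq (by simp [h1, map_star]) (by simp [h2, map_star])
  · rintro ψ ⟨h1', h2'⟩
    refine NonUnitalStarAlgHom.ext fun a => hB.eq_of_eq ?_ ?_
    · exact (DFunLike.congr_fun h1' a).trans (h1 a).symm
    · exact (DFunLike.congr_fun h2' a).trans (h2 a).symm

theorem IsPullbackSquare.existsUnique_starAlgHom {A B B₁ B₂ B₁₂ : Type*}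
    [CStarAlgebra A] [CStarAlgebra B] [CStarAlgebra B₁]
    [CStarAlgebra B₂] [CStarAlgebra B₁₂] {q₁ : B →⋆ₐ[ℂ] B₁} {q₂ : B →⋆ₐ[ℂ] B₂}
    {ρ₁ : B₁ →⋆ₐ[ℂ] B₁₂} {ρ₂ : B₂ →⋆ₐ[ℂ] B₁₂} (hB : IsPullbackSquare q₁ q₂ ρ₁ ρ₂)
    {α₁ : A →⋆ₐ[ℂ] B₁} {α₂ : A →⋆ₐ[ℂ] B₂} (h : ∀ a, ρ₁ (α₁ a) = ρ₂ (α₂ a)) :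
    ∃! φ : A →⋆ₐ[ℂ] B, q₁.comp φ = α₁ ∧ q₂.comp φ = α₂ := by
  choose φ h1 h2 using fun a => (hB.2 _ _ (h a)).exists
  refine ⟨⟨⟨⟨⟨⟨φ, ?_⟩, fun a b => ?_⟩, ?_, fun a b => ?_⟩, fun c => ?_⟩, fun a => ?_⟩,
    ⟨StarAlgHom.ext h1, StarAlgHom.ext h2⟩, ?_⟩
  · exact hB.eq_of_eq (by simp [h1]) (by simp [h2])
  · exact hB.eq_of_eq (by simp [h1]) (by simp [h2])
  · exact hB.eq_of_eq (by simp [h1]) (by simp [h2])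
  · exact hB.eq_of_eq (by simp [h1]) (by simp [h2])
  · exact hB.eq_of_eq (by simp [h1, AlgHomClass.commutes]) (by simp [h2, AlgHomClass.commutes])
  · exact hB.eq_of_eq (by simp [h1, map_star]) (by simp [h2, map_star])
  · rintro ψ ⟨h1', h2'⟩
    refine StarAlgHom.ext fun a => hB.eq_of_eq ?_ ?_
    · exact (DFunLike.congr_fun h1' a).trans (h1 a).symm
    · exact (DFunLike.congr_fun h2' a).trans (h2 a).symm

end Pullback

/-! ### The six-term sequence of a square of unital algebras -/

section Unital

variable {A A₁ A₂ A₁₂ B B₁ B₂ B₁₂ : Type*} [CStarAlgebra A] [CStarAlgebra A₁] [CStarAlgebra A₂]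
  [CStarAlgebra A₁₂] [CStarAlgebra B] [CStarAlgebra B₁] [CStarAlgebra B₂] [CStarAlgebra B₁₂]
  {p₁ : A →⋆ₐ[ℂ] A₁} {p₂ : A →⋆ₐ[ℂ] A₂} {π₁ : A₁ →⋆ₐ[ℂ] A₁₂} {π₂ : A₂ →⋆ₐ[ℂ] A₁₂}
  {q₁ : B →⋆ₐ[ℂ] B₁} {q₂ : B →⋆ₐ[ℂ] B₂} {ρ₁ : B₁ →⋆ₐ[ℂ] B₁₂} {ρ₂ : B₂ →⋆ₐ[ℂ] B₁₂}
  {φ : A →⋆ₐ[ℂ] B} {φ₁ : A₁ →⋆ₐ[ℂ] B₁} {φ₂ : A₂ →⋆ₐ[ℂ] B₂} {φ₁₂ : A₁₂ →⋆ₐ[ℂ] B₁₂}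

theorem sixTermExact (hB : IsPullbackSquare q₁ q₂ ρ₁ ρ₂) (hs : Function.Surjective ρ₂) :
    SixTermExact ((K0.map q₁).prod (K0.map q₂)) (diffMap (K0.map ρ₁) (K0.map ρ₂)) (bottMap hB hs)
      ((K1.map q₁).prod (K1.map q₂)) (diffMap (K1.map ρ₁) (K1.map ρ₂)) (milnorMap hB hs) :=
  ⟨exact_K0_middle hB hs, exact_bottMap_left hB hs, exact_bottMap_right hB hs,
    exact_K1_middle hB hs, exact_milnorMap_right hB hs, exact_milnorMap_left hB hs⟩

theorem map_map_matrix_of_comp_eq {C C' D D' : Type*} [CStarAlgebra C] [CStarAlgebra C']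
    [CStarAlgebra D] [CStarAlgebra D'] {f : C →⋆ₐ[ℂ] D} {g : D →⋆ₐ[ℂ] D'} {f' : C →⋆ₐ[ℂ] C'}
    {g' : C' →⋆ₐ[ℂ] D'} (h : g.comp f = g'.comp f') {ι κ : Type*} (M : Matrix ι κ C) :
    (M.map f).map g = (M.map f').map g' :=
  Matrix.ext fun i j => DFunLike.congr_fun h (M i j)

theorem K0.map_map_of_comp_eq {C C' D D' : Type*} [CStarAlgebra C] [CStarAlgebra C']
    [CStarAlgebra D] [CStarAlgebra D'] {f : C →⋆ₐ[ℂ] D} {g : D →⋆ₐ[ℂ] D'} {f' : C →⋆ₐ[ℂ] C'}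
    {g' : C' →⋆ₐ[ℂ] D'} (h : g.comp f = g'.comp f') (x : K0 C) :
    K0.map g (K0.map f x) = K0.map g' (K0.map f' x) := by
  rw [← AddMonoidHom.comp_apply, ← AddMonoidHom.comp_apply, ← K0.map_comp, ← K0.map_comp, h]

theorem K1.map_map_of_comp_eq {C C' D D' : Type*} [CStarAlgebra C] [CStarAlgebra C']
    [CStarAlgebra D] [CStarAlgebra D'] {f : C →⋆ₐ[ℂ] D} {g : D →⋆ₐ[ℂ] D'} {f' : C →⋆ₐ[ℂ] C'}
    {g' : C' →⋆ₐ[ℂ] D'} (h : g.comp f = g'.comp f') (x : K1 C) :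
    K1.map g (K1.map f x) = K1.map g' (K1.map f' x) := by
  rw [← AddMonoidHom.comp_apply, ← AddMonoidHom.comp_apply, ← K1.map_comp, ← K1.map_comp, h]

/-- A morphism of squares carries trivializations to trivializations and gluing matrices to gluing
matrices. Naturality of the Milnor map therefore needs no comparison of explicit formulas. -/
theorem MilnorRep.map (h1 : q₁.comp φ = φ₁.comp p₁) (h2 : q₂.comp φ = φ₂.comp p₂)
    (h3 : φ₁₂.comp π₁ = ρ₁.comp φ₁) (h4 : φ₁₂.comp π₂ = ρ₂.comp φ₂) {n N : ℕ} {a : GLn n A₁₂}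
    {p : Matrix (Fin N) (Fin N) A} (h : MilnorRep p₁ p₂ π₁ π₂ a p) :
    MilnorRep q₁ q₂ ρ₁ ρ₂ (GLn.map φ₁₂ n a) (p.map φ) := by
  obtain ⟨X₁, Y₁, X₂, Y₂, e1, e2, e3, e4, e5, e6⟩ := h
  refine ⟨X₁.map φ₁, Y₁.map φ₁, X₂.map φ₂, Y₂.map φ₂, ?_, ?_, ?_, ?_, ?_, ?_⟩
  · rw [← Matrix.map_mul, e1, Matrix.map_one _ (map_zero φ₁) (map_one φ₁)]
  · rw [← Matrix.map_mul, e2, map_map_matrix_of_comp_eq h1]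
  · rw [← Matrix.map_mul, e3, Matrix.map_one _ (map_zero φ₂) (map_one φ₂)]
  · rw [← Matrix.map_mul, e4, map_map_matrix_of_comp_eq h2]
  · rw [← map_map_matrix_of_comp_eq h4, ← map_map_matrix_of_comp_eq h3, e5, Matrix.map_mul]
    rfl
  · rw [← map_map_matrix_of_comp_eq h4, ← map_map_matrix_of_comp_eq h3, e6, Matrix.map_mul]
    rfl

theorem map_milnorMap (hA : IsPullbackSquare p₁ p₂ π₁ π₂) (hπ : Function.Surjective π₂)
    (hB : IsPullbackSquare q₁ q₂ ρ₁ ρ₂) (hs : Function.Surjective ρ₂)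
    (h1 : q₁.comp φ = φ₁.comp p₁) (h2 : q₂.comp φ = φ₂.comp p₂)
    (h3 : φ₁₂.comp π₁ = ρ₁.comp φ₁) (h4 : φ₁₂.comp π₂ = ρ₂.comp φ₂) (x : K1 A₁₂) :
    K0.map φ (milnorMap hA hπ x) = milnorMap hB hs (K1.map φ₁₂ x) := by
  obtain ⟨n, hn⟩ := x.exists_cls
  obtain ⟨a, rfl⟩ := hn n le_rfl
  obtain ⟨p, -, h⟩ := exists_idem_milnorRep hA hπ a
  rw [milnorMap_cls hA hπ h, K1.map_cls, milnorMap_cls hB hs (h.map h1 h2 h3 h4), map_sub,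
    K0.map_cls, K0.map_cls_one]

/-- If Q lifts e, its image under φ₂ lifts the image of e under φ₁₂, and exponentials are natural.
-/
theorem map_bottMap (hA : IsPullbackSquare p₁ p₂ π₁ π₂) (hπ : Function.Surjective π₂)
    (hB : IsPullbackSquare q₁ q₂ ρ₁ ρ₂) (hs : Function.Surjective ρ₂)
    (h1 : q₁.comp φ = φ₁.comp p₁) (h2 : q₂.comp φ = φ₂.comp p₂)
    (h4 : φ₁₂.comp π₂ = ρ₂.comp φ₂) (x : K0 A₁₂) :
    K1.map φ (bottMap hA hπ x) = bottMap hB hs (K0.map φ₁₂ x) := by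
  have : (K1.map φ).comp (bottMap hA hπ) = (bottMap hB hs).comp (K0.map φ₁₂) := by
    refine K0.hom_ext fun n e he => ?_
    obtain ⟨w, Q, hQ, hw⟩ := exists_bottRep_lift hA hπ he
    have hw' : BottRep q₁ q₂ (Q.map φ₂) (GLn.map φ n w) := by
      have e1 : GLn.map q₁ n (GLn.map φ n w) = GLn.map φ₁ n (GLn.map p₁ n w) :=
        Units.ext (map_map_matrix_of_comp_eq h1 w.val)
      have e2 : GLn.map q₂ n (GLn.map φ n w) = GLn.map φ₂ n (GLn.map p₂ n w) :=
        Units.ext (map_map_matrix_of_comp_eq h2 w.val)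
      exact ⟨by rw [e1, hw.1, map_one], by rw [e2, hw.2, map_bottExp]⟩
    rw [AddMonoidHom.comp_apply, AddMonoidHom.comp_apply, bottMap_cls hA hπ he hQ hw, K0.map_cls,
      K1.map_cls, bottMap_cls hB hs _ (by rw [← map_map_matrix_of_comp_eq h4, hQ]) hw']
  exact DFunLike.congr_fun this x

theorem sixTermMorphism (hA : IsPullbackSquare p₁ p₂ π₁ π₂) (hπ : Function.Surjective π₂)
    (hB : IsPullbackSquare q₁ q₂ ρ₁ ρ₂) (hs : Function.Surjective ρ₂)
    (h1 : q₁.comp φ = φ₁.comp p₁) (h2 : q₂.comp φ = φ₂.comp p₂)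
    (h3 : φ₁₂.comp π₁ = ρ₁.comp φ₁) (h4 : φ₁₂.comp π₂ = ρ₂.comp φ₂) :
    SixTermMorphism
      ((K0.map p₁).prod (K0.map p₂)) (diffMap (K0.map π₁) (K0.map π₂)) (bottMap hA hπ)
      ((K1.map p₁).prod (K1.map p₂)) (diffMap (K1.map π₁) (K1.map π₂)) (milnorMap hA hπ)
      ((K0.map q₁).prod (K0.map q₂)) (diffMap (K0.map ρ₁) (K0.map ρ₂)) (bottMap hB hs)
      ((K1.map q₁).prod (K1.map q₂)) (diffMap (K1.map ρ₁) (K1.map ρ₂)) (milnorMap hB hs)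
      (K0.map φ) ((K0.map φ₁).prodMap (K0.map φ₂)) (K0.map φ₁₂)
      (K1.map φ) ((K1.map φ₁).prodMap (K1.map φ₂)) (K1.map φ₁₂) := by
  refine ⟨AddMonoidHom.ext fun x => ?_, AddMonoidHom.ext fun x => ?_, AddMonoidHom.ext fun x => ?_,
    AddMonoidHom.ext fun x => ?_, AddMonoidHom.ext fun x => ?_, AddMonoidHom.ext fun x => ?_⟩
  · exact Prod.ext (K0.map_map_of_comp_eq h1 x).symm (K0.map_map_of_comp_eq h2 x).symm
  · change K0.map φ₁₂ (K0.map π₂ x.2 - K0.map π₁ x.1) =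
      K0.map ρ₂ (K0.map φ₂ x.2) - K0.map ρ₁ (K0.map φ₁ x.1)
    rw [map_sub, K0.map_map_of_comp_eq h4, K0.map_map_of_comp_eq h3]
  · exact map_bottMap hA hπ hB hs h1 h2 h4 x
  · exact Prod.ext (K1.map_map_of_comp_eq h1 x).symm (K1.map_map_of_comp_eq h2 x).symm
  · change K1.map φ₁₂ (K1.map π₂ x.2 - K1.map π₁ x.1) =
      K1.map ρ₂ (K1.map φ₂ x.2) - K1.map ρ₁ (K1.map φ₁ x.1)
    rw [map_sub, K1.map_map_of_comp_eq h4, K1.map_map_of_comp_eq h3]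
  · exact map_milnorMap hA hπ hB hs h1 h2 h3 h4 x

end Unital

/-! ### The six-term sequence of a square of algebras that need not have units -/

section NonUnitalSplitting

variable {A B : Type*} [NonUnitalCStarAlgebra A] [NonUnitalCStarAlgebra B]

theorem starMap_fst (f : A →⋆ₙₐ[ℂ] B) (x : Unitization ℂ A) :
    (Unitization.starMap f x).fst = x.fst := by
  simp [Unitization.algebraMap_eq_inl]

theorem starMap_snd (f : A →⋆ₙₐ[ℂ] B) (x : Unitization ℂ A) :
    (Unitization.starMap f x).snd = f x.snd := by
  simp [Unitization.algebraMap_eq_inl]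

theorem starMap_comp_scalarMap (f : A →⋆ₙₐ[ℂ] B) :
    (Unitization.starMap f).comp (scalarMap A) =
      (scalarMap B).comp (Unitization.starMap f) := by
  refine StarAlgHom.ext fun x => Unitization.ext ?_ ?_
  · simp only [StarAlgHom.comp_apply, scalarMap, starMap_fst]
  · simp only [StarAlgHom.comp_apply, scalarMap, starMap_snd, NonUnitalStarAlgHom.zero_apply,
      map_zero]

theorem scalarMap_eq_comp_character :
    scalarMap A = (StarAlgHom.ofId ℂ (Unitization ℂ A)).comp (character A) := by
  refine Unitization.starAlgHom_ext (NonUnitalStarAlgHom.ext fun a => ?_)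
  change scalarMap A (a : Unitization ℂ A) = algebraMap ℂ _ (character A (a : Unitization ℂ A))
  rw [character_coe, map_zero, scalarMap, Unitization.starMap_inr, NonUnitalStarAlgHom.zero_apply,
    Unitization.inr_zero]

/-- The projection `y ↦ y - s_* y` of `K₀` of the unitization of `A` onto `K₀(A)`. -/
def NK0.proj (A : Type*) [NonUnitalCStarAlgebra A] : K0 (Unitization ℂ A) →+ NK0 A :=
  (AddMonoidHom.id _ - K0.map (scalarMap A)).codRestrict (NK0 A) fun y => by
    change K0.map (character A) (y - K0.map (scalarMap A) y) = 0
    rw [map_sub, scalarMap, ← AddMonoidHom.comp_apply, ← K0.map_comp, character_comp_starMap,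
      sub_self]

theorem NK0.coe_proj (y : K0 (Unitization ℂ A)) :
    (NK0.proj A y : K0 (Unitization ℂ A)) = y - K0.map (scalarMap A) y := rfl

/-- The scalar map factors through the character, so it vanishes on the kernel that defines K₀(A).
-/
theorem NK0.proj_coe (x : NK0 A) : NK0.proj A x = x := by
  refine Subtype.ext ?_
  have hx : K0.map (character A) x = 0 := x.2
  rw [NK0.coe_proj, scalarMap_eq_comp_character, K0.map_comp, AddMonoidHom.comp_apply, hx,
    map_zero, sub_zero]

theorem NK0.coe_map (f : A →⋆ₙₐ[ℂ] B) (x : NK0 A) :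
    (NK0.map f x : K0 (Unitization ℂ B)) = K0.map (Unitization.starMap f) x := rfl

/-- Naturality of the projection is what moves preimages found over the unitizations into the
subgroups. -/
theorem NK0.map_proj (f : A →⋆ₙₐ[ℂ] B) (y : K0 (Unitization ℂ A)) :
    NK0.map f (NK0.proj A y) = NK0.proj B (K0.map (Unitization.starMap f) y) := by
  refine Subtype.ext ?_
  rw [NK0.coe_map, NK0.coe_proj, NK0.coe_proj, map_sub,
    K0.map_map_of_comp_eq (starMap_comp_scalarMap f)]

end NonUnitalSplitting

section NonUnital

variable {B B₁ B₂ B₁₂ : Type*} [NonUnitalCStarAlgebra B] [NonUnitalCStarAlgebra B₁]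
  [NonUnitalCStarAlgebra B₂] [NonUnitalCStarAlgebra B₁₂]
  {q₁ : B →⋆ₙₐ[ℂ] B₁} {q₂ : B →⋆ₙₐ[ℂ] B₂} {ρ₁ : B₁ →⋆ₙₐ[ℂ] B₁₂} {ρ₂ : B₂ →⋆ₙₐ[ℂ] B₁₂}

/-- Unitized maps preserve scalar parts, so a compatible pair has one common scalar and a compatible
pair of non-scalar parts. -/
theorem IsPullbackSquare.unitization (hB : IsPullbackSquare q₁ q₂ ρ₁ ρ₂) :
    IsPullbackSquare (Unitization.starMap q₁) (Unitization.starMap q₂)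
      (Unitization.starMap ρ₁) (Unitization.starMap ρ₂) := by
  refine ⟨fun b => Unitization.ext ?_ ?_, fun x y h => ?_⟩
  · simp only [starMap_fst]
  · simp only [starMap_snd, hB.1]
  · have h1 : x.fst = y.fst := by
      rw [← starMap_fst ρ₁ x, h, starMap_fst]
    have h2 : ρ₁ x.snd = ρ₂ y.snd := by
      rw [← starMap_snd ρ₁ x, h, starMap_snd]
    obtain ⟨b, ⟨hb1, hb2⟩, hb⟩ := hB.2 _ _ h2
    have hf : (Unitization.inl x.fst + (b : Unitization ℂ B)).fst = x.fst := by simp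
    have hg : (Unitization.inl x.fst + (b : Unitization ℂ B)).snd = b := by simp
    refine ⟨Unitization.inl x.fst + (b : Unitization ℂ B),
      ⟨Unitization.ext ?_ ?_, Unitization.ext ?_ ?_⟩, ?_⟩
    · rw [starMap_fst, hf]
    · rw [starMap_snd, hg, hb1]
    · rw [starMap_fst, hf, h1]
    · rw [starMap_snd, hg, hb2]
    · rintro c ⟨rfl, rfl⟩
      refine Unitization.ext ?_ ?_
      · rw [hf, starMap_fst]
      · rw [hg]
        exact hb _ ⟨(starMap_snd _ _).symm, (starMap_snd _ _).symm⟩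

/-- The character of B factors through the unitization of q₁, and the Milnor map of the unitized
square is already killed there. -/
theorem character_milnorMap (hB : IsPullbackSquare q₁ q₂ ρ₁ ρ₂) (hs : Function.Surjective ρ₂)
    (x : NK1 B₁₂) : K0.map (character B)
      (milnorMap hB.unitization (Unitization.starMap_surjective hs) x) = 0 := by
  have h := (exact_milnorMap_left hB.unitization
    (Unitization.starMap_surjective hs)).apply_apply_eq_zero x
  have h1 := congrArg Prod.fst h
  rw [← character_comp_starMap q₁, K0.map_comp, AddMonoidHom.comp_apply]
  exact (congrArg _ h1).trans (map_zero _)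

/-- The Milnor map `K₁(B₁₂) → K₀(B)` of a pullback square of algebras that need not have units. -/
def nMilnorMap (hB : IsPullbackSquare q₁ q₂ ρ₁ ρ₂) (hs : Function.Surjective ρ₂) :
    NK1 B₁₂ →+ NK0 B :=
  (milnorMap hB.unitization (Unitization.starMap_surjective hs)).codRestrict (NK0 B)
    (character_milnorMap hB hs)

theorem isNMilnorMap_nMilnorMap (hB : IsPullbackSquare q₁ q₂ ρ₁ ρ₂)
    (hs : Function.Surjective ρ₂) : IsNMilnorMap q₁ q₂ ρ₂ (nMilnorMap hB hs) :=
  isMilnorMap_milnorMap hB.unitization (Unitization.starMap_surjective hs)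

theorem IsNMilnorMap.eq (hB : IsPullbackSquare q₁ q₂ ρ₁ ρ₂) (hs : Function.Surjective ρ₂)
    {D : NK1 B₁₂ →+ NK0 B} (hD : IsNMilnorMap q₁ q₂ ρ₂ D) : D = nMilnorMap hB hs :=
  AddMonoidHom.ext fun x => Subtype.ext (DFunLike.congr_fun
    (IsMilnorMap.eq hB.unitization (Unitization.starMap_surjective hs) hD) x)

/-- The Bott map `K₀(B₁₂) → K₁(B)` of a pullback square of algebras that need not have units. -/
def nBottMap (hB : IsPullbackSquare q₁ q₂ ρ₁ ρ₂) (hs : Function.Surjective ρ₂) :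
    NK0 B₁₂ →+ NK1 B :=
  (bottMap hB.unitization (Unitization.starMap_surjective hs)).comp (NK0 B₁₂).subtype

/-- The scalar map of the unitization of B₁₂ factors through that of B₂, so the Bott map of the
unitized square kills the scalar part. -/
theorem nBottMap_proj (hB : IsPullbackSquare q₁ q₂ ρ₁ ρ₂) (hs : Function.Surjective ρ₂)
    (y : K0 (Unitization ℂ B₁₂)) : nBottMap hB hs (NK0.proj B₁₂ y) =
      bottMap hB.unitization (Unitization.starMap_surjective hs) y := by
  have h : scalarMap B₁₂ = (Unitization.starMap ρ₂).comp
      (Unitization.starMap (0 : B₁₂ →⋆ₙₐ[ℂ] B₂)) := by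
    refine StarAlgHom.ext fun x => Unitization.ext ?_ ?_
    · simp only [StarAlgHom.comp_apply, scalarMap, starMap_fst]
    · simp only [StarAlgHom.comp_apply, scalarMap, starMap_snd, NonUnitalStarAlgHom.zero_apply,
        map_zero]
  change bottMap hB.unitization (Unitization.starMap_surjective hs)
    (y - K0.map (scalarMap B₁₂) y) = _
  rw [map_sub, h, K0.map_comp, AddMonoidHom.comp_apply, bottMap_map_right, sub_zero]

theorem isNBottMap_nBottMap (hB : IsPullbackSquare q₁ q₂ ρ₁ ρ₂) (hs : Function.Surjective ρ₂) :
    IsNBottMap q₁ q₂ ρ₂ (nBottMap hB hs) := by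
  intro k p hp Q hpp hQ hQp
  obtain ⟨w, hw, h⟩ := isBottMap_bottMap hB.unitization (Unitization.starMap_surjective hs) k p hp
    Q hpp hQ hQp
  refine ⟨w, hw, fun x hx => ?_⟩
  rw [show x = NK0.proj B₁₂ (K0.cls p hp) from Subtype.ext hx, nBottMap_proj, h]

/-- Composed with the projection, D is a Bott map of the unitized square, where uniqueness is known;
the projection restricts to the identity on K₀(B₁₂). -/
theorem IsNBottMap.eq (hB : IsPullbackSquare q₁ q₂ ρ₁ ρ₂) (hs : Function.Surjective ρ₂)
    {D : NK0 B₁₂ →+ NK1 B} (hD : IsNBottMap q₁ q₂ ρ₂ D) : D = nBottMap hB hs := by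
  have hb : IsBottMap (Unitization.starMap q₁) (Unitization.starMap q₂) (Unitization.starMap ρ₂)
      (D.comp (NK0.proj B₁₂)) := by
    intro k p hp Q hpp hQ hQp
    obtain ⟨w, hw, h⟩ := hD k p hp Q hpp hQ hQp
    exact ⟨w, hw, h _ rfl⟩
  refine AddMonoidHom.ext fun x => ?_
  rw [← NK0.proj_coe x, nBottMap_proj,
    ← IsBottMap.eq hB.unitization (Unitization.starMap_surjective hs) hb, AddMonoidHom.comp_apply]

/-- Each place is reduced to the unitized sequence. Kernels restrict to the subgroups, and a
preimage over the unitization is projected into K₀ of the algebra itself. -/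
theorem nSixTermExact (hB : IsPullbackSquare q₁ q₂ ρ₁ ρ₂) (hs : Function.Surjective ρ₂) :
    SixTermExact ((NK0.map q₁).prod (NK0.map q₂)) (diffMap (NK0.map ρ₁) (NK0.map ρ₂))
      (nBottMap hB hs) ((NK1.map q₁).prod (NK1.map q₂)) (diffMap (NK1.map ρ₁) (NK1.map ρ₂))
      (nMilnorMap hB hs) := by
  obtain ⟨h1, h2, h3, h4, h5, h6⟩ :=
    sixTermExact hB.unitization (Unitization.starMap_surjective hs)
  refine ⟨fun x => ?_, fun x => ?_, fun x => ?_, h4, fun x => ?_, fun x => ?_⟩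
  · have hx : diffMap (NK0.map ρ₁) (NK0.map ρ₂) x = 0 ↔ diffMap (K0.map (Unitization.starMap ρ₁))
        (K0.map (Unitization.starMap ρ₂)) ((x.1 : K0 (Unitization ℂ B₁)),
          (x.2 : K0 (Unitization ℂ B₂))) = 0 := Subtype.ext_iff
    rw [hx, h1]
    constructor
    · rintro ⟨y, hy⟩
      refine ⟨NK0.proj B y, Prod.ext ?_ ?_⟩
      · change NK0.map q₁ (NK0.proj B y) = x.1
        rw [NK0.map_proj, ← NK0.proj_coe x.1]
        exact congrArg _ (congrArg Prod.fst hy)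
      · change NK0.map q₂ (NK0.proj B y) = x.2
        rw [NK0.map_proj, ← NK0.proj_coe x.2]
        exact congrArg _ (congrArg Prod.snd hy)
    · rintro ⟨y, rfl⟩
      exact ⟨y, rfl⟩
  · refine (h2 x).trans ⟨?_, ?_⟩
    · rintro ⟨y, hy⟩
      refine ⟨(NK0.proj B₁ y.1, NK0.proj B₂ y.2), ?_⟩
      change NK0.map ρ₂ (NK0.proj B₂ y.2) - NK0.map ρ₁ (NK0.proj B₁ y.1) = x
      rw [NK0.map_proj, NK0.map_proj, ← map_sub, ← NK0.proj_coe x]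
      exact congrArg _ hy
    · rintro ⟨y, rfl⟩
      exact ⟨(y.1, y.2), rfl⟩
  · refine (h3 x).trans ⟨?_, ?_⟩
    · rintro ⟨y, rfl⟩
      exact ⟨NK0.proj B₁₂ y, nBottMap_proj hB hs y⟩
    · rintro ⟨y, rfl⟩
      exact ⟨y, rfl⟩
  · exact (Subtype.ext_iff (a1 := nMilnorMap hB hs x) (a2 := 0)).trans (h5 x)
  · have hx : (NK0.map q₁).prod (NK0.map q₂) x = 0 ↔ (K0.map (Unitization.starMap q₁)).prod
        (K0.map (Unitization.starMap q₂)) (x : K0 (Unitization ℂ B)) = 0 := by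
      rw [Prod.ext_iff, Prod.ext_iff]
      exact and_congr Subtype.ext_iff Subtype.ext_iff
    rw [hx, h6]
    exact exists_congr fun y => (Subtype.ext_iff (a1 := nMilnorMap hB hs y) (a2 := x)).symm

variable {A A₁ A₂ A₁₂ : Type*} [NonUnitalCStarAlgebra A] [NonUnitalCStarAlgebra A₁]
  [NonUnitalCStarAlgebra A₂] [NonUnitalCStarAlgebra A₁₂]
  {p₁ : A →⋆ₙₐ[ℂ] A₁} {p₂ : A →⋆ₙₐ[ℂ] A₂} {π₁ : A₁ →⋆ₙₐ[ℂ] A₁₂} {π₂ : A₂ →⋆ₙₐ[ℂ] A₁₂}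
  {φ : A →⋆ₙₐ[ℂ] B} {φ₁ : A₁ →⋆ₙₐ[ℂ] B₁} {φ₂ : A₂ →⋆ₙₐ[ℂ] B₂} {φ₁₂ : A₁₂ →⋆ₙₐ[ℂ] B₁₂}

theorem nSixTermMorphism (hA : IsPullbackSquare p₁ p₂ π₁ π₂) (hπ : Function.Surjective π₂)
    (hB : IsPullbackSquare q₁ q₂ ρ₁ ρ₂) (hs : Function.Surjective ρ₂)
    (h1 : q₁.comp φ = φ₁.comp p₁) (h2 : q₂.comp φ = φ₂.comp p₂)
    (h3 : φ₁₂.comp π₁ = ρ₁.comp φ₁) (h4 : φ₁₂.comp π₂ = ρ₂.comp φ₂) :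
    SixTermMorphism
      ((NK0.map p₁).prod (NK0.map p₂)) (diffMap (NK0.map π₁) (NK0.map π₂)) (nBottMap hA hπ)
      ((NK1.map p₁).prod (NK1.map p₂)) (diffMap (NK1.map π₁) (NK1.map π₂)) (nMilnorMap hA hπ)
      ((NK0.map q₁).prod (NK0.map q₂)) (diffMap (NK0.map ρ₁) (NK0.map ρ₂)) (nBottMap hB hs)
      ((NK1.map q₁).prod (NK1.map q₂)) (diffMap (NK1.map ρ₁) (NK1.map ρ₂)) (nMilnorMap hB hs)
      (NK0.map φ) ((NK0.map φ₁).prodMap (NK0.map φ₂)) (NK0.map φ₁₂)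
      (NK1.map φ) ((NK1.map φ₁).prodMap (NK1.map φ₂)) (NK1.map φ₁₂) := by
  obtain ⟨m1, m2, m3, m4, m5, m6⟩ := sixTermMorphism
    hA.unitization (Unitization.starMap_surjective hπ)
    hB.unitization (Unitization.starMap_surjective hs)
    (by rw [← Unitization.starMap_comp, ← Unitization.starMap_comp, h1])
    (by rw [← Unitization.starMap_comp, ← Unitization.starMap_comp, h2])
    (by rw [← Unitization.starMap_comp, ← Unitization.starMap_comp, h3])
    (by rw [← Unitization.starMap_comp, ← Unitization.starMap_comp, h4])
  refine ⟨AddMonoidHom.ext fun x => ?_, AddMonoidHom.ext fun x => Subtype.ext ?_,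
    AddMonoidHom.ext fun x => ?_, m4, m5, AddMonoidHom.ext fun x => Subtype.ext ?_⟩
  · have := DFunLike.congr_fun m1 (x : K0 (Unitization ℂ A))
    exact Prod.ext (Subtype.ext (congrArg Prod.fst this)) (Subtype.ext (congrArg Prod.snd this))
  · exact DFunLike.congr_fun m2 ((x.1 : K0 (Unitization ℂ A₁)), (x.2 : K0 (Unitization ℂ A₂)))
  · exact DFunLike.congr_fun m3 (x : K0 (Unitization ℂ A₁₂))
  · exact DFunLike.congr_fun m6 x

end NonUnital

end CStarK

end

/-! ### Assembly of the unital and the general case -/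

theorem theorem2p2 :
    (∀ (A A₁ A₂ A₁₂ B B₁ B₂ B₁₂ : Type*)
      [CStarAlgebra A] [CStarAlgebra A₁] [CStarAlgebra A₂]
      [CStarAlgebra A₁₂] [CStarAlgebra B] [CStarAlgebra B₁]
      [CStarAlgebra B₂] [CStarAlgebra B₁₂]
      (p₁ : A →⋆ₐ[ℂ] A₁) (p₂ : A →⋆ₐ[ℂ] A₂) (π₁ : A₁ →⋆ₐ[ℂ] A₁₂) (π₂ : A₂ →⋆ₐ[ℂ] A₁₂)
      (q₁ : B →⋆ₐ[ℂ] B₁) (q₂ : B →⋆ₐ[ℂ] B₂) (ρ₁ : B₁ →⋆ₐ[ℂ] B₁₂) (ρ₂ : B₂ →⋆ₐ[ℂ] B₁₂)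
      (φ₁ : A₁ →⋆ₐ[ℂ] B₁) (φ₂ : A₂ →⋆ₐ[ℂ] B₂) (φ₁₂ : A₁₂ →⋆ₐ[ℂ] B₁₂),
      IsPullbackSquare p₁ p₂ π₁ π₂ → IsPullbackSquare q₁ q₂ ρ₁ ρ₂ →
      Function.Surjective π₂ → Function.Surjective ρ₂ →
      φ₁₂.comp π₁ = ρ₁.comp φ₁ → φ₁₂.comp π₂ = ρ₂.comp φ₂ →
      (∃! φ : A →⋆ₐ[ℂ] B, q₁.comp φ = φ₁.comp p₁ ∧ q₂.comp φ = φ₂.comp p₂) ∧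
      (∃! D : K1 A₁₂ →+ K0 A, IsMilnorMap p₁ p₂ π₂ D) ∧
      (∃! D : K0 A₁₂ →+ K1 A, IsBottMap p₁ p₂ π₂ D) ∧
      (∃! D : K1 B₁₂ →+ K0 B, IsMilnorMap q₁ q₂ ρ₂ D) ∧
      (∃! D : K0 B₁₂ →+ K1 B, IsBottMap q₁ q₂ ρ₂ D) ∧
      ∀ (φ : A →⋆ₐ[ℂ] B) (D₁₀ : K1 A₁₂ →+ K0 A) (D₀₁ : K0 A₁₂ →+ K1 A)
        (D₁₀' : K1 B₁₂ →+ K0 B) (D₀₁' : K0 B₁₂ →+ K1 B),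
        q₁.comp φ = φ₁.comp p₁ → q₂.comp φ = φ₂.comp p₂ →
        IsMilnorMap p₁ p₂ π₂ D₁₀ → IsBottMap p₁ p₂ π₂ D₀₁ →
        IsMilnorMap q₁ q₂ ρ₂ D₁₀' → IsBottMap q₁ q₂ ρ₂ D₀₁' →
        SixTermExact
          ((K0.map p₁).prod (K0.map p₂)) (diffMap (K0.map π₁) (K0.map π₂)) D₀₁
          ((K1.map p₁).prod (K1.map p₂)) (diffMap (K1.map π₁) (K1.map π₂)) D₁₀ ∧
        SixTermExact
          ((K0.map q₁).prod (K0.map q₂)) (diffMap (K0.map ρ₁) (K0.map ρ₂)) D₀₁'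
          ((K1.map q₁).prod (K1.map q₂)) (diffMap (K1.map ρ₁) (K1.map ρ₂)) D₁₀' ∧
        SixTermMorphism
          ((K0.map p₁).prod (K0.map p₂)) (diffMap (K0.map π₁) (K0.map π₂)) D₀₁
          ((K1.map p₁).prod (K1.map p₂)) (diffMap (K1.map π₁) (K1.map π₂)) D₁₀
          ((K0.map q₁).prod (K0.map q₂)) (diffMap (K0.map ρ₁) (K0.map ρ₂)) D₀₁'
          ((K1.map q₁).prod (K1.map q₂)) (diffMap (K1.map ρ₁) (K1.map ρ₂)) D₁₀'
          (K0.map φ) ((K0.map φ₁).prodMap (K0.map φ₂)) (K0.map φ₁₂)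
          (K1.map φ) ((K1.map φ₁).prodMap (K1.map φ₂)) (K1.map φ₁₂)) ∧
    (∀ (A A₁ A₂ A₁₂ B B₁ B₂ B₁₂ : Type*)
      [NonUnitalCStarAlgebra A] [NonUnitalCStarAlgebra A₁] [NonUnitalCStarAlgebra A₂]
      [NonUnitalCStarAlgebra A₁₂] [NonUnitalCStarAlgebra B] [NonUnitalCStarAlgebra B₁]
      [NonUnitalCStarAlgebra B₂] [NonUnitalCStarAlgebra B₁₂]
      (p₁ : A →⋆ₙₐ[ℂ] A₁) (p₂ : A →⋆ₙₐ[ℂ] A₂) (π₁ : A₁ →⋆ₙₐ[ℂ] A₁₂) (π₂ : A₂ →⋆ₙₐ[ℂ] A₁₂)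
      (q₁ : B →⋆ₙₐ[ℂ] B₁) (q₂ : B →⋆ₙₐ[ℂ] B₂) (ρ₁ : B₁ →⋆ₙₐ[ℂ] B₁₂) (ρ₂ : B₂ →⋆ₙₐ[ℂ] B₁₂)
      (φ₁ : A₁ →⋆ₙₐ[ℂ] B₁) (φ₂ : A₂ →⋆ₙₐ[ℂ] B₂) (φ₁₂ : A₁₂ →⋆ₙₐ[ℂ] B₁₂),
      IsPullbackSquare p₁ p₂ π₁ π₂ → IsPullbackSquare q₁ q₂ ρ₁ ρ₂ →
      Function.Surjective π₂ → Function.Surjective ρ₂ →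
      φ₁₂.comp π₁ = ρ₁.comp φ₁ → φ₁₂.comp π₂ = ρ₂.comp φ₂ →
      (∃! φ : A →⋆ₙₐ[ℂ] B, q₁.comp φ = φ₁.comp p₁ ∧ q₂.comp φ = φ₂.comp p₂) ∧
      (∃! D : NK1 A₁₂ →+ NK0 A, IsNMilnorMap p₁ p₂ π₂ D) ∧
      (∃! D : NK0 A₁₂ →+ NK1 A, IsNBottMap p₁ p₂ π₂ D) ∧
      (∃! D : NK1 B₁₂ →+ NK0 B, IsNMilnorMap q₁ q₂ ρ₂ D) ∧
      (∃! D : NK0 B₁₂ →+ NK1 B, IsNBottMap q₁ q₂ ρ₂ D) ∧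
      ∀ (φ : A →⋆ₙₐ[ℂ] B) (D₁₀ : NK1 A₁₂ →+ NK0 A) (D₀₁ : NK0 A₁₂ →+ NK1 A)
        (D₁₀' : NK1 B₁₂ →+ NK0 B) (D₀₁' : NK0 B₁₂ →+ NK1 B),
        q₁.comp φ = φ₁.comp p₁ → q₂.comp φ = φ₂.comp p₂ →
        IsNMilnorMap p₁ p₂ π₂ D₁₀ → IsNBottMap p₁ p₂ π₂ D₀₁ →
        IsNMilnorMap q₁ q₂ ρ₂ D₁₀' → IsNBottMap q₁ q₂ ρ₂ D₀₁' →
        SixTermExact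
          ((NK0.map p₁).prod (NK0.map p₂)) (diffMap (NK0.map π₁) (NK0.map π₂)) D₀₁
          ((NK1.map p₁).prod (NK1.map p₂)) (diffMap (NK1.map π₁) (NK1.map π₂)) D₁₀ ∧
        SixTermExact
          ((NK0.map q₁).prod (NK0.map q₂)) (diffMap (NK0.map ρ₁) (NK0.map ρ₂)) D₀₁'
          ((NK1.map q₁).prod (NK1.map q₂)) (diffMap (NK1.map ρ₁) (NK1.map ρ₂)) D₁₀' ∧
        SixTermMorphism
          ((NK0.map p₁).prod (NK0.map p₂)) (diffMap (NK0.map π₁) (NK0.map π₂)) D₀₁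
          ((NK1.map p₁).prod (NK1.map p₂)) (diffMap (NK1.map π₁) (NK1.map π₂)) D₁₀
          ((NK0.map q₁).prod (NK0.map q₂)) (diffMap (NK0.map ρ₁) (NK0.map ρ₂)) D₀₁'
          ((NK1.map q₁).prod (NK1.map q₂)) (diffMap (NK1.map ρ₁) (NK1.map ρ₂)) D₁₀'
          (NK0.map φ) ((NK0.map φ₁).prodMap (NK0.map φ₂)) (NK0.map φ₁₂)
          (NK1.map φ) ((NK1.map φ₁).prodMap (NK1.map φ₂)) (NK1.map φ₁₂)) := by
  refine ⟨?_, ?_⟩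
  · intro A A₁ A₂ A₁₂ B B₁ B₂ B₁₂ _ _ _ _ _ _ _ _ p₁ p₂ π₁ π₂ q₁ q₂ ρ₁ ρ₂ φ₁ φ₂ φ₁₂
      hA hB hπ hρ h3 h4
    refine ⟨hB.existsUnique_starAlgHom fun a => ?_,
      ⟨_, isMilnorMap_milnorMap hA hπ, fun D => IsMilnorMap.eq hA hπ⟩,
      ⟨_, isBottMap_bottMap hA hπ, fun D => IsBottMap.eq hA hπ⟩,
      ⟨_, isMilnorMap_milnorMap hB hρ, fun D => IsMilnorMap.eq hB hρ⟩,
      ⟨_, isBottMap_bottMap hB hρ, fun D => IsBottMap.eq hB hρ⟩, ?_⟩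
    · exact (DFunLike.congr_fun h3 (p₁ a)).symm.trans
        ((congrArg φ₁₂ (hA.1 a)).trans (DFunLike.congr_fun h4 (p₂ a)))
    · intro φ D₁₀ D₀₁ D₁₀' D₀₁' h1 h2 hM hb hM' hb'
      rw [hM.eq hA hπ, hb.eq hA hπ, hM'.eq hB hρ, hb'.eq hB hρ]
      exact ⟨sixTermExact hA hπ, sixTermExact hB hρ, sixTermMorphism hA hπ hB hρ h1 h2 h3 h4⟩
  · intro A A₁ A₂ A₁₂ B B₁ B₂ B₁₂ _ _ _ _ _ _ _ _ p₁ p₂ π₁ π₂ q₁ q₂ ρ₁ ρ₂ φ₁ φ₂ φ₁₂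
      hA hB hπ hρ h3 h4
    refine ⟨hB.existsUnique_nonUnitalStarAlgHom fun a => ?_,
      ⟨_, isNMilnorMap_nMilnorMap hA hπ, fun D => IsNMilnorMap.eq hA hπ⟩,
      ⟨_, isNBottMap_nBottMap hA hπ, fun D => IsNBottMap.eq hA hπ⟩,
      ⟨_, isNMilnorMap_nMilnorMap hB hρ, fun D => IsNMilnorMap.eq hB hρ⟩,
      ⟨_, isNBottMap_nBottMap hB hρ, fun D => IsNBottMap.eq hB hρ⟩, ?_⟩
    · exact (DFunLike.congr_fun h3 (p₁ a)).symm.trans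
        ((congrArg φ₁₂ (hA.1 a)).trans (DFunLike.congr_fun h4 (p₂ a)))
    · intro φ D₁₀ D₀₁ D₁₀' D₀₁' h1 h2 hM hb hM' hb'
      rw [hM.eq hA hπ, hb.eq hA hπ, hM'.eq hB hρ, hb'.eq hB hρ]
      exact ⟨nSixTermExact hA hπ, nSixTermExact hB hρ, nSixTermMorphism hA hπ hB hρ h1 h2 h3 h4⟩
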